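/- Let $a,p,\kappa>0$ be real, $f(y)=-a|y|^p y$ and $F(y)=\int_0^y f(\tau)\,d\tau$. Consider real-valued solutions $u(x,t)$, $x\in\mathbb R$, of $$u_{tt}=\big(u-u_{xx}+u_{tt}-\kappa u_{xxtt}+f(u)\big)_{xx},\qquad u(0)=u_0,\quad u_t(0)=u_1. \tag{1}$$ Let $H^s=H^s(\mathbb R)$ be the real Sobolev space with norm $\|v\|_s=\|(1-\partial_x^2)^{s/2}v\|_{L^2}$ (so $\|v\|_1^2=\|v\|_{L^2}^2+\|v_x\|_{L^2}^2$), let $\langle\cdot,\cdot\rangle$ be the $L^2$ inner product, and let $(-\partial_x^2)^{-1/2}$ be the Fourier multiplier $|\xi|^{-1}$. A solution of (1) in $C^2(I;H^s)$, $I=[0,T)$ or $I=[0,\infty)$, satisfies the equation in the sense of distributions in $x$ at every $t\in I$. Put $$E(u(0))=\tfrac12\Big(\|(-\partial_x^2)^{-1/2}u_1\|_{L^2}^2+\|u_1\|_{L^2}^2+\kappa\|(u_1)_x\|_{L^2}^2+\|u_0\|_{L^2}^2+\|(u_0)_x\|_{L^2}^2\Big)+\int_{\mathbb R}F(u_0)\,dx,$$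 $$\varphi(x)=\Big(\tfrac{p+2}{2}\Big)^{1/p}\operatorname{sech}^{2/p}\Big(\tfrac{px}{2}\Big),\qquad C_*=\|\varphi\|_1^{-p/(p+2)},\qquad e_0=\frac{p}{2(p+2)}\,a^{-2/p}\,C_*^{-2(p+2)/p}.$$ **Theorem.** Let $s$ be real with $1\le s\le [p]+3$ ($[p]$ the integer part of $p$), let $u_0,u_1\in H^s$ with $(-\partial_x^2)^{-1/2}u_1\in H^{s+1}$, and suppose that $E(u(0))\le e_0$. 1. If $\|u_0\|_1^2\le \frac{2(p+2)}{p}e_0$, then the solution of (1) exists globally: there is a solution $u\in C^2([0,\infty);H^s)$, and every solution of (1) in $C^2([0,T);H^s)$, $T>0$, coincides with $u$ on $[0,T)$. 2. If $\|u_0\|_1^2>\frac{2(p+2)}{p}e_0$ and, in the case $E(u(0))=e_0$, in addition $(-\partial_x^2)^{-1/2}u_0\in L^2$ and $$\big\langle(-\partial_x^2)^{-1/2}u_0,(-\partial_x^2)^{-1/2}u_1\big\rangle+\kappa\langle (u_0)_x,(u_1)_x\rangle+\langle u_0,u_1\rangle\ge 0,$$ then the solution of (1) blows up in finite time: there are $0<T<\infty$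 and a solution $u\in C^2([0,T);H^s)$ with $$\sup_{0\le t<T}\big(\|u(t)\|_s+\|u_t(t)\|_s\big)=+\infty,$$ and every solution of (1) in $C^2([0,T');H^s)$, $T'>0$, satisfies $T'\le T$ and coincides with $u$ on $[0,T')$. -/

import Mathlib

open MeasureTheory Set
open scoped FourierTransform ContDiff

noncomputable section

namespace GBq

/-- Real-valued square-integrable functions on the line (modulo equality almost everywhere). -/
abbrev L2 : Type := Lp ℝ 2 (volume : Measure ℝ)

/-- The `L²` Fourier transform of a real-valued function, in Mathlib's normalization
`û(ξ) = ∫ u(x) exp(-2πi x ξ) dx`. The derivative `∂ₓ` corresponds to multiplication by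
`i k` with `k = 2πξ`, and Plancherel's identity holds without a constant. -/
def hat : L2 →ₗ[ℝ] Lp ℂ 2 (volume : Measure ℝ) :=
  (Lp.fourierTransformₗᵢ ℝ ℂ).toLinearEquiv.toLinearMap.restrictScalars ℝ ∘ₗ
    (Complex.ofRealCLM.compLpL 2 volume).toLinearMap

lemma hat_apply (u : L2) : hat u = 𝓕 (Complex.ofRealCLM.compLpL 2 volume u) := rfl

/-- The Fourier side of `m(D) u`: the function `ξ ↦ m(2πξ) û(ξ)`, for a real symbol `m`. -/
def symbolMul (m : ℝ → ℝ) (u : L2) : ℝ → ℂ :=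
  fun ξ => m (2 * Real.pi * ξ) • (hat u : ℝ → ℂ) ξ

/-- The symbol `(1 + k²)^(s/2)` of `(1 - ∂ₓ²)^(s/2)`. -/
def besselSymbol (s : ℝ) : ℝ → ℝ := fun k => (1 + k ^ 2) ^ (s / 2)

lemma besselSymbol_pos (s k : ℝ) : 0 < besselSymbol s k :=
  Real.rpow_pos_of_pos (by positivity) _

lemma symbolMul_add (m : ℝ → ℝ) (u v : L2) :
    symbolMul m (u + v) =ᵐ[volume] symbolMul m u + symbolMul m v := by
  have h := Lp.coeFn_add (hat u) (hat v)
  filter_upwards [h] with ξ hξ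
  simp only [symbolMul, map_add, hξ, Pi.add_apply, smul_add]

lemma symbolMul_smul (m : ℝ → ℝ) (c : ℝ) (u : L2) :
    symbolMul m (c • u) =ᵐ[volume] c • symbolMul m u := by
  have h := Lp.coeFn_smul c (hat u)
  filter_upwards [h] with ξ hξ
  simp only [symbolMul, map_smul, hξ, Pi.smul_apply]
  rw [smul_comm]

lemma symbolMul_zero (m : ℝ → ℝ) : symbolMul m 0 =ᵐ[volume] 0 := by
  have h := Lp.coeFn_zero ℂ 2 (volume : Measure ℝ)
  filter_upwards [h] with ξ hξ
  simp only [symbolMul, map_zero, hξ, Pi.zero_apply, smul_zero]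

/-- The Sobolev norm `‖u‖_r = ‖(1 - ∂ₓ²)^(r/2) u‖_{L²} = (∫ (1 + k²)^r |û|²)^(1/2)` of an
element `u` of `H^r(ℝ)`; in particular `‖u‖_1² = ‖u‖² + ‖u_x‖²`. -/
def sobolevNorm (r : ℝ) (u : L2) : ℝ :=
  (eLpNorm (symbolMul (besselSymbol r) u) 2 volume).toReal

/-- `H^s(ℝ)`, `s ≥ 0`, as a subspace of `L²(ℝ)`: those `u` with `(1 + k²)^(s/2) û ∈ L²`. -/
def sobolevSubmodule (s : ℝ) : Submodule ℝ L2 where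
  carrier := {u | MemLp (symbolMul (besselSymbol s) u) 2 volume}
  zero_mem' := (memLp_congr_ae (symbolMul_zero _)).2 MemLp.zero
  add_mem' hu hv := (memLp_congr_ae (symbolMul_add _ _ _)).2 (hu.add hv)
  smul_mem' c _ hu := (memLp_congr_ae (symbolMul_smul _ c _)).2 (hu.const_smul c)

/-- The real Sobolev space `H^s(ℝ)`, `s ≥ 0`. It is a separate type because it carries its own
norm, not the one of `L²`. -/
def Hs (s : ℝ) : Type := sobolevSubmodule s

instance (s : ℝ) : AddCommGroup (Hs s) := inferInstanceAs (AddCommGroup (sobolevSubmodule s))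

instance (s : ℝ) : Module ℝ (Hs s) := inferInstanceAs (Module ℝ (sobolevSubmodule s))

/-- The underlying function of an element of `H^s(ℝ)`. -/
def Hs.toL2 {s : ℝ} (u : Hs s) : L2 := Subtype.val (p := fun v => v ∈ sobolevSubmodule s) u

lemma Hs.memLp {s : ℝ} (u : Hs s) : MemLp (symbolMul (besselSymbol s) u.toL2) 2 volume :=
  Subtype.property (p := fun v => v ∈ sobolevSubmodule s) u

/-- `u ↦ (1 + k²)^(s/2) û`, as a linear map from `H^s(ℝ)` to `L²`. -/
def besselMap (s : ℝ) : Hs s →ₗ[ℝ] Lp ℂ 2 (volume : Measure ℝ) where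
  toFun u := u.memLp.toLp
  map_add' u v := by
    rw [← MemLp.toLp_add]
    exact MemLp.toLp_congr _ _ (symbolMul_add _ u.toL2 v.toL2)
  map_smul' c u := by
    rw [RingHom.id_apply, ← MemLp.toLp_const_smul]
    exact MemLp.toLp_congr _ _ (symbolMul_smul _ c u.toL2)

lemma besselMap_injective (s : ℝ) : Function.Injective (besselMap s) := by
  rw [injective_iff_map_eq_zero]
  intro u hu
  have h1 : symbolMul (besselSymbol s) u.toL2 =ᵐ[volume] 0 := by
    have h : u.memLp.toLp = 0 := hu
    have h2 := u.memLp.coeFn_toLp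
    rw [h] at h2
    exact h2.symm.trans (Lp.coeFn_zero ℂ 2 (volume : Measure ℝ))
  have h2 : hat u.toL2 = 0 := by
    refine Lp.ext (Filter.EventuallyEq.trans ?_ (Lp.coeFn_zero ℂ 2 (volume : Measure ℝ)).symm)
    filter_upwards [h1] with ξ hξ
    simpa [symbolMul, (besselSymbol_pos s _).ne'] using hξ
  have h3 : Complex.ofRealCLM.compLpL 2 volume u.toL2 = 0 := by
    have h : Lp.fourierTransformₗᵢ ℝ ℂ (Complex.ofRealCLM.compLpL 2 volume u.toL2) = 0 := h2
    simpa using h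
  have h4 : u.toL2 = 0 := by
    refine Lp.ext (Filter.EventuallyEq.trans ?_ (Lp.coeFn_zero ℝ 2 (volume : Measure ℝ)).symm)
    have h5 := Complex.ofRealCLM.coeFn_compLpL (μ := volume) u.toL2
    rw [h3] at h5
    filter_upwards [h5, Lp.coeFn_zero ℂ 2 (volume : Measure ℝ)] with x hx hx0
    rw [hx0] at hx
    simpa using hx.symm
  exact Subtype.ext h4

/-- The norm of `H^s(ℝ)` is `‖u‖_s = ‖(1 + k²)^(s/2) û‖_{L²}`. -/
instance (s : ℝ) : NormedAddCommGroup (Hs s) :=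
  NormedAddCommGroup.induced (Hs s) (Lp ℂ 2 (volume : Measure ℝ)) (besselMap s)
    (besselMap_injective s)

instance (s : ℝ) : NormedSpace ℝ (Hs s) :=
  NormedSpace.induced ℝ (Hs s) (Lp ℂ 2 (volume : Measure ℝ)) (besselMap s)

lemma Hs.norm_eq {s : ℝ} (u : Hs s) : ‖u‖ = sobolevNorm s u.toL2 :=
  Lp.norm_toLp _ u.memLp

/-- `(-∂ₓ²)^(-1/2) u ∈ H^r(ℝ)`, that is, `(1 + k²)^(r/2) |k|⁻¹ û ∈ L²`. (The value of the symbol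
at the single frequency `k = 0` is irrelevant.) -/
def InvSqrtLaplacianMem (r : ℝ) (u : L2) : Prop :=
  MemLp (symbolMul (fun k => besselSymbol r k * |k|⁻¹) u) 2 volume

/-- `⟨m(D) u, m(D) v⟩_{L²}` for a real symbol `m`, computed on the Fourier side. The cases used are
`m = 1`, giving `⟨u, v⟩`; `m(k) = |k|`, giving `⟨u_x, v_x⟩`; and `m(k) = |k|⁻¹`, giving
`⟨(-∂ₓ²)^(-1/2) u, (-∂ₓ²)^(-1/2) v⟩`. -/
def pairing (m : ℝ → ℝ) (u v : L2) : ℝ :=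
  ∫ ξ, (symbolMul m u ξ * (starRingEnd ℂ) (symbolMul m v ξ)).re

/-- `⟨(-∂ₓ²)^(-1/2) u, (-∂ₓ²)^(-1/2) v⟩ + κ ⟨u_x, v_x⟩ + ⟨u, v⟩`. -/
def kineticPairing (κ : ℝ) (u v : L2) : ℝ :=
  pairing (fun k => |k|⁻¹) u v + κ * pairing (fun k => |k|) u v + pairing (fun _ => 1) u v

/-- The nonlinearity `f(y) = -a |y|^p y`. -/
def nonlin (a p y : ℝ) : ℝ := -a * |y| ^ p * y

/-- `F(y) = ∫₀^y f`. -/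
def nonlinPrim (a p y : ℝ) : ℝ := ∫ τ in (0 : ℝ)..y, nonlin a p τ

/-- The energy of the state `(u, u_t) = (u, v)`,
`½ (‖(-∂ₓ²)^(-1/2) v‖² + ‖v‖² + κ ‖v_x‖² + ‖u‖² + ‖u_x‖²) + ∫ F(u)`. -/
def energy (κ a p : ℝ) (u v : L2) : ℝ :=
  (1 / 2) * (kineticPairing κ v v + pairing (fun _ => 1) u u + pairing (fun k => |k|) u u)
    + ∫ x, nonlinPrim a p (u x)

/-- `φ(x) = ((p+2)/2)^(1/p) sech^(2/p)(p x / 2)`. -/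
def groundState (p x : ℝ) : ℝ :=
  ((p + 2) / 2) ^ (1 / p) * (1 / Real.cosh (p * x / 2)) ^ (2 / p)

/-- `C_* = ‖φ‖_1^(-p/(p+2))`; the function `φ` is smooth and decays exponentially together with its
derivative, so its `H¹` norm is the classical expression. -/
def Cstar (p : ℝ) : ℝ :=
  (Real.sqrt ((∫ x, groundState p x ^ 2) + ∫ x, deriv (groundState p) x ^ 2)) ^ (-p / (p + 2))

/-- `e₀ = p / (2(p+2)) · a^(-2/p) · C_*^(-2(p+2)/p)`. -/
def e0 (a p : ℝ) : ℝ :=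
  p / (2 * (p + 2)) * a ^ (-2 / p) * Cstar p ^ (-2 * (p + 2) / p)

/-- `u` is a solution, in the class `C²(I; H^s(ℝ))`, on a time interval `I = [0, T)` or
`I = [0, ∞)`, of `u_tt = (u - u_xx + u_tt - κ u_xxtt + f(u))_xx`, `u(0) = u₀`, `u_t(0) = u₁`, where
`f(u) = -a |u|^p u`. The time derivatives are taken in the norm of `H^s(ℝ)` (one-sided at `t = 0`),
and the equation holds in the sense of distributions in `x` at each time of `I`. -/
structure IsSolution {s : ℝ} (κ a p : ℝ) (u₀ u₁ : Hs s) (I : Set ℝ) (u : ℝ → Hs s) : Prop where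
  contDiffOn : ContDiffOn ℝ 2 u I
  initial : u 0 = u₀
  initial_deriv : derivWithin u I 0 = u₁
  equation : ∀ t ∈ I, ∀ φ : ℝ → ℝ, ContDiff ℝ ∞ φ → HasCompactSupport φ →
    ∫ x, (derivWithin (derivWithin u I) I t).toL2 x * φ x =
      ∫ x, ((u t).toL2 x * (iteratedDeriv 2 φ x - iteratedDeriv 4 φ x)
        + (derivWithin (derivWithin u I) I t).toL2 x *
            (iteratedDeriv 2 φ x - κ * iteratedDeriv 4 φ x)
        + nonlin a p ((u t).toL2 x) * iteratedDeriv 2 φ x)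

end GBq

end

open MeasureTheory Set
open scoped FourierTransform ContDiff

noncomputable section

namespace GBq

/-! Dividing the equation by P(k)² = 1 + k² + κk⁴ on the Fourier side solves it for u_tt: its
transform is -k²(1+k²)P⁻² times that of u, minus k²P⁻² times that of f(u). Write u = JU with J =
(1-∂ₓ²)^{-1/2}, and let N be the multiplier |k|(1+k²)^{1/2}/P. Since N²J² has symbol k²/P², the
equation becomes the Hamiltonian system U' = NZ, Z' = -N(U + J f(JU)) on L² × L². The operator N is
bounded because κ > 0, and J maps L² into H¹ ⊂ L^∞, so the field is Lipschitz on balls and the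
system is an ODE, with maximal solutions (`LipOnBalls.exists_maximal`). In these variables ‖U‖ =
‖u‖_1, and the conserved energy is ½‖Z‖² + ½‖U‖² + G(U) with G(U) = ∫F(JU).

The threshold comes from the inequality ‖v‖_{p+2} ≤ C_*‖v‖_1 with the ground state constant
(`IsPrim.integral_rpow_le`). It is proved without rearrangement or minimizers: completing a square
bounds ‖v‖_1² from below through the maximal amplitude of v, and the amplitude is then optimized
away. With y₀² = 2(p+2)e₀/p it reads -(p+2)G(U) ≤ ‖U‖²(‖U‖/y₀)^p (`neg_pot_le`). At energy at most
e₀ this bounds ‖Z‖² by a function of ‖U‖² vanishing to second order at y₀². Hence the derivative of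
‖U‖² - y₀² is at most a constant times its own modulus, and Gronwall's inequality shows that this
difference never changes sign, even at critical energy (`IsWell.eq_radius`). Starting in the well, U
stays bounded, hence so does Z, and the solution is global.

Above the well, suppose the solution is global and let Y' = Z with NY = U. Then the second
derivative of ‖Y‖² exceeds (4+β)‖Z‖² for some β > 0, and Levine's concavity argument applied to ‖Y‖²
gives a contradiction (`IsWell.false_of_convexity`). An initial Y with NY = U need not exist, since
N degenerates at k = 0. At subcritical energy it suffices that NY = U - W with W small, because the
energy gap absorbs the error and the range of N is dense. At critical energy there is no gap, which
is where the extra conditions on the data enter. Since bounded U forces bounded Z, it is ‖U‖ = ‖u‖_1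
that becomes unbounded.

It remains to pass between L² and H^s. The linear part is bounded, the forcing k²/P² gains two
derivatives, and f maps curves in H^{m+1} to curves in H^{m+1} for integers 0 ≤ m ≤ p. A bootstrap
then reaches every s ≤ [p]+3 on the whole lifespan of the L² flow (`exists_regular`), and every C²
solution in H^s follows that flow (`IsSolution.besselJ_eq`). -/

/-! ### Hermitian symmetry of the Fourier transform of a real function -/

/-- Complex conjugation on `L²(ℝ; ℂ)`. -/
def conjLp : Lp ℂ 2 (volume : Measure ℝ) →L[ℝ] Lp ℂ 2 (volume : Measure ℝ) :=
  (Complex.conjCLE : ℂ →L[ℝ] ℂ).compLpL 2 volume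

/-- The reflection `g ↦ g(-·)` on `L²(ℝ; ℂ)`. -/
def reflLp : Lp ℂ 2 (volume : Measure ℝ) →ₗᵢ[ℝ] Lp ℂ 2 (volume : Measure ℝ) :=
  Lp.compMeasurePreservingₗᵢ ℝ (fun x : ℝ => -x) (Measure.measurePreserving_neg volume)

lemma conjLp_coeFn (f : Lp ℂ 2 (volume : Measure ℝ)) :
    conjLp f =ᵐ[volume] fun x => (starRingEnd ℂ) (f x) :=
  (Complex.conjCLE : ℂ →L[ℝ] ℂ).coeFn_compLpL (μ := volume) f

lemma reflLp_coeFn (f : Lp ℂ 2 (volume : Measure ℝ)) :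
    reflLp f =ᵐ[volume] fun x => f (-x) :=
  Lp.coeFn_compMeasurePreserving f (Measure.measurePreserving_neg volume)

/-- On Schwartz functions this is conjugation of the Fourier integral; both sides are continuous in
f and Schwartz functions are dense. -/
lemma fourier_conjLp (f : Lp ℂ 2 (volume : Measure ℝ)) :
    𝓕 (conjLp f) = reflLp (conjLp (𝓕 f)) := by
  refine DenseRange.induction_on
    (p := fun f : Lp ℂ 2 (volume : Measure ℝ) => 𝓕 (conjLp f) = reflLp (conjLp (𝓕 f)))
    (SchwartzMap.denseRange_toLpCLM (E := ℝ) (F := ℂ) (p := 2) ENNReal.ofNat_ne_top) f ?_ ?_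
  · have hF : Continuous (fun g : Lp ℂ 2 (volume : Measure ℝ) => 𝓕 g) :=
      (Lp.fourierTransformₗᵢ ℝ ℂ).continuous
    exact isClosed_eq (hF.comp conjLp.continuous)
      (reflLp.continuous.comp (conjLp.continuous.comp hF))
  intro φ
  set ψ : SchwartzMap ℝ ℂ := SchwartzMap.postcompCLM (Complex.conjCLE : ℂ →L[ℝ] ℂ) φ with hψ
  have h1 : conjLp (φ.toLp 2) = ψ.toLp 2 := by
    apply Lp.ext
    filter_upwards [conjLp_coeFn (φ.toLp 2), φ.coeFn_toLp 2, ψ.coeFn_toLp 2] with x h1 h2 h3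
    rw [h1, h2, h3, hψ, SchwartzMap.postcompCLM_apply]
    rfl
  rw [SchwartzMap.toLpCLM_apply, h1, SchwartzMap.toLp_fourier_eq, SchwartzMap.toLp_fourier_eq]
  apply Lp.ext
  have h4 := (Measure.measurePreserving_neg (volume : Measure ℝ)).quasiMeasurePreserving.ae
    ((conjLp_coeFn ((𝓕 φ).toLp 2)).and ((𝓕 φ).coeFn_toLp 2 volume))
  filter_upwards [(𝓕 ψ).coeFn_toLp 2 volume, reflLp_coeFn (conjLp ((𝓕 φ).toLp 2)), h4] with x h1 h2 h4
  rw [h1, h2, h4.1, h4.2, SchwartzMap.fourier_coe, SchwartzMap.fourier_coe, Real.fourier_eq',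
    Real.fourier_eq', ← integral_conj]
  congr 1
  ext v
  rw [hψ, SchwartzMap.postcompCLM_apply]
  have h2 : (starRingEnd ℂ) 2 = 2 := map_ofNat _ 2
  simp [← Complex.exp_conj, h2]

/-- The inclusion `L²(ℝ; ℝ) → L²(ℝ; ℂ)`. -/
def toC : L2 →L[ℝ] Lp ℂ 2 (volume : Measure ℝ) := Complex.ofRealCLM.compLpL 2 volume

lemma toC_coeFn (u : L2) : toC u =ᵐ[volume] fun x => (u x : ℂ) :=
  Complex.ofRealCLM.coeFn_compLpL (μ := volume) u

lemma hat_eq (u : L2) : hat u = 𝓕 (toC u) := rfl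

lemma norm_hat (u : L2) : ‖hat u‖ = ‖u‖ := by
  rw [hat_eq, Lp.norm_fourier_eq, Lp.norm_def, Lp.norm_def]
  congr 1
  rw [eLpNorm_congr_ae (toC_coeFn u)]
  exact eLpNorm_congr_norm_ae (by simp)

lemma hat_injective : Function.Injective hat := by
  rw [injective_iff_map_eq_zero]
  intro u hu
  rw [← norm_eq_zero, ← norm_hat, hu, norm_zero]

lemma hat_neg_ae (u : L2) : ∀ᵐ ξ, hat u (-ξ) = (starRingEnd ℂ) (hat u ξ) := by
  have h : conjLp (toC u) = toC u := by
    apply Lp.ext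
    filter_upwards [conjLp_coeFn (toC u), toC_coeFn u] with x h1 h2
    rw [h1, h2, Complex.conj_ofReal]
  have h2 := fourier_conjLp (toC u)
  rw [h, ← hat_eq] at h2
  have h4 := (Measure.measurePreserving_neg (volume : Measure ℝ)).quasiMeasurePreserving.ae
    (conjLp_coeFn (hat u))
  have h5 := reflLp_coeFn (conjLp (hat u))
  rw [← h2] at h5
  have h6 := (Measure.measurePreserving_neg (volume : Measure ℝ)).quasiMeasurePreserving.ae
    (h5.and h4)
  filter_upwards [h6] with ξ h6
  rw [h6.1]
  simpa using h6.2

/-- A function in `L²(ℝ; ℂ)` with Hermitian symmetry is the Fourier transform of a real one. -/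
lemma exists_hat_eq (g : Lp ℂ 2 (volume : Measure ℝ))
    (hg : ∀ᵐ ξ, g (-ξ) = (starRingEnd ℂ) (g ξ)) : ∃ u : L2, hat u = g := by
  set f : Lp ℂ 2 (volume : Measure ℝ) := 𝓕⁻ g with hf
  have hfg : 𝓕 f = g := FourierTransform.fourier_fourierInv_eq g
  -- Hermitian symmetry of g makes its inverse transform f invariant under conjugation, hence real.
  have h1 : conjLp f = f := by
    apply (Lp.fourierTransformₗᵢ ℝ ℂ).injective
    change 𝓕 (conjLp f) = 𝓕 f
    rw [fourier_conjLp, hfg]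
    apply Lp.ext
    have h4 := (Measure.measurePreserving_neg (volume : Measure ℝ)).quasiMeasurePreserving.ae
      (conjLp_coeFn g)
    filter_upwards [reflLp_coeFn (conjLp g), h4, hg] with ξ h1 h2 h3
    rw [h1, h2, h3, Complex.conj_conj]
  refine ⟨Complex.reCLM.compLpL 2 volume f, ?_⟩
  rw [hat_eq, ← hfg]
  congr 1
  apply Lp.ext
  have h2 := conjLp_coeFn f
  rw [h1] at h2
  filter_upwards [toC_coeFn (Complex.reCLM.compLpL 2 volume f),
    Complex.reCLM.coeFn_compLpL (μ := volume) f, h2] with x h3 h4 h5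
  rw [h3, h4]
  exact (Complex.conj_eq_iff_re.1 h5.symm)

lemma re_integral_inner (f g : Lp ℂ 2 (volume : Measure ℝ)) :
    (∫ ξ, inner ℂ (f ξ) (g ξ)).re = ∫ ξ, (inner ℂ (f ξ) (g ξ)).re :=
  (integral_re (𝕜 := ℂ) (L2.integrable_inner f g)).symm

lemma inner_eq_integral_hat (u v : L2) :
    inner ℝ u v = ∫ ξ, (hat u ξ * (starRingEnd ℂ) (hat v ξ)).re := by
  have h1 : inner ℂ (hat v) (hat u) = inner ℂ (toC v) (toC u) := by
    rw [hat_eq, hat_eq, Lp.inner_fourier_eq]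
  rw [L2.inner_def, L2.inner_def] at h1
  have h2 := congrArg Complex.re h1
  rw [re_integral_inner, re_integral_inner] at h2
  rw [L2.inner_def]
  refine Eq.trans ?_ h2.symm
  apply integral_congr_ae
  filter_upwards [toC_coeFn u, toC_coeFn v] with x h1 h2
  simp [h1, h2, mul_comm]

/-! ### Fourier multipliers on real `L²` -/

/-- `v = m(D) u`, that is, `v̂(ξ) = m(2πξ) û(ξ)` almost everywhere. -/
def HasMul (m : ℝ → ℂ) (u v : L2) : Prop :=
  ∀ᵐ ξ, hat v ξ = m (2 * Real.pi * ξ) * hat u ξ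

lemma HasMul.unique {m : ℝ → ℂ} {u v w : L2} (h : HasMul m u v) (h' : HasMul m u w) : v = w := by
  apply hat_injective
  apply Lp.ext
  filter_upwards [h, h'] with ξ h1 h2
  rw [h1, h2]

/-- One frequency is a null set, so symbols matter only off k = 0. This makes the singular symbol
|k|⁻¹ legitimate and leaves N(D) injective although its symbol vanishes at 0. -/
lemma HasMul.eq_of_ne_zero {m : ℝ → ℂ} {u v w : L2} (hm : ∀ k ≠ 0, m k ≠ 0)
    (h : HasMul m u w) (h' : HasMul m v w) : u = v := by
  apply hat_injective
  apply Lp.ext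
  filter_upwards [h, h', Measure.ae_ne volume (0 : ℝ)] with ξ h1 h2 h3
  exact mul_left_cancel₀ (hm (2 * Real.pi * ξ) (by simp [h3, Real.pi_ne_zero])) (h1.symm.trans h2)

lemma HasMul.congr {m m' : ℝ → ℂ} {u v : L2} (h : HasMul m u v) (hm : ∀ k ≠ 0, m k = m' k) :
    HasMul m' u v := by
  filter_upwards [h, Measure.ae_ne volume (0 : ℝ)] with ξ h1 h3
  rw [h1, hm _ (by simp [h3, Real.pi_ne_zero])]

lemma HasMul.comp {m m' m'' : ℝ → ℂ} {u v w : L2} (h : HasMul m u v) (h' : HasMul m' v w)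
    (hm : ∀ k ≠ 0, m' k * m k = m'' k) : HasMul m'' u w := by
  have h3 : HasMul (fun k => m' k * m k) u w := by
    filter_upwards [h, h'] with ξ h1 h2
    simp only [h2, h1, mul_assoc]
  exact h3.congr hm

lemma hasMul_one (u : L2) : HasMul (fun _ => 1) u u := by
  simp [HasMul]

lemma HasMul.add {m : ℝ → ℂ} {u v u' v' : L2} (h : HasMul m u v) (h' : HasMul m u' v') :
    HasMul m (u + u') (v + v') := by
  have e1 := Lp.coeFn_add (hat u) (hat u')
  have e2 := Lp.coeFn_add (hat v) (hat v')
  unfold HasMul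
  rw [map_add, map_add]
  filter_upwards [h, h', e1, e2] with ξ h1 h2 e1 e2
  rw [e1, e2, Pi.add_apply, Pi.add_apply, h1, h2, mul_add]

lemma HasMul.smul {m : ℝ → ℂ} {u v : L2} (c : ℝ) (h : HasMul m u v) :
    HasMul m (c • u) (c • v) := by
  have e1 := Lp.coeFn_smul c (hat u)
  have e2 := Lp.coeFn_smul c (hat v)
  unfold HasMul
  rw [map_smul, map_smul]
  filter_upwards [h, e1, e2] with ξ h1 e1 e2
  rw [e1, e2, Pi.smul_apply, Pi.smul_apply, h1, mul_smul_comm]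

lemma HasMul.sub {m : ℝ → ℂ} {u v u' v' : L2} (h : HasMul m u v) (h' : HasMul m u' v') :
    HasMul m (u - u') (v - v') := by
  have := h.add (h'.smul (-1))
  simpa [sub_eq_add_neg] using this

lemma HasMul.add_symbol {m m' : ℝ → ℂ} {u v v' : L2} (h : HasMul m u v) (h' : HasMul m' u v') :
    HasMul (fun k => m k + m' k) u (v + v') := by
  have e2 := Lp.coeFn_add (hat v) (hat v')
  unfold HasMul
  rw [map_add]
  filter_upwards [h, h', e2] with ξ h1 h2 e2
  rw [e2, Pi.add_apply, h1, h2, add_mul]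

/-- The multiplier `m` has Hermitian symmetry, so that `m(D)` preserves real functions. -/
structure IsHerm (m : ℝ → ℂ) : Prop where
  measurable : Measurable m
  neg : ∀ k, m (-k) = (starRingEnd ℂ) (m k)

lemma isHerm_ofReal {m : ℝ → ℝ} (hm : Measurable m) (h : ∀ k, m (-k) = m k) :
    IsHerm (fun k => (m k : ℂ)) :=
  ⟨Complex.measurable_ofReal.comp hm, fun k => by simp [h]⟩

lemma exists_hasMul {m : ℝ → ℂ} (hm : IsHerm m) (u : L2)
    (h : MemLp (fun ξ => m (2 * Real.pi * ξ) * hat u ξ) 2 volume) : ∃ v, HasMul m u v := by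
  obtain ⟨v, hv⟩ := exists_hat_eq h.toLp (by
    have h1 := h.coeFn_toLp
    have h2 := (Measure.measurePreserving_neg (volume : Measure ℝ)).quasiMeasurePreserving.ae h1
    filter_upwards [h1, h2, hat_neg_ae u] with ξ h1 h2 h3
    rw [h1, h2, h3, mul_neg, hm.neg, map_mul])
  exact ⟨v, by unfold HasMul; rw [hv]; exact h.coeFn_toLp⟩

lemma aestronglyMeasurable_symbol_mul {m : ℝ → ℂ} (hm : Measurable m) (u : L2) :
    AEStronglyMeasurable (fun ξ => m (2 * Real.pi * ξ) * hat u ξ) volume :=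
  ((hm.comp (measurable_const_mul _)).aestronglyMeasurable).mul (Lp.aestronglyMeasurable _)

/-- Domination by a multiplier already known to give an L² function. The symbol `m` may be
unbounded, as |k|⁻¹ is. -/
lemma exists_hasMul_of_le {m : ℝ → ℂ} (hm : IsHerm m) {u w : L2} {m' : ℝ → ℂ} (hw : HasMul m' u w)
    {C : ℝ} (hC : ∀ k ≠ 0, ‖m k‖ ≤ C * ‖m' k‖) : ∃ v, HasMul m u v := by
  refine exists_hasMul hm u ?_
  refine MemLp.of_le_mul (Lp.memLp (hat w)) (aestronglyMeasurable_symbol_mul hm.measurable u) (c := C) ?_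
  filter_upwards [hw, Measure.ae_ne volume (0 : ℝ)] with ξ h1 h3
  rw [h1, norm_mul, norm_mul, ← mul_assoc]
  gcongr
  exact hC _ (by simp [h3, Real.pi_ne_zero])

lemma HasMul.norm_le {m m' : ℝ → ℂ} {u v w : L2} (h : HasMul m u v) (hw : HasMul m' u w)
    {C : ℝ} (hC : ∀ k ≠ 0, ‖m k‖ ≤ C * ‖m' k‖) : ‖v‖ ≤ C * ‖w‖ := by
  rw [← norm_hat v, ← norm_hat w]
  refine Lp.norm_le_mul_norm_of_ae_le_mul ?_
  filter_upwards [h, hw, Measure.ae_ne volume (0 : ℝ)] with ξ h1 h2 h3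
  rw [h1, h2, norm_mul, norm_mul, ← mul_assoc]
  gcongr
  exact hC _ (by simp [h3, Real.pi_ne_zero])

/-- Bounded Hermitian symbols. -/
structure IsSymbol (m : ℝ → ℂ) : Prop extends IsHerm m where
  bdd : ∃ C, ∀ k, ‖m k‖ ≤ C

lemma IsSymbol.exists_hasMul {m : ℝ → ℂ} (hm : IsSymbol m) (u : L2) : ∃ v, HasMul m u v := by
  obtain ⟨C, hC⟩ := hm.bdd
  exact exists_hasMul_of_le hm.toIsHerm (hasMul_one u) (C := C) (by simpa using fun k _ => hC k)

open Classical in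
/-- The operator `m(D)` on real `L²`, for a bounded Hermitian symbol `m`. -/
def mulOp (m : ℝ → ℂ) : L2 →L[ℝ] L2 :=
  if hm : IsSymbol m then
    LinearMap.mkContinuousOfExistsBound
      { toFun := fun u => (hm.exists_hasMul u).choose
        map_add' := fun u v => (hm.exists_hasMul (u + v)).choose_spec.unique
          ((hm.exists_hasMul u).choose_spec.add (hm.exists_hasMul v).choose_spec)
        map_smul' := fun c u => (hm.exists_hasMul (c • u)).choose_spec.unique
          ((hm.exists_hasMul u).choose_spec.smul c) }
      (by
        obtain ⟨C, hC⟩ := hm.bdd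
        exact ⟨C, fun u => (hm.exists_hasMul u).choose_spec.norm_le (hasMul_one u)
          (by simpa using fun k _ => hC k)⟩)
  else 0

lemma hasMul_mulOp {m : ℝ → ℂ} (hm : IsSymbol m) (u : L2) : HasMul m u (mulOp m u) := by
  rw [mulOp, dif_pos hm]
  exact (hm.exists_hasMul u).choose_spec

/-- `m(D)` is symmetric for a real symbol `m`. -/
lemma HasMul.inner_symm {m : ℝ → ℂ} {u v u' v' : L2} (hm : ∀ k, (starRingEnd ℂ) (m k) = m k)
    (h : HasMul m u u') (h' : HasMul m v v') : (inner ℝ u' v : ℝ) = inner ℝ u v' := by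
  rw [inner_eq_integral_hat, inner_eq_integral_hat]
  apply integral_congr_ae
  filter_upwards [h, h'] with ξ h1 h2
  rw [h1, h2, map_mul, hm]
  ring_nf

/-- The `L²` pairing after application of a real symbol. -/
lemma pairing_eq_inner {m : ℝ → ℝ} {u v u' v' : L2} (h : HasMul (fun k => (m k : ℂ)) u u')
    (h' : HasMul (fun k => (m k : ℂ)) v v') : pairing m u v = inner ℝ u' v' := by
  rw [inner_eq_integral_hat, pairing]
  apply integral_congr_ae
  filter_upwards [h, h'] with ξ h1 h2
  rw [h1, h2]
  simp only [symbolMul, Complex.real_smul]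

end GBq
end

open MeasureTheory Set
open scoped FourierTransform ContDiff

noncomputable section

namespace GBq

/-! ### Weak formulation of linear differential relations -/

lemma iteratedDeriv_clm_comp {F G : Type*} [NormedAddCommGroup F] [NormedSpace ℝ F]
    [NormedAddCommGroup G] [NormedSpace ℝ G] (A : F →L[ℝ] G) {f : ℝ → F} (hf : ContDiff ℝ ∞ f)
    (j : ℕ) (x : ℝ) : iteratedDeriv j (fun y => A (f y)) x = A (iteratedDeriv j f x) := by
  have h := A.iteratedFDeriv_comp_left (f := f) (x := x) (n := (∞ : WithTop ℕ∞)) hf.contDiffAt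
    (i := j) (mod_cast le_top)
  rw [iteratedDeriv, iteratedDeriv]
  change iteratedFDeriv ℝ j (A ∘ f) x _ = _
  rw [h]
  rfl

/-- Iterated derivatives of a Schwartz function, as a Schwartz function. -/
def derivIter (j : ℕ) (φ : SchwartzMap ℝ ℂ) : SchwartzMap ℝ ℂ :=
  (SchwartzMap.derivCLM ℂ ℂ)^[j] φ

lemma derivIter_apply (j : ℕ) (φ : SchwartzMap ℝ ℂ) (x : ℝ) :
    derivIter j φ x = iteratedDeriv j φ x := by
  induction j generalizing x with
  | zero => simp [derivIter]
  | succ j ih =>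
    rw [derivIter, Function.iterate_succ_apply', SchwartzMap.derivCLM_apply, iteratedDeriv_succ]
    congr 1
    ext y
    exact ih y

lemma fourier_derivIter (j : ℕ) (φ : SchwartzMap ℝ ℂ) (ξ : ℝ) :
    𝓕 (derivIter j φ) ξ = (2 * Real.pi * ξ * Complex.I) ^ j * 𝓕 φ ξ := by
  induction j with
  | zero => simp [derivIter]
  | succ j ih =>
    have h : derivIter (j + 1) φ = LineDeriv.lineDerivOp (1 : ℝ) (derivIter j φ) := by
      ext x
      rw [derivIter, Function.iterate_succ_apply', SchwartzMap.derivCLM_apply,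
        SchwartzMap.lineDerivOp_apply_eq_fderiv]
      simp [derivIter]
    rw [h, SchwartzMap.fourier_lineDerivOp_eq, smul_apply,
      SchwartzMap.smulLeftCLM_apply_apply (by fun_prop), ih, pow_succ]
    simp
    ring

lemma integral_ofReal_mul_schwartz (w : L2) (φ : SchwartzMap ℝ ℂ) :
    ∫ x, (w x : ℂ) * φ x = ∫ ξ, (starRingEnd ℂ) (hat w ξ) * 𝓕 φ ξ := by
  have h1 : inner ℂ (hat w) ((𝓕 φ).toLp 2 volume) = inner ℂ (toC w) (φ.toLp 2 volume) := by
    rw [hat_eq, ← SchwartzMap.toLp_fourier_eq, Lp.inner_fourier_eq]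
  rw [L2.inner_def, L2.inner_def] at h1
  refine Eq.trans ?_ (h1.symm.trans ?_)
  · apply integral_congr_ae
    filter_upwards [toC_coeFn w, φ.coeFn_toLp 2 volume] with x h1 h2
    simp [h1, h2, mul_comm]
  · apply integral_congr_ae
    filter_upwards [(𝓕 φ).coeFn_toLp 2 volume] with x h2
    simp [h2, mul_comm]

lemma integrable_ofReal_mul_schwartz (w : L2) (φ : SchwartzMap ℝ ℂ) :
    Integrable (fun x => (w x : ℂ) * φ x) := by
  have h1 := L2.integrable_inner (𝕜 := ℂ) (toC w) (φ.toLp 2 volume)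
  refine h1.congr ?_
  filter_upwards [toC_coeFn w, φ.coeFn_toLp 2 volume] with x h1 h2
  simp [h1, h2, mul_comm]

lemma integrable_conj_hat_mul_schwartz (w : L2) (φ : SchwartzMap ℝ ℂ) :
    Integrable (fun ξ => (starRingEnd ℂ) (hat w ξ) * φ ξ) := by
  have h1 := L2.integrable_inner (𝕜 := ℂ) (hat w) (φ.toLp 2 volume)
  refine h1.congr ?_
  filter_upwards [φ.coeFn_toLp 2 volume] with x h2
  simp [h2, mul_comm]

/-- Parseval turns derivatives of φ into powers of 2πiξ. These are written under the conjugation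
together with the transform of w, which changes the sign of i. -/
lemma sum_integral_schwartz (n : ℕ) (w : ℕ → L2) (φ : SchwartzMap ℝ ℂ) :
    ∑ j ∈ Finset.range n, ∫ x, (w j x : ℂ) * derivIter j φ x =
      ∫ ξ, (starRingEnd ℂ) (∑ j ∈ Finset.range n,
        (-(2 * Real.pi * ξ * Complex.I)) ^ j * hat (w j) ξ) * 𝓕 φ ξ := by
  simp_rw [integral_ofReal_mul_schwartz]
  rw [← integral_finsetSum]
  · congr 1
    ext ξ
    rw [map_sum, Finset.sum_mul]
    refine Finset.sum_congr rfl fun j _ => ?_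
    have h2 : (starRingEnd ℂ) 2 = 2 := map_ofNat _ 2
    rw [fourier_derivIter, map_mul, map_pow]
    simp [h2]
    ring
  · intro j _
    exact integrable_conj_hat_mul_schwartz _ _

lemma integral_test_of_hat {n : ℕ} {w : ℕ → L2}
    (h : ∀ᵐ ξ : ℝ, ∑ j ∈ Finset.range n,
      (-(2 * Real.pi * ξ * Complex.I)) ^ j * hat (w j) ξ = 0)
    {φ : ℝ → ℝ} (hφ : ContDiff ℝ ∞ φ) (hc : HasCompactSupport φ) :
    ∑ j ∈ Finset.range n, ∫ x, w j x * iteratedDeriv j φ x = 0 := by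
  have hc' : HasCompactSupport (fun x => (Complex.ofRealCLM (φ x) : ℂ)) := hc.comp_left (by simp)
  have hφ' : ContDiff ℝ ∞ (fun x => (Complex.ofRealCLM (φ x) : ℂ)) := by fun_prop
  have h1 := sum_integral_schwartz n w (hc'.toSchwartzMap hφ')
  have h2 : ∫ ξ, (starRingEnd ℂ) (∑ j ∈ Finset.range n,
        (-(2 * Real.pi * ξ * Complex.I)) ^ j * hat (w j) ξ) * 𝓕 (hc'.toSchwartzMap hφ') ξ = 0 := by
    rw [integral_eq_zero_of_ae]
    filter_upwards [h] with ξ h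
    simp [h]
  rw [h2] at h1
  rw [← Complex.ofReal_inj, Complex.ofReal_sum, Complex.ofReal_zero, ← h1]
  refine Finset.sum_congr rfl fun j _ => ?_
  refine (integral_ofReal (𝕜 := ℂ)).symm.trans ?_
  congr 1
  ext x
  rw [derivIter_apply]
  change _ = _ * iteratedDeriv j (fun x => (Complex.ofRealCLM (φ x) : ℂ)) x
  rw [iteratedDeriv_clm_comp Complex.ofRealCLM hφ]
  simp

/-- Multiplication of a Schwartz function by dilated cutoffs. -/
lemma tendsto_integral_cutoff (w : L2) (φ : SchwartzMap ℝ ℂ) {χ : ℝ → ℝ} (hχ : ContDiff ℝ ∞ χ)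
    (hc : HasCompactSupport χ) (h1 : ∀ᶠ x in nhds 0, χ x = 1) (j : ℕ) :
    Filter.Tendsto (fun n : ℕ => ∫ x, (w x : ℂ) *
      iteratedDeriv j (fun y => χ (((n : ℝ) + 1)⁻¹ * y) • φ y) x) Filter.atTop
      (nhds (∫ x, (w x : ℂ) * derivIter j φ x)) := by
  have hb : ∀ i, ∃ C, ∀ x, ‖iteratedDeriv i χ x‖ ≤ C := by
    intro i
    have hcont : Continuous (iteratedDeriv i χ) := hχ.continuous_iteratedDeriv i (mod_cast le_top)
    have hsupp : HasCompactSupport (iteratedDeriv i χ) := by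
      have := (hc.iteratedFDeriv (𝕜 := ℝ) i)
      exact this.comp_left (g := fun A : ContinuousMultilinearMap ℝ (fun _ : Fin i => ℝ) ℝ =>
        A fun _ => 1) rfl
    exact hsupp.exists_bound_of_continuous hcont
  choose C hC using hb
  have hform : ∀ (n : ℕ) (x : ℝ), iteratedDeriv j (fun y => χ (((n : ℝ) + 1)⁻¹ * y) • φ y) x =
      ∑ i ∈ Finset.range (j + 1), (j.choose i : ℝ) • (((((n : ℝ) + 1)⁻¹) ^ i *
        iteratedDeriv i χ (((n : ℝ) + 1)⁻¹ * x)) • derivIter (j - i) φ x) := by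
    intro n x
    have e1 : ContDiff ℝ ∞ (fun y => χ (((n : ℝ) + 1)⁻¹ * y)) := by fun_prop
    have e2 : ContDiff ℝ ∞ φ := φ.smooth'
    have e3 := iteratedDerivWithin_smul (n := j) (x := x) (Set.mem_univ x) uniqueDiffOn_univ
      (e1.of_le (mod_cast le_top)).contDiffWithinAt (e2.of_le (mod_cast le_top)).contDiffWithinAt
    simp only [iteratedDerivWithin_univ] at e3
    refine Eq.trans e3 (Finset.sum_congr rfl fun i _ => ?_)
    rw [iteratedDeriv_comp_const_mul (hχ.of_le (mod_cast le_top)), derivIter_apply]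
    simp [mul_assoc]
  apply tendsto_integral_of_dominated_convergence (fun x => ∑ i ∈ Finset.range (j + 1),
    (j.choose i : ℝ) * (C i * ‖(w x : ℂ) * derivIter (j - i) φ x‖))
  · intro n
    apply AEStronglyMeasurable.mul
    · exact Complex.continuous_ofReal.comp_aestronglyMeasurable (Lp.aestronglyMeasurable w)
    · apply Continuous.aestronglyMeasurable
      have e1 : ContDiff ℝ ∞ (fun y => χ (((n : ℝ) + 1)⁻¹ * y)) := by fun_prop
      have e2 : ContDiff ℝ ∞ φ := φ.smooth'
      exact (e1.smul e2).continuous_iteratedDeriv j (mod_cast le_top)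
  · refine integrable_finsetSum _ fun i _ => ?_
    exact ((integrable_ofReal_mul_schwartz w _).norm.const_mul _).const_mul _
  · intro n
    refine Filter.Eventually.of_forall fun x => ?_
    rw [hform, Finset.mul_sum]
    refine (norm_sum_le _ _).trans (Finset.sum_le_sum fun i _ => ?_)
    have e3 : ‖(((n : ℝ) + 1)⁻¹) ^ i * iteratedDeriv i χ (((n : ℝ) + 1)⁻¹ * x)‖ ≤ C i := by
      rw [norm_mul, norm_pow]
      have : ‖((n : ℝ) + 1)⁻¹‖ ^ i ≤ 1 := by
        apply pow_le_one₀ (norm_nonneg _)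
        rw [norm_inv, Real.norm_of_nonneg (by positivity)]
        exact inv_le_one_of_one_le₀ (by linarith [Nat.cast_nonneg (α := ℝ) n])
      calc _ ≤ 1 * C i := by gcongr; exact hC i _
        _ = C i := one_mul _
    have e4 : 0 ≤ C i := (norm_nonneg _).trans e3
    rw [mul_smul_comm, mul_smul_comm, norm_smul, norm_smul, Real.norm_of_nonneg (Nat.cast_nonneg _)]
    gcongr
  · refine Filter.Eventually.of_forall fun x => ?_
    apply tendsto_const_nhds.congr'
    have ht : Filter.Tendsto (fun n : ℕ => ((n : ℝ) + 1)⁻¹ * x) Filter.atTop (nhds 0) := by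
      have := (tendsto_one_div_add_atTop_nhds_zero_nat (𝕜 := ℝ)).mul_const x
      simpa [one_div] using this
    filter_upwards [ht.eventually h1.eventually_nhds] with n hn
    congr 1
    rw [derivIter_apply]
    apply Filter.EventuallyEq.iteratedDeriv_eq
    have hcont : Filter.Tendsto (fun y : ℝ => ((n : ℝ) + 1)⁻¹ * y) (nhds x)
        (nhds (((n : ℝ) + 1)⁻¹ * x)) := (continuous_const_mul _).tendsto _
    filter_upwards [hcont.eventually hn] with y hy
    rw [hy, one_smul]

/-- The natural test functions are those whose Fourier transform is a prescribed smooth function of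
compact support, but these are only Schwartz functions. The hypothesis is therefore extended from
compact support to the Schwartz class by dilated cutoffs. The weighted sum, being locally
integrable, then vanishes because it annihilates every smooth compactly supported function. -/
lemma hat_of_integral_test {n : ℕ} {w : ℕ → L2}
    (h : ∀ φ : ℝ → ℝ, ContDiff ℝ ∞ φ → HasCompactSupport φ →
      ∑ j ∈ Finset.range n, ∫ x, w j x * iteratedDeriv j φ x = 0) :
    ∀ᵐ ξ : ℝ, ∑ j ∈ Finset.range n,
      (-(2 * Real.pi * ξ * Complex.I)) ^ j * hat (w j) ξ = 0 := by
  have hC : ∀ φ : ℝ → ℂ, ContDiff ℝ ∞ φ → HasCompactSupport φ →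
      ∑ j ∈ Finset.range n, ∫ x, (w j x : ℂ) * iteratedDeriv j φ x = 0 := by
    intro φ hφ hc
    have hint : ∀ j, Integrable (fun x => (w j x : ℂ) * iteratedDeriv j φ x) := by
      intro j
      have := integrable_ofReal_mul_schwartz (w j) (derivIter j (hc.toSchwartzMap hφ))
      simpa only [derivIter_apply] using! this
    have hre := h (fun x => Complex.reCLM (φ x)) (by fun_prop) (hc.comp_left (by simp))
    have him := h (fun x => Complex.imCLM (φ x)) (by fun_prop) (hc.comp_left (by simp))
    simp_rw [iteratedDeriv_clm_comp _ hφ] at hre him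
    apply Complex.ext
    · rw [Complex.re_sum, Complex.zero_re, ← hre]
      refine Finset.sum_congr rfl fun j _ => ?_
      refine (integral_re (𝕜 := ℂ) (hint j)).symm.trans ?_
      simp
    · rw [Complex.im_sum, Complex.zero_im, ← him]
      refine Finset.sum_congr rfl fun j _ => ?_
      refine (integral_im (𝕜 := ℂ) (hint j)).symm.trans ?_
      simp
  obtain ⟨χ, hχ⟩ : ∃ χ : ContDiffBump (0 : ℝ), True := ⟨⟨1, 2, by norm_num, by norm_num⟩, trivial⟩
  have hS : ∀ φ : SchwartzMap ℝ ℂ, ∑ j ∈ Finset.range n, ∫ x, (w j x : ℂ) * derivIter j φ x = 0 := by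
    intro φ
    have ht := tendsto_finsetSum (Finset.range n) (fun j _ => tendsto_integral_cutoff (w j) φ
      χ.contDiff χ.hasCompactSupport χ.eventuallyEq_one j)
    refine tendsto_nhds_unique ht (tendsto_const_nhds.congr fun N => (hC _ ?_ ?_).symm)
    · have e1 : ContDiff ℝ ∞ (fun y => χ (((N : ℝ) + 1)⁻¹ * y)) :=
        χ.contDiff.comp (by fun_prop)
      exact e1.smul φ.smooth'
    · have e3 : HasCompactSupport (fun y => χ (((N : ℝ) + 1)⁻¹ * y)) := by
        have := χ.hasCompactSupport.comp_homeomorph (Homeomorph.mulLeft₀ (((N : ℝ) + 1)⁻¹)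
          (by positivity))
        exact this
      exact e3.smul_right
  have hloc : ∀ j, LocallyIntegrable (fun ξ : ℝ =>
      (-(2 * Real.pi * ξ * Complex.I)) ^ j * hat (w j) ξ) volume := by
    intro j
    have h1 : LocallyIntegrable (hat (w j)) volume :=
      (Lp.memLp (hat (w j))).locallyIntegrable (by norm_num)
    have h2 : Continuous (fun ξ : ℝ => (-(2 * Real.pi * ξ * Complex.I)) ^ j) := by fun_prop
    rw [← locallyIntegrableOn_univ] at h1 ⊢
    exact h1.continuousOn_mul h2.continuousOn isOpen_univ.isLocallyClosed
  apply ae_eq_zero_of_integral_contDiff_smul_eq_zero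
  · exact locallyIntegrable_finsetSum _ fun j _ => hloc j
  · intro g hg hgc
    have hg1 : HasCompactSupport (fun x => (Complex.ofRealCLM (g x) : ℂ)) :=
      hgc.comp_left (by simp)
    have hg2 : ContDiff ℝ ∞ (fun x => (Complex.ofRealCLM (g x) : ℂ)) := by fun_prop
    -- The test function is the inverse transform of g, so the pairing is with g itself.
    have h3 := sum_integral_schwartz n w (𝓕⁻ (hg1.toSchwartzMap hg2))
    rw [hS, FourierTransform.fourier_fourierInv_eq] at h3
    have h4 := congrArg (starRingEnd ℂ) h3
    rw [← integral_conj, map_zero] at h4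
    rw [h4]
    congr 1
    ext ξ
    rw [map_mul, Complex.conj_conj, Complex.real_smul]
    refine (mul_comm _ _).trans (congrArg _ ?_)
    simp

end GBq
end

open MeasureTheory Set
open scoped FourierTransform ContDiff

noncomputable section

namespace GBq

/-! ### Primitives on the line and weak derivatives -/

/-- `u` is a (locally absolutely continuous) primitive of the locally integrable function `g`. -/
structure IsPrim (u g : ℝ → ℝ) : Prop where
  intervalIntegrable : ∀ x y, IntervalIntegrable g volume x y
  sub_eq : ∀ x y, u y - u x = ∫ t in x..y, g t

lemma IsPrim.absolutelyContinuous {u g : ℝ → ℝ} (h : IsPrim u g) (x y : ℝ) :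
    AbsolutelyContinuousOnInterval u x y := by
  have h1 := (h.intervalIntegrable x y).absolutelyContinuousOnInterval_intervalIntegral
    (c := x) (by simp)
  have h2 : AbsolutelyContinuousOnInterval (fun _ : ℝ => u x) x y :=
    (LipschitzWith.const (u x)).lipschitzOnWith.absolutelyContinuousOnInterval
  have h3 := h1.add h2
  have e : ((fun z => ∫ t in x..z, g t) + fun _ => u x) = u := by
    funext z
    change (∫ t in x..z, g t) + u x = u z
    linarith [h.sub_eq x z]
  rwa [e] at h3

lemma IsPrim.continuous {u g : ℝ → ℝ} (h : IsPrim u g) : Continuous u := by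
  rw [continuous_iff_continuousAt]
  intro x
  have h1 := (h.absolutelyContinuous (x - 1) (x + 1)).continuousOn
  rw [uIcc_of_le (by linarith)] at h1
  exact h1.continuousAt (Icc_mem_nhds (by linarith) (by linarith))

lemma IsPrim.locallyIntegrable {u g : ℝ → ℝ} (h : IsPrim u g) : LocallyIntegrable g volume := by
  intro x
  refine ⟨Ioc (x - 1) (x + 1), Ioc_mem_nhds (by linarith) (by linarith), ?_⟩
  have := h.intervalIntegrable (x - 1) (x + 1)
  rwa [intervalIntegrable_iff_integrableOn_Ioc_of_le (by linarith)] at this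

lemma IsPrim.ae_hasDerivAt {u g : ℝ → ℝ} (h : IsPrim u g) : ∀ᵐ x, HasDerivAt u (g x) x := by
  filter_upwards [LocallyIntegrable.ae_hasDerivAt_integral h.locallyIntegrable] with x hx
  have h1 := (hx 0).add_const (u 0)
  have e : (fun z => (∫ t in (0 : ℝ)..z, g t) + u 0) = u := by
    funext z
    linarith [h.sub_eq 0 z]
  rwa [e] at h1

lemma isPrim_of_absolutelyContinuous {u g : ℝ → ℝ}
    (h : ∀ x y, AbsolutelyContinuousOnInterval u x y) (hg : ∀ᵐ x, HasDerivAt u (g x) x) :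
    IsPrim u g where
  intervalIntegrable x y := by
    refine (h x y).intervalIntegrable_deriv.congr_ae ?_
    apply ae_restrict_of_ae
    filter_upwards [hg] with z hz
    exact hz.deriv
  sub_eq x y := by
    rw [← (h x y).integral_deriv_eq_sub]
    apply intervalIntegral.integral_congr_ae
    filter_upwards [hg] with z hz _
    exact hz.deriv

lemma isPrim_of_contDiff {φ : ℝ → ℝ} (hφ : ContDiff ℝ 1 φ) : IsPrim φ (deriv φ) where
  intervalIntegrable x y := (hφ.continuous_deriv le_rfl).intervalIntegrable x y
  sub_eq x y := (intervalIntegral.integral_deriv_eq_sub (fun z _ => (hφ.differentiable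
    (by norm_num)).differentiableAt) ((hφ.continuous_deriv le_rfl).intervalIntegrable x y)).symm

lemma IsPrim.mul {u g v h : ℝ → ℝ} (hu : IsPrim u g) (hv : IsPrim v h) :
    IsPrim (fun x => u x * v x) (fun x => g x * v x + u x * h x) := by
  refine isPrim_of_absolutelyContinuous
    (fun x y => (hu.absolutelyContinuous x y).mul (hv.absolutelyContinuous x y)) ?_
  filter_upwards [hu.ae_hasDerivAt, hv.ae_hasDerivAt] with x h1 h2
  exact h1.mul h2

lemma absolutelyContinuousOnInterval_lipschitz_comp {u G : ℝ → ℝ} {S : Set ℝ} {K : NNReal}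
    (hG : LipschitzOnWith K G S) {x y : ℝ} (hu : AbsolutelyContinuousOnInterval u x y)
    (hS : ∀ z ∈ uIcc x y, u z ∈ S) : AbsolutelyContinuousOnInterval (fun z => G (u z)) x y := by
  rw [absolutelyContinuousOnInterval_iff] at hu ⊢
  intro ε hε
  obtain ⟨δ, hδ, h⟩ := hu (ε / (K + 1)) (by positivity)
  refine ⟨δ, hδ, fun E hE hEδ => ?_⟩
  have h1 := h E hE hEδ
  have hE' := hE.1
  calc ∑ i ∈ Finset.range E.1, dist (G (u (E.2 i).1)) (G (u (E.2 i).2))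
      ≤ ∑ i ∈ Finset.range E.1, (K + 1) * dist (u (E.2 i).1) (u (E.2 i).2) := by
        refine Finset.sum_le_sum fun i hi => ?_
        refine (hG.dist_le_mul _ (hS _ (hE' i hi).1) _ (hS _ (hE' i hi).2)).trans ?_
        gcongr
        linarith
    _ = (K + 1) * ∑ i ∈ Finset.range E.1, dist (u (E.2 i).1) (u (E.2 i).2) := by
        rw [Finset.mul_sum]
    _ < (K + 1) * (ε / (K + 1)) := by gcongr
    _ = ε := by field_simp

/-- Chain rule for the composition with a locally Lipschitz function that is differentiable away
from `0` and vanishes at `0`. -/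
lemma IsPrim.comp {u g : ℝ → ℝ} (hu : IsPrim u g) {G G' : ℝ → ℝ} (h0 : G 0 = 0)
    (hL : ∀ R, ∃ K : NNReal, LipschitzOnWith K G (Icc (-R) R))
    (hG : ∀ y ≠ 0, HasDerivAt G (G' y) y) :
    IsPrim (fun x => G (u x)) (fun x => G' (u x) * g x) := by
  have habs : ∀ {G : ℝ → ℝ}, (∀ R, ∃ K : NNReal, LipschitzOnWith K G (Icc (-R) R)) →
      ∀ x y, AbsolutelyContinuousOnInterval (fun x => G (u x)) x y := by
    intro G hL x y
    have h1 := hu.absolutelyContinuous x y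
    obtain ⟨R, hR⟩ := h1.exists_bound
    obtain ⟨K, hK⟩ := hL R
    exact absolutelyContinuousOnInterval_lipschitz_comp hK h1 (fun z hz => abs_le.1 (hR z hz))
  have hdiff : ∀ {w : ℝ → ℝ}, (∀ x y, AbsolutelyContinuousOnInterval w x y) →
      ∀ᵐ x, DifferentiableAt ℝ w x := by
    intro w hw
    have : ∀ n : ℕ, ∀ᵐ x, x ∈ uIcc (-(n : ℝ)) n → DifferentiableAt ℝ w x :=
      fun n => (hw _ _).ae_differentiableAt
    filter_upwards [ae_all_iff.2 this] with x hx
    obtain ⟨n, hn⟩ := exists_nat_ge |x|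
    refine hx n ?_
    rw [uIcc_of_le (by linarith [abs_nonneg x])]
    exact abs_le.1 hn
  refine isPrim_of_absolutelyContinuous (habs hL) ?_
  -- The absolute value of u is absolutely continuous too, hence differentiable almost everywhere.
  have h1 := hdiff (habs (G := fun y => |y|) fun R => ⟨1, (by
    exact (lipschitzWith_one_norm (E := ℝ)).lipschitzOnWith)⟩)
  filter_upwards [hu.ae_hasDerivAt, h1] with x hx h1
  rcases ne_or_eq (u x) 0 with h | h
  · exact (hG _ h).comp x hx
  -- At a zero of u the function |u| has a minimum, so where it is differentiable its derivative is
  -- 0. Hence u' = 0 there, the arbitrary value of `G'` at 0 is irrelevant, and the Lipschitz bound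
  -- gives derivative 0 for the composition.
  · have hmin : IsLocalMin (fun x => |u x|) x := by
      refine Filter.Eventually.of_forall fun y => ?_
      simp [h]
    have h2 : HasDerivAt (fun x => |u x|) 0 x := by
      have := h1.hasDerivAt
      rwa [hmin.deriv_eq_zero] at this
    have h3 : HasDerivAt u 0 x := by
      rw [hasDerivAt_iff_isLittleO] at h2 ⊢
      simp only [h, abs_zero, smul_zero, sub_zero] at h2 ⊢
      exact h2.of_abs_left
    rw [hx.unique h3, mul_zero]
    obtain ⟨K, hK⟩ := hL 1
    rw [hasDerivAt_iff_isLittleO] at h3 ⊢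
    simp only [h, h0, smul_zero, sub_zero] at h3 ⊢
    refine Asymptotics.IsBigO.trans_isLittleO ?_ h3
    refine Asymptotics.IsBigO.of_bound K ?_
    have h4 : ∀ᶠ y in nhds x, u y ∈ Icc (-1 : ℝ) 1 := by
      apply hu.continuous.continuousAt.eventually_mem
      rw [h]
      exact Icc_mem_nhds (by norm_num) (by norm_num)
    filter_upwards [h4] with y hy
    have := hK.dist_le_mul _ hy 0 (by simp)
    simpa [h0, dist_eq_norm] using this

lemma IsPrim.integral_mul_deriv_test {u g : ℝ → ℝ} (hu : IsPrim u g) {φ : ℝ → ℝ}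
    (hφ : ContDiff ℝ ∞ φ) (hc : HasCompactSupport φ) :
    ∫ x, u x * deriv φ x = - ∫ x, g x * φ x := by
  have h1 := hu.mul (isPrim_of_contDiff (hφ.of_le (by norm_num)))
  obtain ⟨R, hR⟩ := hc.isCompact.isBounded.subset_closedBall (0 : ℝ)
  have hφ0 : ∀ x, R < |x| → φ x = 0 := fun x hx => image_eq_zero_of_notMem_tsupport
    fun hx' => by
      have := hR hx'
      rw [mem_closedBall_zero_iff, Real.norm_eq_abs] at this
      linarith
  have hd0 : ∀ x, R < |x| → deriv φ x = 0 := fun x hx => by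
    by_contra hne
    have : x ∈ tsupport φ := support_deriv_subset hne
    have := hR this
    rw [mem_closedBall_zero_iff, Real.norm_eq_abs] at this
    linarith
  have h2 : ∀ x, R < |x| → (g x * φ x + u x * deriv φ x) = 0 := fun x hx => by
    rw [hφ0 x hx, hd0 x hx]; ring
  have h3 : ∫ x, (g x * φ x + u x * deriv φ x) = 0 := by
    have hR1 : R < |(-(|R| + 1))| := by
      rw [abs_neg, abs_of_pos (by positivity)]
      linarith [le_abs_self R]
    have hR2 : R < |(|R| + 1)| := by
      rw [abs_of_pos (by positivity)]
      linarith [le_abs_self R]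
    have h4 := h1.sub_eq (-(|R| + 1)) (|R| + 1)
    rw [hφ0 _ hR1, hφ0 _ hR2] at h4
    rw [← intervalIntegral.integral_eq_integral_of_support_subset
      (a := -(|R| + 1)) (b := |R| + 1), ← h4]
    · ring
    · intro x hx
      by_contra hx'
      apply hx
      apply h2
      have h5 : ¬ |x| < |R| + 1 := fun h => hx' ⟨(abs_lt.1 h).1, (abs_lt.1 h).2.le⟩
      have := le_abs_self R
      linarith
  have hi1 : Integrable (fun x => g x * φ x) := by
    have := hu.locallyIntegrable.integrable_smul_right_of_hasCompactSupport hφ.continuous hc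
    simpa [mul_comm] using this
  have hi2 : Integrable (fun x => u x * deriv φ x) :=
    (hu.continuous.mul (hφ.continuous_deriv (by norm_num))).integrable_of_hasCompactSupport
      (hc.deriv.mul_left)
  rw [integral_add hi1 hi2] at h3
  linarith

/-- A locally integrable function whose weak derivative vanishes is constant. -/
lemma ae_eq_const_of_integral_deriv_test {d : ℝ → ℝ} (hd : LocallyIntegrable d volume)
    (h : ∀ φ : ℝ → ℝ, ContDiff ℝ ∞ φ → HasCompactSupport φ → ∫ x, d x * deriv φ x = 0) :
    ∃ c, ∀ᵐ x, d x = c := by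
  let χ : ContDiffBump (0 : ℝ) := ⟨1, 2, by norm_num, by norm_num⟩
  set ρ : ℝ → ℝ := χ.normed volume with hρ
  have hρc : HasCompactSupport ρ := χ.hasCompactSupport_normed
  have hρs : ContDiff ℝ ∞ ρ := χ.contDiff_normed
  have hρ1 : ∫ x, ρ x = 1 := χ.integral_normed
  refine ⟨∫ x, d x * ρ x, ae_eq_of_integral_contDiff_smul_eq hd
    (locallyIntegrable_const _) fun ψ hψ hψc => ?_⟩
  -- Subtracting a multiple of ρ makes the mean zero, so that θ is the derivative of a compactly
  -- supported function.
  set θ : ℝ → ℝ := fun x => ψ x - (∫ y, ψ y) * ρ x with hθ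
  have hθs : ContDiff ℝ ∞ θ := hψ.sub (contDiff_const.mul hρs)
  have hθc : HasCompactSupport θ := hψc.sub hρc.mul_left
  have hψi : Integrable ψ := hψ.continuous.integrable_of_hasCompactSupport hψc
  have hρi : Integrable ρ := hρs.continuous.integrable_of_hasCompactSupport hρc
  have hθ0 : ∫ x, θ x = 0 := by
    rw [hθ, integral_sub hψi (hρi.const_mul _), integral_const_mul, hρ1]
    ring
  have hθi : Integrable θ := hθs.continuous.integrable_of_hasCompactSupport hθc
  obtain ⟨R, hR⟩ := hθc.isCompact.isBounded.subset_closedBall (0 : ℝ)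
  obtain ⟨B, hB0, hz⟩ : ∃ B : ℝ, 0 ≤ B ∧ ∀ x, B < |x| → θ x = 0 :=
    ⟨|R|, abs_nonneg R, fun x hx => image_eq_zero_of_notMem_tsupport fun hx' => by
      have := hR hx'
      rw [mem_closedBall_zero_iff, Real.norm_eq_abs] at this
      linarith [le_abs_self R]⟩
  set A : ℝ := B + 1 with hA
  have hA0 : 0 < A := by positivity
  set φ : ℝ → ℝ := fun x => ∫ t in (-A)..x, θ t with hφ
  have hderiv : ∀ x, HasDerivAt φ (θ x) x := fun x =>
    (hθs.continuous.integral_hasStrictDerivAt (-A) x).hasDerivAt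
  have hφd : deriv φ = θ := funext fun x => (hderiv x).deriv
  have hφs : ContDiff ℝ ∞ φ := by
    rw [contDiff_infty_iff_deriv, hφd]
    exact ⟨fun x => (hderiv x).differentiableAt, hθs⟩
  have hφc : HasCompactSupport φ := by
    refine HasCompactSupport.intro (isCompact_Icc (a := -A) (b := A)) fun x hx => ?_
    rw [mem_Icc, not_and_or, not_le, not_le] at hx
    rcases hx with hx | hx
    · rw [hφ]
      refine (intervalIntegral.integral_congr (g := fun _ => 0) fun t ht => ?_).trans (by simp)
      rw [uIcc_of_ge hx.le] at ht
      apply hz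
      rw [abs_of_nonpos (by linarith [ht.2])]
      linarith [ht.2]
    · have h1 : φ x = ∫ t, θ t := by
        apply intervalIntegral.integral_eq_integral_of_support_subset
        intro t ht
        by_contra hne
        apply ht
        apply hz
        rw [mem_Ioc, not_and_or, not_lt, not_le] at hne
        rcases hne with hne | hne
        · rw [abs_of_nonpos (by linarith)]; linarith
        · rw [abs_of_pos (by linarith)]; linarith
      rw [h1, hθ0]
  have h1 := h φ hφs hφc
  rw [hφd] at h1
  have hi1 : Integrable (fun x => d x * ψ x) := by
    simpa [mul_comm] using hd.integrable_smul_right_of_hasCompactSupport hψ.continuous hψc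
  have hi2 : Integrable (fun x => d x * ρ x) := by
    simpa [mul_comm] using hd.integrable_smul_right_of_hasCompactSupport hρs.continuous hρc
  have h2 : ∫ x, d x * θ x = (∫ x, d x * ψ x) - (∫ y, ψ y) * ∫ x, d x * ρ x := by
    rw [← integral_const_mul, ← integral_sub hi1 (hi2.const_mul _)]
    congr 1
    ext x
    rw [hθ]
    ring
  rw [h2] at h1
  simp only [smul_eq_mul]
  rw [integral_mul_const]
  simp_rw [mul_comm (ψ _)]
  linarith

/-- `g` is the weak derivative of `u`. -/
abbrev HasDer (u g : L2) : Prop := HasMul (fun k => k * Complex.I) u g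

lemma hasDer_iff_integral_test {u g : L2} : HasDer u g ↔ ∀ φ : ℝ → ℝ, ContDiff ℝ ∞ φ →
    HasCompactSupport φ → ∫ x, u x * deriv φ x = - ∫ x, g x * φ x := by
  have key : HasDer u g ↔ ∀ᵐ ξ : ℝ, ∑ j ∈ Finset.range 2,
      (-(2 * Real.pi * ξ * Complex.I)) ^ j * hat ((fun j => if j = 0 then g else u) j) ξ = 0 := by
    refine Filter.eventually_congr (Filter.Eventually.of_forall fun ξ => ?_)
    rw [Finset.sum_range_succ, Finset.sum_range_one]
    simp only [pow_zero, one_mul, if_true, pow_one, one_ne_zero, if_false]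
    rw [neg_mul, add_neg_eq_zero]
    simp
  have key2 : ∀ φ : ℝ → ℝ, (∑ j ∈ Finset.range 2, ∫ x, (fun j => if j = 0 then g else u) j x *
      iteratedDeriv j φ x = 0 ↔ ∫ x, u x * deriv φ x = - ∫ x, g x * φ x) := by
    intro φ
    rw [Finset.sum_range_succ, Finset.sum_range_one]
    simp only [if_true, one_ne_zero, if_false, iteratedDeriv_zero, iteratedDeriv_one]
    constructor <;> intro h <;> linarith
  rw [key]
  constructor
  · intro h φ hφ hc
    exact (key2 φ).1 (integral_test_of_hat h hφ hc)
  · intro h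
    exact hat_of_integral_test fun φ hφ hc => (key2 φ).2 (h φ hφ hc)

lemma IsPrim.hasDer {u g : ℝ → ℝ} (h : IsPrim u g) {u' g' : L2} (hu : u' =ᵐ[volume] u)
    (hg : g' =ᵐ[volume] g) : HasDer u' g' := by
  rw [hasDer_iff_integral_test]
  intro φ hφ hc
  have h1 := h.integral_mul_deriv_test hφ hc
  rw [integral_congr_ae (g := fun x => u x * deriv φ x), h1,
    integral_congr_ae (g := fun x => g' x * φ x)]
  · filter_upwards [hg] with x hx
    rw [hx]
  · filter_upwards [hu] with x hx
    rw [hx]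

lemma L2.locallyIntegrable (g : L2) : LocallyIntegrable g volume :=
  (Lp.memLp g).locallyIntegrable (by norm_num)

lemma L2.intervalIntegrable (g : L2) (x y : ℝ) : IntervalIntegrable g volume x y :=
  ((L2.locallyIntegrable g).integrableOn_isCompact isCompact_uIcc).intervalIntegrable

/-- Elements of `H¹(ℝ)` have an absolutely continuous representative. -/
lemma HasDer.exists_isPrim {u g : L2} (h : HasDer u g) : ∃ v : ℝ → ℝ, u =ᵐ[volume] v ∧ IsPrim v g := by
  set U : ℝ → ℝ := fun x => ∫ t in (0 : ℝ)..x, g t with hU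
  have hUp : IsPrim U g := ⟨L2.intervalIntegrable g, fun x y => by
    rw [hU]
    exact intervalIntegral.integral_interval_sub_left (L2.intervalIntegrable g _ _)
      (L2.intervalIntegrable g _ _)⟩
  have hUl : LocallyIntegrable U volume := hUp.continuous.locallyIntegrable
  obtain ⟨c, hc⟩ := ae_eq_const_of_integral_deriv_test ((L2.locallyIntegrable u).sub hUl) (by
    intro φ hφ hc
    have h1 := hasDer_iff_integral_test.1 h φ hφ hc
    have h2 := hUp.integral_mul_deriv_test hφ hc
    have hdc : Continuous (deriv φ) := hφ.continuous_deriv (by norm_num)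
    have hi1 : Integrable (fun x => u x * deriv φ x) := by
      simpa [mul_comm] using (L2.locallyIntegrable u).integrable_smul_right_of_hasCompactSupport
        hdc hc.deriv
    have hi2 : Integrable (fun x => U x * deriv φ x) := by
      simpa [mul_comm] using hUl.integrable_smul_right_of_hasCompactSupport hdc hc.deriv
    simp only [Pi.sub_apply, sub_mul]
    rw [integral_sub hi1 hi2, h1, h2, sub_self])
  refine ⟨fun x => U x + c, ?_, hUp.intervalIntegrable, fun x y => ?_⟩
  · filter_upwards [hc] with x hx
    simp only [Pi.sub_apply] at hx
    linarith
  · rw [← hUp.sub_eq]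
    ring

end GBq
end

open MeasureTheory Set
open scoped FourierTransform ContDiff

noncomputable section

namespace GBq

/-! ### The ground state -/

/-- `ψ(x) = sech^(2/p)(p x / 2)`. -/
def sechPow (p x : ℝ) : ℝ := (1 / Real.cosh (p * x / 2)) ^ (2 / p)

/-- `t √(1 - t^p)`, extended to an even function vanishing for `|t| ≥ 1`. -/
def wellDensity (p t : ℝ) : ℝ := |t| * Real.sqrt (1 - |t| ^ p)

/-- The primitive of `wellDensity`. -/
def wellPrim (p r : ℝ) : ℝ := ∫ t in (0 : ℝ)..r, wellDensity p t

section
variable {p : ℝ} (hp : 0 < p)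
include hp

lemma continuous_wellDensity : Continuous (wellDensity p) := by
  unfold wellDensity
  refine continuous_abs.mul (Real.continuous_sqrt.comp ?_)
  exact continuous_const.sub (continuous_abs.rpow_const fun x => Or.inr hp.le)

lemma hasDerivAt_wellPrim (r : ℝ) : HasDerivAt (wellPrim p) (wellDensity p r) r :=
  ((continuous_wellDensity hp).integral_hasStrictDerivAt 0 r).hasDerivAt

omit hp in
lemma wellDensity_nonneg (t : ℝ) : 0 ≤ wellDensity p t :=
  mul_nonneg (abs_nonneg _) (Real.sqrt_nonneg _)

lemma wellDensity_sq {t : ℝ} (ht : |t| ≤ 1) : wellDensity p t ^ 2 = t ^ 2 - |t| ^ (p + 2) := by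
  have h1 : |t| ^ p ≤ 1 := Real.rpow_le_one (abs_nonneg _) ht hp.le
  rw [wellDensity, mul_pow, Real.sq_sqrt (by linarith), sq_abs,
    Real.rpow_add_of_nonneg (abs_nonneg _) hp.le (by norm_num), Real.rpow_two, sq_abs]
  ring

omit hp in
lemma sechPow_pos (x : ℝ) : 0 < sechPow p x :=
  Real.rpow_pos_of_pos (one_div_pos.2 (Real.cosh_pos _)) _

lemma sechPow_le_one (x : ℝ) : sechPow p x ≤ 1 :=
  Real.rpow_le_one (one_div_pos.2 (Real.cosh_pos _)).le
    ((div_le_one (Real.cosh_pos _)).2 (Real.one_le_cosh _)) (by positivity)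

lemma sechPow_rpow (x : ℝ) : sechPow p x ^ p = 1 - Real.tanh (p * x / 2) ^ 2 := by
  have h := Real.cosh_sq (p * x / 2)
  have hc := Real.cosh_pos (p * x / 2)
  rw [sechPow, ← Real.rpow_mul (one_div_pos.2 hc).le, div_mul_cancel₀ _ hp.ne', Real.rpow_two,
    Real.tanh_eq_sinh_div_cosh, div_pow, div_pow, eq_sub_iff_add_eq, ← add_div, div_eq_one_iff_eq
    (by positivity), h]
  ring

lemma hasDerivAt_sechPow (x : ℝ) :
    HasDerivAt (sechPow p) (-Real.tanh (p * x / 2) * sechPow p x) x := by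
  have hc := Real.cosh_pos (p * x / 2)
  have h1 : HasDerivAt (fun x => p * x / 2) (p / 2) x := by
    simpa using ((hasDerivAt_id x).const_mul p).div_const 2
  have h2 := ((Real.hasDerivAt_cosh _).comp x h1)
  have h3 := (h2.inv hc.ne').rpow_const (p := 2 / p) (Or.inl (inv_pos.2 hc).ne')
  have e : (fun x => ((Real.cosh ∘ fun x => p * x / 2)⁻¹ x) ^ (2 / p)) = sechPow p := by
    funext y
    simp [sechPow]
  rw [e] at h3
  convert h3 using 1
  simp only [Pi.inv_apply, Function.comp]
  rw [sechPow, one_div, Real.rpow_sub_one (inv_pos.2 hc).ne', Real.tanh_eq_sinh_div_cosh]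
  field_simp

lemma sechPow_le_exp (x : ℝ) : sechPow p x ≤ 2 ^ (2 / p) * Real.exp (-x) := by
  have hc := Real.cosh_pos (p * x / 2)
  have h1 : 1 / Real.cosh (p * x / 2) ≤ 2 * Real.exp (-(p * x / 2)) := by
    rw [div_le_iff₀ hc, Real.cosh_eq, Real.exp_neg]
    have := Real.exp_pos (p * x / 2)
    field_simp
    nlinarith [sq_nonneg (Real.exp (p * x / 2))]
  calc sechPow p x ≤ (2 * Real.exp (-(p * x / 2))) ^ (2 / p) :=
        Real.rpow_le_rpow (one_div_pos.2 hc).le h1 (by positivity)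
    _ = _ := by
        rw [Real.mul_rpow (by norm_num) (Real.exp_pos _).le, ← Real.exp_mul]
        congr 2
        field_simp

lemma tendsto_sechPow : Filter.Tendsto (sechPow p) Filter.atTop (nhds 0) := by
  have h1 : Filter.Tendsto (fun x : ℝ => (2 : ℝ) ^ (2 / p) * Real.exp (-x)) Filter.atTop (nhds 0) := by
    simpa using Real.tendsto_exp_neg_atTop_nhds_zero.const_mul ((2 : ℝ) ^ (2 / p))
  exact squeeze_zero (fun x => (sechPow_pos x).le) (sechPow_le_exp hp) h1

lemma continuous_sechPow : Continuous (sechPow p) :=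
  continuous_iff_continuousAt.2 fun x => (hasDerivAt_sechPow hp x).continuousAt

lemma integrableOn_sechPow_sq : IntegrableOn (fun x => sechPow p x ^ 2) (Ioi 0) := by
  have h1 := (exp_neg_integrableOn_Ioi 0 (b := 1) one_pos).const_mul ((2 : ℝ) ^ (2 / p))
  refine Integrable.mono' h1 ((continuous_sechPow hp).pow 2).aestronglyMeasurable ?_
  refine Filter.Eventually.of_forall fun x => ?_
  rw [Real.norm_of_nonneg (sq_nonneg _)]
  have h2 := sechPow_le_exp hp x
  have h3 := sechPow_le_one hp x
  have h4 := sechPow_pos (p := p) x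
  simp only [neg_mul, one_mul]
  nlinarith

/-- On the half-line the profile ψ solves ψ' = -ψ√(1-ψ^p) = -`wellDensity p ψ`. Hence (ψ')² is minus
the derivative of `wellPrim p ψ`, and the integral telescopes between ψ(0) = 1 and ψ(∞) = 0. -/
lemma integral_Ioi_deriv_sechPow_sq :
    ∫ x in Ioi (0 : ℝ), (Real.tanh (p * x / 2) * sechPow p x) ^ 2 = wellPrim p 1 := by
  have hd : ∀ x ∈ Ici (0 : ℝ), HasDerivAt (fun x => wellPrim p (sechPow p x))
      (-(Real.tanh (p * x / 2) * sechPow p x) ^ 2) x := by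
    intro x hx
    have h1 := (hasDerivAt_wellPrim hp (sechPow p x)).comp x (hasDerivAt_sechPow hp x)
    refine h1.congr_deriv ?_
    have ht : 0 ≤ Real.tanh (p * x / 2) := by
      rw [Real.tanh_eq_sinh_div_cosh]
      exact div_nonneg (Real.sinh_nonneg_iff.2 (by have := mem_Ici.1 hx; positivity))
        (Real.cosh_pos _).le
    have h2 : wellDensity p (sechPow p x) = sechPow p x * Real.tanh (p * x / 2) := by
      unfold wellDensity
      rw [abs_of_pos (sechPow_pos x), sechPow_rpow hp, sub_sub_cancel, Real.sqrt_sq ht]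
    rw [h2]
    ring
  have hlim : Filter.Tendsto (fun x => wellPrim p (sechPow p x)) Filter.atTop
      (nhds (wellPrim p 0)) :=
    (hasDerivAt_wellPrim hp 0).continuousAt.tendsto.comp (tendsto_sechPow hp)
  have h2 := integral_Ioi_of_hasDerivAt_of_nonpos' hd
    (fun x _ => neg_nonpos.2 (sq_nonneg _)) hlim
  rw [integral_neg] at h2
  have h3 : wellPrim p 0 = 0 := by simp [wellPrim]
  have h4 : sechPow p 0 = 1 := by simp [sechPow]
  rw [h3, h4] at h2
  linarith

lemma integrableOn_deriv_sechPow_sq :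
    IntegrableOn (fun x => (Real.tanh (p * x / 2) * sechPow p x) ^ 2) (Ioi 0) := by
  refine Integrable.mono' (integrableOn_sechPow_sq hp) ?_ ?_
  · refine Continuous.aestronglyMeasurable ?_
    have : Continuous (fun x : ℝ => Real.tanh (p * x / 2)) := by
      simp_rw [Real.tanh_eq_sinh_div_cosh]
      exact (by fun_prop : Continuous fun x : ℝ => Real.sinh (p * x / 2)).div (by fun_prop)
        fun x => (Real.cosh_pos _).ne'
    exact (this.mul (continuous_sechPow hp)).pow 2
  · refine Filter.Eventually.of_forall fun x => ?_
    rw [Real.norm_of_nonneg (sq_nonneg _), mul_pow]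
    have : Real.tanh (p * x / 2) ^ 2 ≤ 1 := (Real.tanh_sq_lt_one _).le
    exact mul_le_of_le_one_left (sq_nonneg _) this

/-- The derivative of tanh(px/2)ψ² is (p/2)ψ² - ((p+4)/2)(ψ')², and its boundary terms vanish at 0
and at infinity. This expresses the integral of ψ² through that of (ψ')². -/
lemma integral_Ioi_sechPow_sq :
    ∫ x in Ioi (0 : ℝ), sechPow p x ^ 2 = (p + 4) / p * wellPrim p 1 := by
  have hd : ∀ x ∈ Ici (0 : ℝ), HasDerivAt (fun x => Real.tanh (p * x / 2) * sechPow p x ^ 2)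
      (p / 2 * sechPow p x ^ 2 -
        (p + 4) / 2 * (Real.tanh (p * x / 2) * sechPow p x) ^ 2) x := by
    intro x _
    have h1 : HasDerivAt (fun x => p * x / 2) (p / 2) x := by
      simpa using ((hasDerivAt_id x).const_mul p).div_const 2
    have h2 : HasDerivAt (fun x => Real.tanh (p * x / 2))
        ((1 - Real.tanh (p * x / 2) ^ 2) * (p / 2)) x := by
      have hc := Real.cosh_pos (p * x / 2)
      have h4 := ((Real.hasDerivAt_sinh _).comp x h1).div ((Real.hasDerivAt_cosh _).comp x h1) hc.ne'
      have e : ((Real.sinh ∘ fun x => p * x / 2) / (Real.cosh ∘ fun x => p * x / 2)) =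
          fun x => Real.tanh (p * x / 2) := by
        funext y
        simp [Real.tanh_eq_sinh_div_cosh]
      rw [e] at h4
      refine h4.congr_deriv ?_
      simp only [Function.comp]
      rw [Real.tanh_eq_sinh_div_cosh]
      field_simp
    have h3 := h2.mul ((hasDerivAt_sechPow hp x).pow 2)
    refine h3.congr_deriv ?_
    simp only [Pi.pow_apply]
    push_cast
    ring
  have hlim : Filter.Tendsto (fun x => Real.tanh (p * x / 2) * sechPow p x ^ 2) Filter.atTop
      (nhds 0) := by
    have h1 := (tendsto_sechPow hp).pow 2
    refine squeeze_zero_norm (a := fun x => sechPow p x ^ 2) (fun x => ?_) (by simpa using h1)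
    rw [norm_mul, Real.norm_of_nonneg (sq_nonneg (sechPow p x))]
    exact mul_le_of_le_one_left (sq_nonneg _) (Real.abs_tanh_lt_one _).le
  have i1 := (integrableOn_sechPow_sq hp).const_mul (p / 2)
  have i2 := (integrableOn_deriv_sechPow_sq hp).const_mul ((p + 4) / 2)
  have h2 := integral_Ioi_of_hasDerivAt_of_tendsto' hd (i1.sub i2) hlim
  rw [integral_sub i1 i2, integral_const_mul, integral_const_mul,
    integral_Ioi_deriv_sechPow_sq hp] at h2
  simp only [mul_zero, zero_div, Real.tanh_zero, zero_mul, sub_zero] at h2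
  field_simp
  linarith

/-- The mass `‖φ‖_1²` of the ground state. -/
lemma groundState_mass :
    (∫ x, groundState p x ^ 2) + ∫ x, deriv (groundState p) x ^ 2 =
      4 * ((p + 2) / p) * ((p + 2) / 2) ^ (2 / p) * wellPrim p 1 := by
  have hg : groundState p = fun x => ((p + 2) / 2) ^ (1 / p) * sechPow p x := rfl
  have hd : deriv (groundState p) = fun x =>
      ((p + 2) / 2) ^ (1 / p) * (-Real.tanh (p * x / 2) * sechPow p x) := by
    funext x
    rw [hg]
    exact ((hasDerivAt_sechPow hp x).const_mul _).deriv
  have hc : (((p + 2) / 2) ^ (1 / p)) ^ 2 = ((p + 2) / 2) ^ (2 / p) := by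
    rw [← Real.rpow_natCast, ← Real.rpow_mul (by positivity)]
    congr 1
    push_cast
    ring
  have habs : ∀ x, sechPow p |x| = sechPow p x := by
    intro x
    rcases abs_choice x with h | h <;> rw [h]
    rw [sechPow, sechPow, mul_neg, neg_div, Real.cosh_neg]
  have e1 : ∫ x, groundState p x ^ 2 =
      ((p + 2) / 2) ^ (2 / p) * (2 * ((p + 4) / p * wellPrim p 1)) := by
    rw [← integral_Ioi_sechPow_sq hp, ← integral_comp_abs (f := fun x => sechPow p x ^ 2),
      ← integral_const_mul]
    congr 1
    funext x
    rw [hg, habs, ← hc]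
    ring
  have e2 : ∫ x, deriv (groundState p) x ^ 2 =
      ((p + 2) / 2) ^ (2 / p) * (2 * wellPrim p 1) := by
    rw [← integral_Ioi_deriv_sechPow_sq hp,
      ← integral_comp_abs (f := fun x => (Real.tanh (p * x / 2) * sechPow p x) ^ 2),
      ← integral_const_mul]
    congr 1
    funext x
    have : Real.tanh (p * |x| / 2) ^ 2 = Real.tanh (p * x / 2) ^ 2 := by
      rcases abs_choice x with h | h <;> rw [h]
      rw [mul_neg, neg_div, Real.tanh_neg, neg_sq]
    rw [hd, habs, ← hc]
    simp only [mul_pow, this]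
    ring
  rw [e1, e2]
  field_simp
  ring

lemma wellPrim_one_pos : 0 < wellPrim p 1 := by
  refine intervalIntegral.intervalIntegral_pos_of_pos_on
    ((continuous_wellDensity hp).intervalIntegrable _ _) (fun x hx => ?_) one_pos
  have h1 : |x| = x := abs_of_pos hx.1
  have h2 : x ^ p < 1 := Real.rpow_lt_one hx.1.le hx.2 hp
  rw [wellDensity, h1]
  exact mul_pos hx.1 (Real.sqrt_pos.2 (by linarith))

end

end GBq
end

open MeasureTheory Set
open scoped FourierTransform ContDiff

noncomputable section

namespace GBq

/-! ### Sobolev and Gagliardo–Nirenberg inequalities on the line -/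

/-- Arbitrarily distant points where v is small replace the limit 0 at infinity in the inequalities
below. -/
lemma exists_gt_abs_lt {v : ℝ → ℝ} (hv : Integrable (fun x => v x ^ 2)) (A : ℝ) {ε : ℝ}
    (hε : 0 < ε) : ∃ y > A, |v y| < ε := by
  by_contra! h
  have h1 : IntegrableOn (fun _ : ℝ => ε ^ 2) (Ioi A) := by
    refine Integrable.mono' hv.integrableOn aestronglyMeasurable_const ?_
    refine (ae_restrict_iff' measurableSet_Ioi).2 (Filter.Eventually.of_forall fun x hx => ?_)
    rw [Real.norm_of_nonneg (sq_nonneg _), ← sq_abs (v x)]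
    have := h x hx
    gcongr
  rw [integrableOn_const_iff] at h1
  simp [hε.ne'] at h1

lemma exists_lt_abs_lt {v : ℝ → ℝ} (hv : Integrable (fun x => v x ^ 2)) (A : ℝ) {ε : ℝ}
    (hε : 0 < ε) : ∃ y < A, |v y| < ε := by
  obtain ⟨y, hy, h⟩ := exists_gt_abs_lt (v := fun x => v (-x)) hv.comp_neg (-A) hε
  exact ⟨-y, by linarith, h⟩

/-- The derivative of v² is 2vg ≤ v² + g²; integrate it from a point far to the left at which v is
small. -/
lemma IsPrim.sq_le {v g : ℝ → ℝ} (h : IsPrim v g) (hv : Integrable (fun x => v x ^ 2))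
    (hg : Integrable (fun x => g x ^ 2)) (x : ℝ) :
    v x ^ 2 ≤ (∫ x, v x ^ 2) + ∫ x, g x ^ 2 := by
  rw [← integral_add hv hg]
  refine le_of_forall_pos_le_add fun ε hε => ?_
  obtain ⟨y, hy, hyε⟩ := exists_lt_abs_lt hv x (Real.sqrt_pos.2 hε)
  have hyε' : v y ^ 2 ≤ ε := by
    rw [← sq_abs, ← Real.sq_sqrt hε.le]
    gcongr
  have h1 := (h.mul h)
  have h2 : v x ^ 2 - v y ^ 2 ≤ ∫ t in y..x, (v t ^ 2 + g t ^ 2) := by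
    have := h1.sub_eq y x
    rw [sq, sq, this]
    refine intervalIntegral.integral_mono_on hy.le (h1.intervalIntegrable _ _)
      (hv.add hg).intervalIntegrable fun t _ => ?_
    nlinarith [sq_nonneg (v t - g t)]
  have h3 : ∫ t in y..x, (v t ^ 2 + g t ^ 2) ≤ ∫ t, (v t ^ 2 + g t ^ 2) := by
    rw [intervalIntegral.integral_of_le hy.le]
    exact setIntegral_le_integral (hv.add hg) (Filter.Eventually.of_forall fun t => by positivity)
  linarith

lemma IsPrim.integrable_rpow {v g : ℝ → ℝ} (h : IsPrim v g) (hv : Integrable (fun x => v x ^ 2))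
    (hg : Integrable (fun x => g x ^ 2)) {p : ℝ} (hp : 0 < p) :
    Integrable (fun x => |v x| ^ (p + 2)) := by
  set B := (∫ x, v x ^ 2) + ∫ x, g x ^ 2 with hB
  refine Integrable.mono' (hv.const_mul (Real.sqrt B ^ p)) ?_ (Filter.Eventually.of_forall fun x => ?_)
  · exact (h.continuous.abs.rpow_const fun x => Or.inr (by linarith)).aestronglyMeasurable
  · rw [Real.norm_of_nonneg (Real.rpow_nonneg (abs_nonneg _) _),
      Real.rpow_add_of_nonneg (abs_nonneg _) hp.le (by norm_num), Real.rpow_two, sq_abs]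
    gcongr
    exact Real.abs_le_sqrt (h.sq_le hv hg x)

section
variable {p : ℝ} (hp : 0 < p)
include hp

omit hp in
lemma wellPrim_neg (r : ℝ) : wellPrim p (-r) = - wellPrim p r := by
  have := intervalIntegral.integral_comp_neg (a := 0) (b := r) (f := wellDensity p)
  simp only [wellDensity, abs_neg, neg_zero] at this
  rw [wellPrim, wellPrim, intervalIntegral.integral_symm]
  simp only [wellDensity]
  rw [this]

omit hp in
lemma abs_wellPrim (r : ℝ) : |wellPrim p r| = wellPrim p |r| := by
  have h : ∀ r : ℝ, 0 ≤ r → 0 ≤ wellPrim p r := fun r hr =>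
    intervalIntegral.integral_nonneg hr fun t _ => wellDensity_nonneg t
  rcases le_total 0 r with hr | hr
  · rw [abs_of_nonneg hr, abs_of_nonneg (h r hr)]
  · rw [abs_of_nonpos hr, wellPrim_neg, abs_of_nonpos]
    have := h (-r) (by linarith)
    rw [wellPrim_neg] at this
    linarith

lemma IsPrim.wellPrim_comp {v g : ℝ → ℝ} (h : IsPrim v g) :
    IsPrim (fun x => wellPrim p (v x)) (fun x => wellDensity p (v x) * g x) := by
  refine h.comp (by simp [wellPrim]) (fun R => ?_) (fun y _ => hasDerivAt_wellPrim hp y)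
  obtain ⟨C, hC⟩ := (isCompact_Icc (a := -R) (b := R)).exists_bound_of_continuousOn
    (continuous_wellDensity hp).continuousOn
  refine ⟨C.toNNReal, (convex_Icc _ _).lipschitzOnWith_of_nnnorm_hasDerivWithin_le
    (fun x _ => (hasDerivAt_wellPrim hp x).hasDerivWithinAt) fun x hx => ?_⟩
  rw [← NNReal.coe_le_coe, coe_nnnorm]
  exact (hC x hx).trans (Real.le_coe_toNNReal C)

/-- The sharp inequality for functions bounded by `1`. -/
lemma IsPrim.four_wellPrim_le {v g : ℝ → ℝ} (h : IsPrim v g) (hv : Integrable (fun x => v x ^ 2))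
    (hg : Integrable (fun x => g x ^ 2)) (h1 : ∀ x, |v x| ≤ 1) (x : ℝ) :
    4 * wellPrim p |v x| + ∫ x, |v x| ^ (p + 2) ≤ (∫ x, v x ^ 2) + ∫ x, g x ^ 2 := by
  have hS := h.integrable_rpow hv hg hp
  have hI : Integrable (fun x => (v x ^ 2 - |v x| ^ (p + 2)) + g x ^ 2) := (hv.sub hS).add hg
  have hP := h.wellPrim_comp hp
  -- Completing the square: the derivative of `wellPrim p (v)` has modulus D|g| ≤ (D² + g²)/2 with D
  -- = `wellDensity p (v)`, and D² = v² - |v|^{p+2} because |v| ≤ 1. Equality holds along the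
  -- profile ψ, where |ψ'| = D, which is why the constant is sharp.
  have hab : ∀ a b, a ≤ b → |wellPrim p (v b) - wellPrim p (v a)| ≤
      (1 / 2) * ∫ t in a..b, ((v t ^ 2 - |v t| ^ (p + 2)) + g t ^ 2) := by
    intro a b hab
    rw [hP.sub_eq a b, ← intervalIntegral.integral_const_mul]
    rw [← Real.norm_eq_abs]
    refine (intervalIntegral.norm_integral_le_integral_norm hab).trans ?_
    refine intervalIntegral.integral_mono_on hab (hP.intervalIntegrable _ _).norm
      (hI.const_mul _).intervalIntegrable fun t _ => ?_
    rw [← wellDensity_sq hp (h1 t), norm_mul, Real.norm_of_nonneg (wellDensity_nonneg _),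
      Real.norm_eq_abs, ← sq_abs (g t)]
    nlinarith [sq_nonneg (wellDensity p (v t) - |g t|)]
  have h0 : Filter.Tendsto (fun r => wellPrim p r) (nhds 0) (nhds 0) := by
    have := (hasDerivAt_wellPrim hp 0).continuousAt.tendsto
    have h00 : wellPrim p 0 = 0 := by simp [wellPrim]
    rwa [h00] at this
  -- The bound is used on both sides of x, out to points where v is small. Each half controls
  -- `wellPrim p |v x|` by half of its integral, so the sum gives the factor 4.
  have key : ∀ ε > 0, 4 * wellPrim p |v x| ≤
      (∫ t, ((v t ^ 2 - |v t| ^ (p + 2)) + g t ^ 2)) + ε := by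
    intro ε hε
    obtain ⟨δ, hδ, hδ'⟩ := Metric.tendsto_nhds_nhds.1 h0 (ε / 4) (by linarith)
    obtain ⟨y, hy, hyδ⟩ := exists_lt_abs_lt hv x hδ
    obtain ⟨z, hz, hzδ⟩ := exists_gt_abs_lt hv x hδ
    have e1 := hδ' (x := v y) (by simpa using hyδ)
    have e2 := hδ' (x := v z) (by simpa using hzδ)
    rw [dist_zero_right, Real.norm_eq_abs] at e1 e2
    have h2 := hab y x hy.le
    have h3 := hab x z hz.le
    have h4 : (∫ t in y..x, ((v t ^ 2 - |v t| ^ (p + 2)) + g t ^ 2)) +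
        ∫ t in x..z, ((v t ^ 2 - |v t| ^ (p + 2)) + g t ^ 2) ≤
        ∫ t, ((v t ^ 2 - |v t| ^ (p + 2)) + g t ^ 2) := by
      rw [intervalIntegral.integral_add_adjacent_intervals hI.intervalIntegrable
        hI.intervalIntegrable, intervalIntegral.integral_of_le (hy.trans hz).le]
      refine setIntegral_le_integral hI (Filter.Eventually.of_forall fun t => ?_)
      change 0 ≤ (v t ^ 2 - |v t| ^ (p + 2)) + g t ^ 2
      rw [← wellDensity_sq hp (h1 t)]
      positivity
    rw [← abs_wellPrim]
    have h5 : |wellPrim p (v x)| ≤ |wellPrim p (v x) - wellPrim p (v y)| + |wellPrim p (v y)| := by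
      have := abs_add_le (wellPrim p (v x) - wellPrim p (v y)) (wellPrim p (v y))
      simpa using this
    have h6 : |wellPrim p (v x)| ≤ |wellPrim p (v z) - wellPrim p (v x)| + |wellPrim p (v z)| := by
      have := abs_sub (wellPrim p (v z)) (wellPrim p (v z) - wellPrim p (v x))
      simp only [sub_sub_cancel] at this
      linarith
    linarith
  have h7 := le_of_forall_pos_le_add key
  have hvS : Integrable (fun x => v x ^ 2 - |v x| ^ (p + 2)) := hv.sub hS
  rw [integral_add hvS hg, integral_sub hv hS] at h7
  linarith

/-- The mass of the ground state. -/
def gsMass (p : ℝ) : ℝ := (∫ x, groundState p x ^ 2) + ∫ x, deriv (groundState p) x ^ 2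

lemma gsMass_pos : 0 < gsMass p := by
  rw [gsMass, groundState_mass hp]
  have := wellPrim_one_pos hp
  positivity

/-- Weighted arithmetic–geometric mean inequality, in the form that optimizes the amplitude. -/
lemma rpow_le_of_amplitude {X S M : ℝ} (hS : 0 ≤ S) (hM : 0 < M)
    (h : 4 * wellPrim p 1 * M ^ 2 + S * M ^ (-p) ≤ X) :
    S ≤ gsMass p ^ (-p / 2) * X ^ ((p + 2) / 2) := by
  have hN := gsMass_pos hp
  have hJ := wellPrim_one_pos hp
  set c := (p + 2) / 2 with hc
  have hc0 : 0 < c := by positivity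
  have e1 : 4 * wellPrim p 1 * M ^ 2 = p / (p + 2) * (gsMass p * c ^ (-(2 / p)) * M ^ 2) := by
    have h1 : c ^ (2 / p) * c ^ (-(2 / p)) = 1 := by
      rw [← Real.rpow_add hc0, add_neg_cancel, Real.rpow_zero]
    rw [gsMass, groundState_mass hp, ← hc]
    calc _ = 4 * wellPrim p 1 * M ^ 2 * (c ^ (2 / p) * c ^ (-(2 / p))) := by rw [h1, mul_one]
      _ = _ := by field_simp
  have e2 : S * M ^ (-p) = 2 / (p + 2) * (c * S * M ^ (-p)) := by
    rw [hc]; field_simp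
  -- With weights p/(p+2) and 2/(p+2) the powers of M cancel in the geometric mean, since 2·p/(p+2)
  -- = p·2/(p+2).
  have h2 := Real.geom_mean_le_arith_mean2_weighted (w₁ := p / (p + 2)) (w₂ := 2 / (p + 2))
    (p₁ := gsMass p * c ^ (-(2 / p)) * M ^ 2) (p₂ := c * S * M ^ (-p))
    (by positivity) (by positivity) (by positivity) (by positivity) (by field_simp)
  rw [← e1, ← e2] at h2
  have h3 := h2.trans h
  have h4 : (gsMass p * c ^ (-(2 / p)) * M ^ 2) ^ (p / (p + 2)) *
      (c * S * M ^ (-p)) ^ (2 / (p + 2)) = gsMass p ^ (p / (p + 2)) * S ^ (2 / (p + 2)) := by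
    have hp2 : p + 2 ≠ 0 := by positivity
    rw [Real.mul_rpow (by positivity) (by positivity), Real.mul_rpow (by positivity) (by positivity),
      Real.mul_rpow (by positivity) (by positivity), Real.mul_rpow (by positivity) (by positivity),
      ← Real.rpow_mul hc0.le, ← Real.rpow_mul hM.le, ← Real.rpow_natCast M, ← Real.rpow_mul hM.le]
    have a1 : c ^ (-(2 / p) * (p / (p + 2))) * c ^ (2 / (p + 2)) = 1 := by
      rw [← Real.rpow_add hc0]
      convert Real.rpow_zero c using 2
      field_simp
      ring
    have a2 : M ^ (((2 : ℕ) : ℝ) * (p / (p + 2))) * M ^ (-p * (2 / (p + 2))) = 1 := by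
      rw [← Real.rpow_add hM]
      convert Real.rpow_zero M using 2
      push_cast
      field_simp
      ring
    calc _ = gsMass p ^ (p / (p + 2)) * S ^ (2 / (p + 2)) *
        (c ^ (-(2 / p) * (p / (p + 2))) * c ^ (2 / (p + 2))) *
        (M ^ (((2 : ℕ) : ℝ) * (p / (p + 2))) * M ^ (-p * (2 / (p + 2)))) := by ring
      _ = _ := by rw [a1, a2]; ring
  rw [h4] at h3
  have h5 := Real.rpow_le_rpow (by positivity) h3 (z := (p + 2) / 2) (by positivity)
  rw [Real.mul_rpow (by positivity) (by positivity), ← Real.rpow_mul hN.le, ← Real.rpow_mul hS] at h5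
  have e3 : p / (p + 2) * ((p + 2) / 2) = p / 2 := by field_simp
  have e4 : 2 / (p + 2) * ((p + 2) / 2) = 1 := by field_simp
  rw [e3, e4, Real.rpow_one] at h5
  calc S = gsMass p ^ (-p / 2) * (gsMass p ^ (p / 2) * S) := by
        rw [← mul_assoc, ← Real.rpow_add hN]
        have : -p / 2 + p / 2 = 0 := by ring
        rw [this, Real.rpow_zero, one_mul]
    _ ≤ _ := by gcongr

/-- The sharp Gagliardo–Nirenberg–Sobolev inequality `‖v‖_{p+2} ≤ C_* ‖v‖_1`. -/
theorem IsPrim.integral_rpow_le {v g : ℝ → ℝ} (h : IsPrim v g) (hv : Integrable (fun x => v x ^ 2))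
    (hg : Integrable (fun x => g x ^ 2)) :
    ∫ x, |v x| ^ (p + 2) ≤
      gsMass p ^ (-p / 2) * ((∫ x, v x ^ 2) + ∫ x, g x ^ 2) ^ ((p + 2) / 2) := by
  set X := (∫ x, v x ^ 2) + ∫ x, g x ^ 2 with hX
  have hX0 : 0 ≤ X := add_nonneg (integral_nonneg fun x => sq_nonneg _)
    (integral_nonneg fun x => sq_nonneg _)
  have hbdd : BddAbove (range fun x => |v x|) := ⟨Real.sqrt X, by
    rintro _ ⟨x, rfl⟩
    exact Real.abs_le_sqrt (h.sq_le hv hg x)⟩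
  set M := sSup (range fun x => |v x|) with hM
  have hle : ∀ x, |v x| ≤ M := fun x => le_csSup hbdd ⟨x, rfl⟩
  have hM0 : 0 ≤ M := (abs_nonneg _).trans (hle 0)
  rcases hM0.eq_or_lt with h0 | hpos
  · have hz : ∀ x, v x = 0 := fun x => abs_eq_zero.1 (le_antisymm (h0 ▸ hle x) (abs_nonneg _))
    have : ∫ x, |v x| ^ (p + 2) = 0 := by
      simp [hz, Real.zero_rpow (by linarith : p + 2 ≠ 0)]
    rw [this]
    have := gsMass_pos hp
    positivity
  have hMi : M * M⁻¹ = 1 := mul_inv_cancel₀ hpos.ne'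
  have hw : IsPrim (fun x => M⁻¹ * v x) (fun x => M⁻¹ * g x) :=
    ⟨fun x y => (h.intervalIntegrable x y).const_mul _, fun x y => by
      rw [intervalIntegral.integral_const_mul, ← h.sub_eq]; ring⟩
  have hwa : ∀ x, |M⁻¹ * v x| = |v x| / M := fun x => by
    rw [abs_mul, abs_of_pos (inv_pos.2 hpos)]; ring
  have hmain : ∀ x, 4 * wellPrim p (|v x| / M) + M ^ (-(p + 2)) * ∫ x, |v x| ^ (p + 2) ≤
      M⁻¹ ^ 2 * X := by
    intro x
    have h1 := hw.four_wellPrim_le hp (by simpa only [mul_pow] using hv.const_mul (M⁻¹ ^ 2))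
      (by simpa only [mul_pow] using hg.const_mul (M⁻¹ ^ 2)) (fun x => by
        rw [hwa, div_le_one hpos]; exact hle x) x
    simp only [hwa, mul_pow] at h1
    rw [integral_const_mul, integral_const_mul, ← mul_add] at h1
    convert h1 using 2
    rw [← integral_const_mul]
    congr 1
    ext y
    rw [Real.div_rpow (abs_nonneg _) hpos.le, Real.rpow_neg hpos.le]
    ring
  -- Attainment of the supremum M is not needed: the inequality passes to the limit along a
  -- maximizing sequence, with amplitude tending to 1 after normalization.
  obtain ⟨u, -, hu, hu'⟩ := exists_seq_tendsto_sSup (range_nonempty (fun x => |v x|)) hbdd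
  have hlim : Filter.Tendsto (fun n => 4 * wellPrim p (u n / M) +
      M ^ (-(p + 2)) * ∫ x, |v x| ^ (p + 2)) Filter.atTop
      (nhds (4 * wellPrim p 1 + M ^ (-(p + 2)) * ∫ x, |v x| ^ (p + 2))) := by
    have h2 : Filter.Tendsto (fun n => u n / M) Filter.atTop (nhds 1) := by
      have := hu.div_const M
      rwa [← hM, div_self hpos.ne'] at this
    exact (((hasDerivAt_wellPrim hp 1).continuousAt.tendsto.comp h2).const_mul 4).add_const _
  have hfin := le_of_tendsto' hlim (fun n => by
    obtain ⟨x, hx⟩ := hu' n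
    rw [← hx]
    exact hmain x)
  refine rpow_le_of_amplitude hp (integral_nonneg fun x => Real.rpow_nonneg (abs_nonneg _) _) hpos ?_
  have h3 : M ^ (-p) = M ^ 2 * M ^ (-(p + 2)) := by
    rw [← Real.rpow_natCast, ← Real.rpow_add hpos]
    congr 1
    push_cast
    ring
  rw [h3]
  calc _ = M ^ 2 * (4 * wellPrim p 1 + M ^ (-(p + 2)) * ∫ x, |v x| ^ (p + 2)) := by ring
    _ ≤ M ^ 2 * (M⁻¹ ^ 2 * X) := by gcongr
    _ = (M * M⁻¹) ^ 2 * X := by ring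
    _ = X := by rw [hMi]; ring

end

end GBq
end

open MeasureTheory Set
open scoped FourierTransform ContDiff

noncomputable section

namespace GBq

/-! ### Composition operators on bounded elements of `L²` -/

lemma L2.inner_eq_integral (u v : L2) : (inner ℝ u v : ℝ) = ∫ x, u x * v x := by
  rw [L2.inner_def]
  refine integral_congr_ae (Filter.Eventually.of_forall fun x => ?_)
  simp [mul_comm]

lemma L2.integrable_mul (u v : L2) : Integrable (fun x => u x * v x) := by
  refine (L2.integrable_inner (𝕜 := ℝ) u v).congr (Filter.Eventually.of_forall fun x => ?_)
  simp [mul_comm]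

lemma L2.norm_sq_eq (u : L2) : ‖u‖ ^ 2 = ∫ x, u x ^ 2 := by
  rw [← real_inner_self_eq_norm_sq, L2.inner_eq_integral]
  simp only [sq]

lemma L2.integrable_sq (u : L2) : Integrable (fun x => u x ^ 2) := by
  simpa only [sq] using L2.integrable_mul u u

/-- `h` vanishes at the origin and is Lipschitz on bounded sets. -/
structure LocLip (h : ℝ → ℝ) : Prop where
  zero : h 0 = 0
  lip : ∀ R, ∃ K : NNReal, LipschitzOnWith K h (Icc (-R) R)

lemma LocLip.continuous {h : ℝ → ℝ} (hh : LocLip h) : Continuous h := by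
  rw [continuous_iff_continuousAt]
  intro x
  obtain ⟨K, hK⟩ := hh.lip (|x| + 1)
  have := abs_lt.1 (lt_add_one |x|)
  exact hK.continuousOn.continuousAt (Icc_mem_nhds this.1 this.2)

lemma locLip_of_hasDerivAt {h h' : ℝ → ℝ} (h0 : h 0 = 0) (hd : ∀ y, HasDerivAt h (h' y) y)
    (hc : Continuous h') : LocLip h := by
  refine ⟨h0, fun R => ?_⟩
  obtain ⟨C, hC⟩ := (isCompact_Icc (a := -R) (b := R)).exists_bound_of_continuousOn hc.continuousOn
  refine ⟨C.toNNReal, (convex_Icc _ _).lipschitzOnWith_of_nnnorm_hasDerivWithin_le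
    (fun x _ => (hd x).hasDerivWithinAt) fun x hx => ?_⟩
  rw [← NNReal.coe_le_coe, coe_nnnorm]
  exact (hC x hx).trans (Real.le_coe_toNNReal C)

open Classical in
/-- A function as an element of `L²`, when it is one. -/
def ofFun (f : ℝ → ℝ) : L2 := if hf : MemLp f 2 volume then hf.toLp else 0

lemma ofFun_coeFn {f : ℝ → ℝ} (hf : MemLp f 2 volume) : ofFun f =ᵐ[volume] f := by
  rw [ofFun, dif_pos hf]
  exact hf.coeFn_toLp

/-- The composition `x ↦ h (u x)`, as an element of `L²` when it is one. -/
def nem (h : ℝ → ℝ) (u : L2) : L2 := ofFun fun x => h (u x)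

lemma LocLip.nem_coeFn {h : ℝ → ℝ} (hh : LocLip h) {u : L2} {R : ℝ} (hu : ∀ᵐ x, |u x| ≤ R) :
    nem h u =ᵐ[volume] fun x => h (u x) := by
  have hm : MemLp (fun x => h (u x)) 2 volume := by
    obtain ⟨K, hK⟩ := hh.lip R
    refine MemLp.of_le_mul (Lp.memLp u)
      (hh.continuous.comp_aestronglyMeasurable (Lp.aestronglyMeasurable _)) (c := K) ?_
    filter_upwards [hu] with x hx
    have hR : 0 ≤ R := (abs_nonneg _).trans hx
    have := hK.dist_le_mul (u x) (abs_le.1 hx) 0 ⟨by linarith, hR⟩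
    simpa [hh.zero] using this
  exact ofFun_coeFn hm

lemma LocLip.exists_nem_lipschitz {h : ℝ → ℝ} (hh : LocLip h) (R : ℝ) :
    ∃ K : NNReal, ∀ u v : L2, (∀ᵐ x, |u x| ≤ R) → (∀ᵐ x, |v x| ≤ R) →
      ‖nem h u - nem h v‖ ≤ K * ‖u - v‖ := by
  obtain ⟨K, hK⟩ := hh.lip R
  refine ⟨K, fun u v hu hv => Lp.norm_le_mul_norm_of_ae_le_mul ?_⟩
  filter_upwards [hu, hv, hh.nem_coeFn hu, hh.nem_coeFn hv, Lp.coeFn_sub u v,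
    Lp.coeFn_sub (nem h u) (nem h v)] with x h1 h2 h3 h4 h5 h6
  rw [h5, h6, Pi.sub_apply, Pi.sub_apply, h3, h4, ← dist_eq_norm, ← dist_eq_norm]
  exact hK.dist_le_mul _ (abs_le.1 h1) _ (abs_le.1 h2)

/-! ### The nonlinearity -/

section
variable {a p : ℝ}

lemma hasDerivAt_abs_rpow_mul (hp : 0 < p) (y : ℝ) :
    HasDerivAt (fun y : ℝ => |y| ^ p * y) ((p + 1) * |y| ^ p) y := by
  rcases eq_or_ne y 0 with rfl | hy
  · rw [hasDerivAt_iff_tendsto_slope]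
    simp only [abs_zero, Real.zero_rpow hp.ne', mul_zero]
    have h : Filter.Tendsto (fun y : ℝ => |y| ^ p) (nhdsWithin 0 {0}ᶜ) (nhds 0) := by
      have := (continuous_abs.rpow_const fun x => Or.inr hp.le :
        Continuous fun y : ℝ => |y| ^ p).tendsto 0
      simp only [abs_zero, Real.zero_rpow hp.ne'] at this
      exact this.mono_left nhdsWithin_le_nhds
    refine h.congr' ?_
    filter_upwards [self_mem_nhdsWithin] with y hy
    have hy : y ≠ 0 := hy
    rw [slope_def_field]
    simp only [abs_zero, Real.zero_rpow hp.ne', mul_zero, sub_zero]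
    field_simp
  · have h1 : HasDerivAt (fun y : ℝ => |y|) (SignType.sign y : ℝ) y := hasDerivAt_abs hy
    have h2 := (h1.rpow_const (p := p) (Or.inl (abs_ne_zero.2 hy))).mul (hasDerivAt_id y)
    refine h2.congr_deriv ?_
    have e : (SignType.sign y : ℝ) * y = |y| := sign_mul_self y
    have e2 : |y| ^ p = |y| ^ (p - 1) * |y| := by
      rw [← Real.rpow_add_one (abs_ne_zero.2 hy)]; simp
    simp only [id_eq, mul_one]
    rw [e2, ← e]
    ring

lemma hasDerivAt_nonlin (hp : 0 < p) (y : ℝ) :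
    HasDerivAt (nonlin a p) (-a * ((p + 1) * |y| ^ p)) y := by
  have := (hasDerivAt_abs_rpow_mul hp y).const_mul (-a)
  refine this.congr_of_eventuallyEq (Filter.Eventually.of_forall fun z => ?_)
  simp [nonlin, mul_assoc]

lemma continuous_abs_rpow (hp : 0 ≤ p) : Continuous fun y : ℝ => |y| ^ p :=
  continuous_abs.rpow_const fun _ => Or.inr hp

lemma locLip_nonlin (a : ℝ) (hp : 0 < p) : LocLip (nonlin a p) :=
  locLip_of_hasDerivAt (by simp [nonlin]) (hasDerivAt_nonlin hp)
    (((continuous_abs_rpow hp.le).const_mul _).const_mul _)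

lemma hasDerivAt_nonlinPrim (hp : 0 < p) (y : ℝ) : HasDerivAt (nonlinPrim a p) (nonlin a p y) y :=
  intervalIntegral.integral_hasDerivAt_right
    ((locLip_nonlin a hp).continuous.intervalIntegrable _ _)
    ((locLip_nonlin a hp).continuous.stronglyMeasurableAtFilter _ _)
    (locLip_nonlin a hp).continuous.continuousAt

lemma abs_rpow_mul_sq (hp : 0 < p) (y : ℝ) : |y| ^ p * y * y = |y| ^ (p + 2) := by
  rw [Real.rpow_add_of_nonneg (abs_nonneg _) hp.le (by norm_num), Real.rpow_two, sq_abs]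
  ring

lemma nonlinPrim_eq (hp : 0 < p) (y : ℝ) :
    nonlinPrim a p y = -(a / (p + 2)) * |y| ^ (p + 2) := by
  have h1 : ∀ y, HasDerivAt (fun y : ℝ => -(a / (p + 2)) * |y| ^ (p + 2)) (nonlin a p y) y := by
    intro y
    have h2 := ((hasDerivAt_abs_rpow_mul hp y).mul (hasDerivAt_id y)).const_mul (-(a / (p + 2)))
    refine (h2.congr_of_eventuallyEq (Filter.Eventually.of_forall fun z => ?_)).congr_deriv ?_
    · simp [← abs_rpow_mul_sq hp]
    · simp only [nonlin, id_eq]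
      field_simp
      ring
  have := is_const_of_deriv_eq_zero
    (f := fun y => nonlinPrim a p y - -(a / (p + 2)) * |y| ^ (p + 2))
    (fun y => ((hasDerivAt_nonlinPrim hp y).sub (h1 y)).differentiableAt)
    (fun y => ((hasDerivAt_nonlinPrim hp y).sub (h1 y)).deriv.trans (sub_self _)) y 0
  simp [nonlinPrim, Real.zero_rpow (by linarith : p + 2 ≠ 0)] at this
  rw [nonlinPrim]
  linarith

lemma nonlin_mul_self (hp : 0 < p) (y : ℝ) : nonlin a p y * y = (p + 2) * nonlinPrim a p y := by
  rw [nonlinPrim_eq hp, nonlin, ← abs_rpow_mul_sq hp]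
  field_simp

/-- A crude Young inequality: |y|^{p+1}|z| is at most the (p+2)-th power of the larger of |y|, |z|.
It is phrased through F so that, after integration, the error caused by the correction W in the
blow-up argument is measured by potential energies. -/
lemma abs_mul_nonlin_le (ha : 0 ≤ a) (hp : 0 < p) (y z : ℝ) :
    |z * nonlin a p y| ≤ (p + 2) * (-nonlinPrim a p y - nonlinPrim a p z) := by
  have e : (p + 2) * (-nonlinPrim a p y - nonlinPrim a p z) =
      a * (|y| ^ (p + 2) + |z| ^ (p + 2)) := by
    rw [nonlinPrim_eq hp, nonlinPrim_eq hp]; field_simp; ring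
  have e2 : |z * nonlin a p y| = a * (|y| ^ p * |y| * |z|) := by
    rw [nonlin, abs_mul, abs_mul, abs_mul, abs_neg, abs_of_nonneg ha,
      abs_of_nonneg (Real.rpow_nonneg (abs_nonneg y) p)]
    ring
  rw [e, e2]
  have h (x : ℝ) : |x| ^ (p + 2) = |x| ^ p * |x| * |x| := by
    rw [← abs_rpow_mul_sq hp]; rw [mul_assoc, mul_assoc, abs_mul_abs_self]
  have hy := Real.rpow_nonneg (abs_nonneg y) p
  have hz := Real.rpow_nonneg (abs_nonneg z) p
  gcongr
  rcases le_total |y| |z| with hyz | hyz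
  · have : |y| ^ p * |y| * |z| ≤ |z| ^ p * |z| * |z| := by gcongr
    rw [← h] at this
    have := Real.rpow_nonneg (abs_nonneg y) (p + 2)
    linarith
  · have : |y| ^ p * |y| * |z| ≤ |y| ^ p * |y| * |y| := by gcongr
    rw [← h] at this
    have := Real.rpow_nonneg (abs_nonneg z) (p + 2)
    linarith

/-- A second-order Taylor bound obtained from the Lipschitz continuity of f alone; integrated over x
it gives differentiability of the potential energy. -/
lemma abs_nonlinPrim_sub_le (a : ℝ) (hp : 0 < p) (R : ℝ) : ∃ K : NNReal, ∀ y ∈ Icc (-R) R, ∀ z ∈ Icc (-R) R,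
    |nonlinPrim a p z - nonlinPrim a p y - nonlin a p y * (z - y)| ≤ K * (z - y) ^ 2 := by
  obtain ⟨K, hK⟩ := (locLip_nonlin a hp).lip R
  refine ⟨K, fun y hy z hz => ?_⟩
  have hsub : uIcc y z ⊆ Icc (-R) R := (ordConnected_Icc).uIcc_subset hy hz
  have h := (convex_uIcc y z).norm_image_sub_le_of_norm_hasDerivWithin_le
    (f := fun x => nonlinPrim a p x - nonlin a p y * x)
    (f' := fun x => nonlin a p x - nonlin a p y) (C := K * |z - y|)
    (fun x _ => ((hasDerivAt_nonlinPrim hp x).sub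
      ((hasDerivAt_id x).const_mul (nonlin a p y))).hasDerivWithinAt.congr_deriv (by simp))
    (fun x hx => ?_) left_mem_uIcc right_mem_uIcc
  · rw [Real.norm_eq_abs, Real.norm_eq_abs] at h
    calc _ = |nonlinPrim a p z - nonlin a p y * z - (nonlinPrim a p y - nonlin a p y * y)| := by
          congr 1; ring
      _ ≤ K * |z - y| * |z - y| := h
      _ = _ := by rw [mul_assoc, abs_mul_abs_self, sq]
  · refine (hK.dist_le_mul x (hsub hx) y hy).trans ?_
    gcongr
    rw [Real.dist_eq]
    rw [abs_sub_comm x y, abs_sub_comm z y]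
    exact abs_sub_left_of_mem_uIcc hx |>.trans_eq (abs_sub_comm _ _) |> fun h => by
      simpa [abs_sub_comm] using h

end

/-! ### The Bessel potential of order one and the potential energy -/

/-- `J = (1 - ∂ₓ²)^{-1/2}`. -/
def besselJ : L2 →L[ℝ] L2 := mulOp (fun k => (besselSymbol (-1) k : ℂ))

lemma measurable_besselSymbol (s : ℝ) : Measurable (besselSymbol s) := by
  unfold besselSymbol; fun_prop

lemma besselSymbol_neg_arg (s k : ℝ) : besselSymbol s (-k) = besselSymbol s k := by
  simp [besselSymbol]

lemma besselSymbol_mul (s r k : ℝ) : besselSymbol s k * besselSymbol r k = besselSymbol (s + r) k := by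
  rw [besselSymbol, besselSymbol, besselSymbol, ← Real.rpow_add (by positivity)]
  ring_nf

lemma besselSymbol_zero (k : ℝ) : besselSymbol 0 k = 1 := by simp [besselSymbol]

lemma besselSymbol_two (k : ℝ) : besselSymbol 2 k = 1 + k ^ 2 := by simp [besselSymbol]

lemma besselSymbol_mono {s r : ℝ} (h : s ≤ r) (k : ℝ) : besselSymbol s k ≤ besselSymbol r k :=
  Real.rpow_le_rpow_of_exponent_le (by nlinarith [sq_nonneg k]) (by linarith)

lemma besselSymbol_le_one {s : ℝ} (hs : s ≤ 0) (k : ℝ) : besselSymbol s k ≤ 1 :=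
  (besselSymbol_mono hs k).trans_eq (besselSymbol_zero k)

lemma isSymbol_bessel {s : ℝ} (hs : s ≤ 0) : IsSymbol (fun k => (besselSymbol s k : ℂ)) where
  toIsHerm := isHerm_ofReal (measurable_besselSymbol s) (besselSymbol_neg_arg s)
  bdd := ⟨1, fun k => by
    rw [Complex.norm_real, Real.norm_of_nonneg (besselSymbol_pos s k).le]
    exact besselSymbol_le_one hs k⟩

lemma hasMul_besselJ (U : L2) : HasMul (fun k => (besselSymbol (-1) k : ℂ)) U (besselJ U) :=
  hasMul_mulOp (isSymbol_bessel (by norm_num)) U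

lemma norm_besselJ_le (U : L2) : ‖besselJ U‖ ≤ ‖U‖ := by
  simpa using (hasMul_besselJ U).norm_le (hasMul_one U) (C := 1) (fun k _ => by
    rw [Complex.norm_real, Real.norm_of_nonneg (besselSymbol_pos _ k).le]
    simpa using besselSymbol_le_one (by norm_num) k)

lemma inner_besselJ (U V : L2) : (inner ℝ (besselJ U) V : ℝ) = inner ℝ U (besselJ V) :=
  HasMul.inner_symm (fun _ => Complex.conj_ofReal _) (hasMul_besselJ U) (hasMul_besselJ V)

/-- Pythagoras for multipliers. -/
lemma HasMul.norm_sq_add {m m₁ m₂ : ℝ → ℂ} {u v v₁ v₂ : L2} (h : HasMul m u v)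
    (h₁ : HasMul m₁ u v₁) (h₂ : HasMul m₂ u v₂)
    (hm : ∀ k ≠ 0, ‖m₁ k‖ ^ 2 + ‖m₂ k‖ ^ 2 = ‖m k‖ ^ 2) : ‖v₁‖ ^ 2 + ‖v₂‖ ^ 2 = ‖v‖ ^ 2 := by
  have key : ∀ w : L2, ‖w‖ ^ 2 = ∫ ξ, ‖hat w ξ‖ ^ 2 := fun w => by
    rw [← real_inner_self_eq_norm_sq, inner_eq_integral_hat]
    refine integral_congr_ae (Filter.Eventually.of_forall fun ξ => ?_)
    simp only [Complex.mul_conj, Complex.normSq_eq_norm_sq, Complex.ofReal_re]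
  have hint : ∀ w : L2, Integrable fun ξ => ‖hat w ξ‖ ^ 2 := fun w =>
    (Lp.memLp (hat w)).integrable_norm_pow (by norm_num)
  rw [key, key, key, ← integral_add (hint _) (hint _)]
  apply integral_congr_ae
  filter_upwards [h, h₁, h₂, Measure.ae_ne volume (0 : ℝ)] with ξ e e₁ e₂ e3
  rw [e, e₁, e₂, norm_mul, norm_mul, norm_mul, mul_pow, mul_pow, mul_pow, ← add_mul,
    hm _ (by simp [e3, Real.pi_ne_zero])]

lemma isSymbol_der_bessel : IsSymbol (fun k => k * Complex.I * besselSymbol (-1) k) where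
  measurable := by
    have := Complex.measurable_ofReal.comp (measurable_besselSymbol (-1))
    exact (Complex.measurable_ofReal.mul_const _).mul this
  neg k := by simp [besselSymbol_neg_arg]
  bdd := ⟨1, fun k => by
    have e : besselSymbol 1 k * besselSymbol (-1) k = 1 := by
      rw [besselSymbol_mul]; simp [besselSymbol_zero]
    have h : |k| ≤ besselSymbol 1 k := by
      rw [besselSymbol, ← Real.sqrt_eq_rpow]
      exact Real.abs_le_sqrt (by linarith)
    simp only [norm_mul, Complex.norm_real, Complex.norm_I, mul_one, Real.norm_eq_abs]
    rw [abs_of_pos (besselSymbol_pos (-1) k)]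
    exact (mul_le_mul_of_nonneg_right h (besselSymbol_pos _ k).le).trans_eq e⟩

/-- Elements of `H¹(ℝ)` and their derivatives. -/
lemma exists_isPrim_besselJ (U : L2) : ∃ v g : ℝ → ℝ, besselJ U =ᵐ[volume] v ∧ IsPrim v g ∧
    Integrable (fun x => v x ^ 2) ∧ Integrable (fun x => g x ^ 2) ∧
    (∫ x, v x ^ 2) + ∫ x, g x ^ 2 = ‖U‖ ^ 2 := by
  obtain ⟨g, hg⟩ := isSymbol_der_bessel.exists_hasMul U
  have hd : HasDer (besselJ U) g := by
    obtain ⟨g', hg'⟩ := exists_hasMul_of_le (m := fun k => (k : ℂ) * Complex.I) (u := besselJ U)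
      (w := g) (m' := fun k => k * Complex.I) (C := 1)
      ⟨Complex.measurable_ofReal.mul_const _, fun k => by simp⟩ (by
        filter_upwards [hg, hasMul_besselJ U] with ξ h1 h2
        rw [h1, h2]; push_cast; ring) (by simp)
    rwa [hg.unique ((hasMul_besselJ U).comp hg' fun k _ => rfl)]
  obtain ⟨v, hv, hvg⟩ := hd.exists_isPrim
  have e : (fun x => (besselJ U : ℝ → ℝ) x ^ 2) =ᵐ[volume] fun x => v x ^ 2 := by
    filter_upwards [hv] with x hx
    rw [hx]
  refine ⟨v, g, hv, hvg, (L2.integrable_sq _).congr e, L2.integrable_sq g, ?_⟩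
  rw [← integral_congr_ae e, ← L2.norm_sq_eq, ← L2.norm_sq_eq]
  refine (hasMul_one U).norm_sq_add (hasMul_besselJ U) hg fun k _ => ?_
  simp only [norm_mul, Complex.norm_real, Complex.norm_I, mul_one, Real.norm_eq_abs, mul_pow,
    sq_abs, norm_one, one_pow]
  have : besselSymbol 2 k * (besselSymbol (-1) k * besselSymbol (-1) k) = 1 := by
    rw [besselSymbol_mul, besselSymbol_mul]; norm_num [besselSymbol_zero]
  rw [besselSymbol_two] at this
  linarith

/-- The embedding H¹ ⊂ L^∞ with constant 1, seen through J. A ball in L² becomes a set on which the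
nonlinearity is Lipschitz. -/
lemma ae_abs_besselJ_le (U : L2) : ∀ᵐ x, |besselJ U x| ≤ ‖U‖ := by
  obtain ⟨v, g, hv, hp, h1, h2, h3⟩ := exists_isPrim_besselJ U
  filter_upwards [hv] with x hx
  rw [hx]
  refine abs_le_of_sq_le_sq ((hp.sq_le h1 h2 x).trans_eq h3) (norm_nonneg _)

section
variable (a p : ℝ)

/-- `g(U) = f(JU)`. -/
def nl (U : L2) : L2 := nem (nonlin a p) (besselJ U)

/-- `G(U) = ∫ F(JU)`. -/
def pot (U : L2) : ℝ := ∫ x, nonlinPrim a p (besselJ U x)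

variable {a p}
variable (ha : 0 < a) (hp : 0 < p)
include hp

lemma nl_coeFn (U : L2) : nl a p U =ᵐ[volume] fun x => nonlin a p (besselJ U x) :=
  (locLip_nonlin a hp).nem_coeFn (ae_abs_besselJ_le U)

/-- This is what makes the Hamiltonian system an ordinary differential equation in L² × L². -/
lemma exists_nl_lipschitz (R : ℝ) : ∃ K : NNReal, ∀ U V : L2, ‖U‖ ≤ R → ‖V‖ ≤ R →
    ‖nl a p U - nl a p V‖ ≤ K * ‖U - V‖ := by
  obtain ⟨K, hK⟩ := (locLip_nonlin a hp).exists_nem_lipschitz R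
  refine ⟨K, fun U V hU hV => (hK _ _ ?_ ?_).trans ?_⟩
  · filter_upwards [ae_abs_besselJ_le U] with x hx using hx.trans hU
  · filter_upwards [ae_abs_besselJ_le V] with x hx using hx.trans hV
  · rw [← map_sub]
    gcongr
    exact norm_besselJ_le _

lemma integrable_abs_rpow_besselJ (U : L2) : Integrable fun x => |besselJ U x| ^ (p + 2) := by
  obtain ⟨v, g, hv, hpr, h1, h2, h3⟩ := exists_isPrim_besselJ U
  refine (hpr.integrable_rpow h1 h2 hp).congr ?_
  filter_upwards [hv] with x hx
  rw [hx]

lemma integrable_pot (U : L2) : Integrable fun x => nonlinPrim a p (besselJ U x) := by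
  simp only [nonlinPrim_eq hp]
  exact (integrable_abs_rpow_besselJ hp U).const_mul _

lemma pot_eq (U : L2) : pot a p U = -(a / (p + 2)) * ∫ x, |besselJ U x| ^ (p + 2) := by
  rw [pot, ← integral_const_mul]
  simp only [nonlinPrim_eq hp]

lemma inner_nl (U : L2) : (inner ℝ (nl a p U) (besselJ U) : ℝ) = (p + 2) * pot a p U := by
  rw [L2.inner_eq_integral, pot, ← integral_const_mul]
  apply integral_congr_ae
  filter_upwards [nl_coeFn (a := a) hp U] with x hx
  rw [hx, nonlin_mul_self hp]

/-- JU and JV are bounded in L^∞ for V near U, so the Taylor remainder of F integrates to at most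
K‖J(V-U)‖² ≤ K‖V-U‖². -/
lemma hasFDerivAt_pot (U : L2) :
    HasFDerivAt (pot a p) ((innerSL ℝ (nl a p U)).comp besselJ) U := by
  obtain ⟨K, hK⟩ := abs_nonlinPrim_sub_le a hp (‖U‖ + 1)
  have main : ∀ V : L2, ‖V - U‖ ≤ 1 →
      ‖pot a p V - pot a p U - inner ℝ (nl a p U) (besselJ (V - U))‖ ≤ K * ‖V - U‖ ^ 2 := by
    intro V hV
    have hVn : ‖V‖ ≤ ‖U‖ + 1 := by
      have := norm_le_insert' V U
      linarith
    have e := Lp.coeFn_sub (besselJ V) (besselJ U)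
    have i1 : Integrable fun x => nonlinPrim a p (besselJ V x) - nonlinPrim a p (besselJ U x) :=
      (integrable_pot hp V).sub (integrable_pot hp U)
    have i2 := L2.integrable_mul (nl a p U) (besselJ V - besselJ U)
    rw [map_sub, L2.inner_eq_integral, pot, pot, ← integral_sub (integrable_pot hp V)
      (integrable_pot hp U), ← integral_sub i1 i2]
    calc _ ≤ ∫ x, K * (besselJ V - besselJ U : L2) x ^ 2 := by
          refine norm_integral_le_of_norm_le ((L2.integrable_sq _).const_mul _) ?_
          filter_upwards [e, nl_coeFn (a := a) hp U, ae_abs_besselJ_le U, ae_abs_besselJ_le V]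
            with x h1 h2 h3 h4
          rw [h1, h2, Pi.sub_apply]
          exact hK _ (abs_le.1 (h3.trans (by linarith))) _ (abs_le.1 (h4.trans hVn))
      _ = K * ‖besselJ (V - U)‖ ^ 2 := by
          rw [integral_const_mul, L2.norm_sq_eq, map_sub]
      _ ≤ _ := by gcongr; exact norm_besselJ_le _
  refine HasFDerivAt.of_isLittleO ?_
  have hO : (fun V => pot a p V - pot a p U - inner ℝ (nl a p U) (besselJ (V - U))) =O[nhds U]
      fun V => ‖V - U‖ ^ 2 := by
    refine Asymptotics.IsBigO.of_bound K ?_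
    filter_upwards [Metric.closedBall_mem_nhds U one_pos] with V hV
    rw [mem_closedBall_iff_norm] at hV
    simpa using main V hV
  exact hO.trans_isLittleO (Asymptotics.isLittleO_norm_pow_id one_lt_two |>.comp_tendsto (by
    have : Filter.Tendsto (fun V => V - U) (nhds U) (nhds (U - U)) :=
      (continuous_id.sub continuous_const).tendsto U
    rwa [sub_self] at this))

include ha

lemma abs_inner_nl_le (W U : L2) :
    |(inner ℝ (besselJ W) (nl a p U) : ℝ)| ≤ (p + 2) * (-pot a p U - pot a p W) := by
  have h1 : Integrable fun x => -nonlinPrim a p (besselJ U x) := (integrable_pot hp U).neg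
  rw [L2.inner_eq_integral, pot, pot, ← integral_neg, ← integral_sub h1 (integrable_pot hp W),
    ← integral_const_mul, ← Real.norm_eq_abs]
  refine norm_integral_le_of_norm_le ((h1.sub (integrable_pot hp W)).const_mul _) ?_
  filter_upwards [nl_coeFn (a := a) hp U] with x hx
  rw [hx]
  exact abs_mul_nonlin_le ha.le hp _ _

/-- The amplitude at which the potential well attains its depth. -/
def wellRadius (a p : ℝ) : ℝ := a ^ (-(1 / p)) * Real.sqrt (gsMass p)

lemma wellRadius_pos : 0 < wellRadius a p := by
  have := Real.sqrt_pos.2 (gsMass_pos hp)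
  unfold wellRadius
  positivity

lemma wellRadius_sq : wellRadius a p ^ 2 = a ^ (-2 / p) * gsMass p := by
  rw [wellRadius, mul_pow, Real.sq_sqrt (gsMass_pos hp).le, ← Real.rpow_natCast, ← Real.rpow_mul ha.le]
  congr 2
  push_cast
  ring

/-- The sharp inequality, in terms of the potential energy. -/
lemma neg_pot_le (U : L2) :
    -((p + 2) * pot a p U) ≤ ‖U‖ ^ 2 * (‖U‖ / wellRadius a p) ^ p := by
  obtain ⟨v, g, hv, hpr, h1, h2, h3⟩ := exists_isPrim_besselJ U
  have h4 := hpr.integral_rpow_le hp h1 h2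
  rw [h3] at h4
  have e : ∫ x, |besselJ U x| ^ (p + 2) = ∫ x, |v x| ^ (p + 2) := by
    apply integral_congr_ae
    filter_upwards [hv] with x hx
    rw [hx]
  have hg := gsMass_pos hp
  have e1 : (‖U‖ ^ 2) ^ ((p + 2) / 2) = ‖U‖ ^ p * ‖U‖ ^ 2 := by
    rw [← Real.rpow_natCast, ← Real.rpow_mul (norm_nonneg _), ← Real.rpow_add_of_nonneg
      (norm_nonneg _) hp.le (by norm_num)]
    congr 1
    push_cast
    ring
  have e2 : wellRadius a p ^ p = a⁻¹ * gsMass p ^ (p / 2) := by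
    rw [wellRadius, Real.mul_rpow (by positivity) (by positivity), ← Real.rpow_mul ha.le,
      Real.sqrt_eq_rpow, ← Real.rpow_mul hg.le, ← Real.rpow_neg_one a]
    congr 2 <;> field_simp
  rw [Real.div_rpow (norm_nonneg _) (wellRadius_pos ha hp).le, e2, pot_eq hp, e]
  rw [e1] at h4
  have e3 : gsMass p ^ (-p / 2) = (gsMass p ^ (p / 2))⁻¹ := by
    rw [← Real.rpow_neg hg.le]; congr 1; ring
  rw [e3] at h4
  calc _ = a * ∫ x, |v x| ^ (p + 2) := by field_simp
    _ ≤ a * ((gsMass p ^ (p / 2))⁻¹ * (‖U‖ ^ p * ‖U‖ ^ 2)) := by gcongr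
    _ = _ := by field_simp

end

end GBq
end

open MeasureTheory Set
open scoped FourierTransform ContDiff

noncomputable section

namespace GBq

/-! ### Autonomous ODEs with a field that is Lipschitz on bounded sets -/

section
variable {E : Type*} [NormedAddCommGroup E]

/-- Lipschitz on every ball. -/
def LipOnBalls (v : E → E) : Prop :=
  ∀ R : ℝ, ∃ K : NNReal, LipschitzOnWith K v (Metric.closedBall 0 R)

variable [NormedSpace ℝ E] {v : E → E} (hv : LipOnBalls v)
include hv

/-- Right derivatives suffice. This matters because a solution of the wave equation on [0, T) has
only one-sided time derivatives at 0. -/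
lemma LipOnBalls.eqOn_Ico {f g : ℝ → E} {T : ℝ}
    (hf : ContinuousOn f (Ico 0 T)) (hg : ContinuousOn g (Ico 0 T))
    (hf' : ∀ t ∈ Ico 0 T, HasDerivWithinAt f (v (f t)) (Ici t) t)
    (hg' : ∀ t ∈ Ico 0 T, HasDerivWithinAt g (v (g t)) (Ici t) t)
    (h0 : f 0 = g 0) : EqOn f g (Ico 0 T) := by
  intro t ht
  have hsub : Icc 0 t ⊆ Ico 0 T := fun x hx => ⟨hx.1, hx.2.trans_lt ht.2⟩
  obtain ⟨A, hA⟩ := isCompact_Icc.exists_bound_of_continuousOn (hf.mono hsub)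
  obtain ⟨B, hB⟩ := isCompact_Icc.exists_bound_of_continuousOn (hg.mono hsub)
  obtain ⟨K, hK⟩ := hv (max A B)
  exact ODE_solution_unique_of_mem_Icc_right (v := fun _ => v) (K := K)
    (s := fun _ => Metric.closedBall 0 (max A B)) (fun _ _ => hK) (hf.mono hsub)
    (fun x hx => hf' x (hsub (Ico_subset_Icc_self hx)))
    (fun x hx => by simpa using Or.inl (hA x (Ico_subset_Icc_self hx))) (hg.mono hsub)
    (fun x hx => hg' x (hsub (Ico_subset_Icc_self hx)))
    (fun x hx => by simpa using Or.inr (hB x (Ico_subset_Icc_self hx))) h0 ⟨ht.1, le_rfl⟩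

lemma LipOnBalls.eqOn_Ioo {f g : ℝ → E} {a b t₀ : ℝ} (ht₀ : t₀ ∈ Ioo a b)
    (hf : ∀ t ∈ Ioo a b, HasDerivAt f (v (f t)) t)
    (hg : ∀ t ∈ Ioo a b, HasDerivAt g (v (g t)) t) (h0 : f t₀ = g t₀) : EqOn f g (Ioo a b) := by
  intro t ht
  obtain ⟨a', ha', ha''⟩ := exists_between (lt_min ht₀.1 ht.1)
  obtain ⟨b', hb', hb''⟩ := exists_between (max_lt ht₀.2 ht.2)
  obtain ⟨h1, h2⟩ := lt_min_iff.1 ha''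
  obtain ⟨h3, h4⟩ := max_lt_iff.1 hb'
  have hsub : Icc a' b' ⊆ Ioo a b := fun x hx => ⟨ha'.trans_le hx.1, hx.2.trans_lt hb''⟩
  obtain ⟨A, hA⟩ := isCompact_Icc.exists_bound_of_continuousOn (f := f) (s := Icc a' b')
    fun x hx => (hf x (hsub hx)).continuousAt.continuousWithinAt
  obtain ⟨B, hB⟩ := isCompact_Icc.exists_bound_of_continuousOn (f := g) (s := Icc a' b')
    fun x hx => (hg x (hsub hx)).continuousAt.continuousWithinAt
  obtain ⟨K, hK⟩ := hv (max A B)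
  exact ODE_solution_unique_of_mem_Ioo (v := fun _ => v) (K := K)
    (s := fun _ => Metric.closedBall 0 (max A B)) (fun _ _ => hK) ⟨h1, h3⟩
    (fun x hx => ⟨hf x (hsub (Ioo_subset_Icc_self hx)),
      by simpa using Or.inl (hA x (Ioo_subset_Icc_self hx))⟩)
    (fun x hx => ⟨hg x (hsub (Ioo_subset_Icc_self hx)),
      by simpa using Or.inr (hB x (Ioo_subset_Icc_self hx))⟩) h0 ⟨h2, h4⟩

variable [CompleteSpace E]

/-- Picard–Lindelöf on the unit ball around x. The speed bound L is taken on the ball of radius R +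
1, so the existence time 1/(L+1) depends on R only; that uniformity drives the continuation
argument. -/
lemma LipOnBalls.exists_local (R : ℝ) : ∃ δ > 0, ∀ x : E, ‖x‖ ≤ R →
    ∃ f : ℝ → E, f 0 = x ∧ ∀ t ∈ Ioo (-δ) δ, HasDerivAt f (v (f t)) t := by
  obtain ⟨K, hK⟩ := hv (R + 1)
  set L : NNReal := K * (R + 1).toNNReal + ‖v 0‖₊ with hL
  set δ : ℝ := 1 / (L + 1) with hδ
  have hδ0 : 0 < δ := by positivity
  refine ⟨δ, hδ0, fun x hx => ?_⟩
  have hsub : Metric.closedBall x (1 : NNReal) ⊆ Metric.closedBall 0 (R + 1) := by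
    intro y hy
    rw [mem_closedBall_iff_norm, NNReal.coe_one] at hy
    rw [mem_closedBall_zero_iff]
    have := norm_le_insert' y x
    linarith
  have hR : 0 ≤ R := (norm_nonneg _).trans hx
  have hPL : IsPicardLindelof (fun _ : ℝ => v) (tmin := -δ) (tmax := δ)
      ⟨0, by constructor <;> linarith⟩ x 1 0 L K := by
    refine IsPicardLindelof.of_time_independent (fun y hy => ?_) (hK.mono hsub) ?_
    · have hy' := hsub hy
      have h1 := hK.dist_le_mul y hy' 0 (by simp; linarith)
      have h2 := norm_le_insert' (v y) (v 0)
      rw [dist_eq_norm, dist_zero_right] at h1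
      rw [mem_closedBall_zero_iff] at hy'
      rw [hL]
      push_cast
      rw [Real.coe_toNNReal _ (by linarith)]
      have : (K : ℝ) * ‖y‖ ≤ K * (R + 1) := by gcongr
      linarith
    · simp only [sub_zero, zero_sub, neg_neg, max_self, NNReal.coe_one, NNReal.coe_zero]
      rw [hδ, mul_one_div, div_le_one (by positivity)]
      linarith
  obtain ⟨f, hf0, hf⟩ := hPL.exists_eq_forall_mem_Icc_hasDerivWithinAt₀
  exact ⟨f, hf0, fun t ht => (hf t (Ioo_subset_Icc_self ht)).hasDerivAt (Icc_mem_nhds ht.1 ht.2)⟩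

/-- A solution exists globally or up to a finite time at which it is unbounded. -/
theorem LipOnBalls.exists_maximal (x₀ : E) : ∃ ε > 0,
    (∃ f : ℝ → E, f 0 = x₀ ∧ ∀ t, -ε < t → HasDerivAt f (v (f t)) t) ∨
    ∃ T > 0, ∃ f : ℝ → E, f 0 = x₀ ∧ (∀ t ∈ Ioo (-ε) T, HasDerivAt f (v (f t)) t) ∧
      ¬ BddAbove ((fun t => ‖f t‖) '' Ico 0 T) := by
  obtain ⟨ε, hε, hloc⟩ := hv.exists_local ‖x₀‖
  refine ⟨ε, hε, ?_⟩
  -- The fixed backward margin ε makes the derivatives at time 0 two-sided.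
  set S : Set ℝ := {T | 0 < T ∧ ∃ f : ℝ → E, f 0 = x₀ ∧
    ∀ t ∈ Ioo (-ε) T, HasDerivAt f (v (f t)) t} with hS
  have hεS : ε ∈ S := ⟨hε, hloc x₀ le_rfl⟩
  have hS0 : ∀ T ∈ S, 0 < T := fun T hT => hT.1
  choose! fs hfs0 hfs using fun T (hT : T ∈ S) => hT.2
  have hagree : ∀ T ∈ S, ∀ T' ∈ S, ∀ t, -ε < t → t < T → t < T' → fs T t = fs T' t := by
    intro T hT T' hT' t h1 h2 h3
    refine hv.eqOn_Ioo (a := -ε) (b := min T T') (t₀ := 0)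
      ⟨by linarith, lt_min (hS0 T hT) (hS0 T' hT')⟩
      (fun x hx => hfs T hT x ⟨hx.1, hx.2.trans_le (min_le_left _ _)⟩)
      (fun x hx => hfs T' hT' x ⟨hx.1, hx.2.trans_le (min_le_right _ _)⟩)
      ((hfs0 T hT).trans (hfs0 T' hT').symm) ⟨h1, lt_min h2 h3⟩
  choose! τ hτS hτ using fun t (ht : ∃ T ∈ S, t < T) => ht
  set F : ℝ → E := fun t => fs (τ t) t with hF
  have hF0 : F 0 = x₀ := hfs0 _ (hτS 0 ⟨ε, hεS, hε⟩)
  have hFd : ∀ t, -ε < t → (∃ T ∈ S, t < T) → HasDerivAt F (v (F t)) t := by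
    rintro t ht ⟨T, hT, htT⟩
    have hev : F =ᶠ[nhds t] fs T := by
      filter_upwards [Ioo_mem_nhds ht htT] with x hx
      exact hagree _ (hτS x ⟨T, hT, hx.2⟩) _ hT x hx.1 (hτ x ⟨T, hT, hx.2⟩) hx.2
    rw [hev.eq_of_nhds]
    exact (hfs T hT t ⟨ht, htT⟩).congr_of_eventuallyEq hev
  by_cases hbd : BddAbove S
  · right
    have hlt : ∀ t, t < sSup S → ∃ T ∈ S, t < T := fun t ht => exists_lt_of_lt_csSup ⟨ε, hεS⟩ ht
    have hsup : 0 < sSup S := hε.trans_le (le_csSup hbd hεS)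
    refine ⟨sSup S, hsup, F, hF0, fun t ht => hFd t ht.1 (hlt t ht.2), ?_⟩
    rintro ⟨R, hR⟩
    obtain ⟨δ, hδ, hδ'⟩ := hv.exists_local R
    -- The solution is restarted within δ/2 of the supposed end. Its lifetime δ does not depend on
    -- the restart point, so it reaches at least δ/2 beyond.
    set t₁ := max 0 (sSup S - δ / 2) with ht₁
    have ht₁0 : 0 ≤ t₁ := le_max_left _ _
    have ht₁1 : sSup S - δ / 2 ≤ t₁ := le_max_right _ _
    have ht₁S : t₁ < sSup S := max_lt hsup (by linarith)
    obtain ⟨g, hg0, hg⟩ := hδ' (F t₁) (hR ⟨t₁, ⟨ht₁0, ht₁S⟩, rfl⟩)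
    have hgd : ∀ t ∈ Ioo (t₁ - δ) (t₁ + δ), HasDerivAt (fun t => g (t - t₁)) (v (g (t - t₁))) t :=
      fun t ht => (hg (t - t₁) ⟨by linarith [ht.1], by linarith [ht.2]⟩).comp_sub_const t t₁
    have heq : EqOn F (fun t => g (t - t₁)) (Ioo (max (-ε) (t₁ - δ)) (sSup S)) :=
      hv.eqOn_Ioo ⟨max_lt (by linarith) (by linarith), ht₁S⟩
        (fun t ht => hFd t ((le_max_left _ _).trans_lt ht.1) (hlt t ht.2))
        (fun t ht => hgd t ⟨(le_max_right _ _).trans_lt ht.1, by linarith [ht.2]⟩)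
        (by simp [hg0])
    have hmem : sSup S + δ / 2 ∈ S := by
      refine ⟨by linarith, fun t => if t < sSup S then F t else g (t - t₁), by simp [hsup, hF0], ?_⟩
      intro t ht
      rcases lt_or_ge t (sSup S) with h | h
      · simp only [h, if_true]
        refine (hFd t ht.1 (hlt t h)).congr_of_eventuallyEq ?_
        filter_upwards [Iio_mem_nhds h] with x hx
        simp [show x < sSup S from hx]
      · simp only [not_lt.2 h, if_false]
        refine (hgd t ⟨by linarith, by linarith [ht.2]⟩).congr_of_eventuallyEq ?_
        filter_upwards [Ioi_mem_nhds (show max (-ε) (t₁ - δ) < t from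
          max_lt ht.1 (by linarith))] with x hx
        rcases lt_or_ge x (sSup S) with h' | h'
        · simp only [h', if_true]
          exact heq ⟨hx, h'⟩
        · simp [not_lt.2 h']
    have := le_csSup hbd hmem
    linarith
  · left
    rw [not_bddAbove_iff] at hbd
    exact ⟨F, hF0, fun t ht => hFd t ht (hbd t)⟩

end

end GBq
end

open MeasureTheory Set
open scoped FourierTransform ContDiff

noncomputable section

namespace GBq

/-! ### Two scalar lemmas -/

/-- The well function vanishes quadratically at its maximum. -/
lemma exists_well_le_sq {p : ℝ} (hp : 0 < p) (R : ℝ) : ∃ C ≥ 0, ∀ σ ∈ Icc 0 R,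
    p / (2 * (p + 2)) - σ / 2 + σ ^ ((p + 2) / 2) / (p + 2) ≤ C * (σ - 1) ^ 2 := by
  have hd : ∀ x : ℝ, HasDerivAt (fun x : ℝ => p / (2 * (p + 2)) - x / 2 + x ^ ((p + 2) / 2) / (p + 2))
      ((x ^ (p / 2) - 1) / 2) x := by
    intro x
    have h1 := Real.hasDerivAt_rpow_const (x := x) (p := (p + 2) / 2) (Or.inr (by linarith))
    have h2 := (((hasDerivAt_id x).div_const 2).const_sub (p / (2 * (p + 2)))).add
      (h1.div_const (p + 2))
    refine h2.congr_deriv ?_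
    have e : (p + 2) / 2 - 1 = p / 2 := by ring
    rw [e]
    field_simp
    ring
  -- The derivative of the well function is (x^{p/2} - 1)/2, that is, x - 1 times half a continuous
  -- slope. Boundedness of the slope on compacts avoids a second derivative, which is singular at 0
  -- when p < 2.
  have hc : ContinuousOn (dslope (fun x : ℝ => x ^ (p / 2)) 1) univ := by
    rw [continuousOn_dslope Filter.univ_mem]
    exact ⟨(Real.continuous_rpow_const (by positivity)).continuousOn,
      (Real.hasDerivAt_rpow_const (Or.inl one_ne_zero)).differentiableAt⟩
  obtain ⟨C, hC⟩ := (isCompact_Icc (a := 0) (b := max R 1)).exists_bound_of_continuousOn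
    (hc.mono (subset_univ _))
  have hC0 : 0 ≤ C := (norm_nonneg _).trans (hC 0 ⟨le_rfl, by positivity⟩)
  refine ⟨C, hC0, fun σ hσ => ?_⟩
  have hsub : uIcc 1 σ ⊆ Icc 0 (max R 1) := ordConnected_Icc.uIcc_subset
    ⟨zero_le_one, le_max_right _ _⟩ ⟨hσ.1, hσ.2.trans (le_max_left _ _)⟩
  have h := (convex_uIcc 1 σ).norm_image_sub_le_of_norm_hasDerivWithin_le
    (C := C * |σ - 1|) (fun x _ => (hd x).hasDerivWithinAt) (fun x hx => ?_)
    left_mem_uIcc right_mem_uIcc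
  · rw [Real.norm_eq_abs, Real.norm_eq_abs, mul_assoc, abs_mul_abs_self] at h
    have h1 := (le_abs_self _).trans h
    simp only [Real.one_rpow] at h1
    have e : p / (2 * (p + 2)) - 1 / 2 + 1 / (p + 2) = 0 := by field_simp; ring
    rw [e, sub_zero] at h1
    rwa [sq]
  · have h1 := sub_smul_dslope (fun x : ℝ => x ^ (p / 2)) 1 x
    simp only [Real.one_rpow, smul_eq_mul] at h1
    rw [← h1, norm_div, norm_mul, Real.norm_eq_abs, Real.norm_eq_abs 2, abs_two]
    have h2 := hC x (hsub hx)
    have h3 : |x - 1| ≤ |σ - 1| := abs_sub_left_of_mem_uIcc hx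
    have h4 : |x - 1| * ‖dslope (fun x : ℝ => x ^ (p / 2)) 1 x‖ ≤ |σ - 1| * C := by gcongr
    have h5 : 0 ≤ |σ - 1| * C := by positivity
    linarith

/-- A quantity with `|D'| ≤ C |D|` never changes sign. -/
lemma eq_zero_of_abs_deriv_le {D D' : ℝ → ℝ} {T C t₁ : ℝ}
    (hD : ∀ t ∈ Icc 0 T, HasDerivAt D (D' t) t) (hC : ∀ t ∈ Icc 0 T, |D' t| ≤ C * |D t|)
    (ht₁ : t₁ ∈ Icc 0 T) (h0 : D t₁ = 0) : ∀ t ∈ Icc 0 T, D t = 0 := by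
  intro t ht
  rcases le_total t₁ t with h | h
  · have hs : Icc t₁ t ⊆ Icc 0 T := Icc_subset_Icc ht₁.1 ht.2
    exact eq_zero_of_abs_deriv_le_mul_abs_self_of_eq_zero_right (f' := D') (K := C)
      (fun x hx => (hD x (hs hx)).continuousAt.continuousWithinAt)
      (fun x hx => (hD x (hs (Ico_subset_Icc_self hx))).hasDerivWithinAt) h0
      (fun x hx => hC x (hs (Ico_subset_Icc_self hx))) t ⟨h, le_rfl⟩
  -- Times before `t₁` are handled by reversing time.
  · have hm : ∀ x ∈ Icc (-t₁) (-t), -x ∈ Icc 0 T := fun x hx =>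
      ⟨by linarith [hx.2, ht.1], by linarith [hx.1, ht₁.2]⟩
    have hd : ∀ x ∈ Icc (-t₁) (-t), HasDerivAt (fun x => D (-x)) (-D' (-x)) x := fun x hx => by
      exact ((hD (-x) (hm x hx)).scomp x (hasDerivAt_neg x)).congr_deriv (by simp)
    have := eq_zero_of_abs_deriv_le_mul_abs_self_of_eq_zero_right (f := fun x => D (-x))
      (f' := fun x => -D' (-x)) (K := C) (a := -t₁) (b := -t)
      (fun x hx => (hd x hx).continuousAt.continuousWithinAt)
      (fun x hx => (hd x (Ico_subset_Icc_self hx)).hasDerivWithinAt) (by simpa using h0)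
      (fun x hx => by simpa using hC _ (hm x (Ico_subset_Icc_self hx))) (-t) ⟨by linarith, le_rfl⟩
    simpa using this

/-- Levine's concavity argument. -/
lemma concavity_blowup {Φ Φ₁ Φ₂ : ℝ → ℝ} {t₁ α : ℝ} (hα : 0 < α)
    (h0 : ∀ t ≥ t₁, 0 ≤ Φ t) (hd : ∀ t ≥ t₁, HasDerivAt Φ (Φ₁ t) t)
    (hd₁ : ∀ t ≥ t₁, HasDerivAt Φ₁ (Φ₂ t) t) (hpos : ∀ t ≥ t₁, 0 < Φ₁ t)
    (h : ∀ t ≥ t₁, (1 + α) * Φ₁ t ^ 2 ≤ Φ t * Φ₂ t) : False := by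
  have hmono : StrictMonoOn Φ (Ici t₁) := by
    refine strictMonoOn_of_deriv_pos (convex_Ici _)
      (fun t ht => (hd t ht).continuousAt.continuousWithinAt) fun t ht => ?_
    rw [interior_Ici] at ht
    rw [(hd t (le_of_lt ht)).deriv]
    exact hpos t (le_of_lt ht)
  -- Nonnegativity and strict growth make Φ positive from here on, so negative powers may be taken.
  set t₂ := t₁ + 1 with ht₂
  have hge : ∀ t ≥ t₂, t ≥ t₁ := fun t ht => by linarith
  have hΦ : ∀ t ≥ t₂, 0 < Φ t := fun t ht =>
    (h0 t₁ le_rfl).trans_lt (hmono self_mem_Ici (hge t ht) (by linarith))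
  -- Up to the factor -α this is the derivative of Φ^{-α}; the hypothesis says exactly that it is
  -- nondecreasing, that is, that Φ^{-α} is concave.
  set q : ℝ → ℝ := fun t => Φ₁ t * Φ t ^ (-(1 + α)) with hq
  have hqd : ∀ t ≥ t₂, HasDerivAt q (Φ t ^ (-(2 + α)) * (Φ t * Φ₂ t - (1 + α) * Φ₁ t ^ 2)) t := by
    intro t ht
    have h1 := (hd₁ t (hge t ht)).mul
      ((hd t (hge t ht)).rpow_const (p := -(1 + α)) (Or.inl (hΦ t ht).ne'))
    refine h1.congr_deriv ?_
    have e1 : Φ t ^ (-(1 + α)) = Φ t ^ (-(2 + α)) * Φ t := by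
      rw [← Real.rpow_add_one (hΦ t ht).ne']; ring_nf
    have e2 : -(1 + α) - 1 = -(2 + α) := by ring
    rw [e2, e1]
    ring
  have hqm : MonotoneOn q (Ici t₂) := by
    refine monotoneOn_of_deriv_nonneg (convex_Ici _)
      (fun t ht => (hqd t ht).continuousAt.continuousWithinAt)
      (fun t ht => (hqd t (interior_subset ht)).differentiableAt.differentiableWithinAt)
      fun t ht => ?_
    have ht := interior_subset ht
    rw [(hqd t ht).deriv]
    have := h t (hge t ht)
    have := Real.rpow_nonneg (hΦ t ht).le (-(2 + α))
    exact mul_nonneg this (by linarith)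
  set c := q t₂ with hc
  have hc0 : 0 < c := mul_pos (hpos t₂ (hge _ le_rfl)) (Real.rpow_pos_of_pos (hΦ _ le_rfl) _)
  set r : ℝ → ℝ := fun t => Φ t ^ (-α) + α * c * t with hr
  have hrd : ∀ t ≥ t₂, HasDerivAt r (-α * q t + α * c) t := by
    intro t ht
    have h1 := ((hd t (hge t ht)).rpow_const (p := -α) (Or.inl (hΦ t ht).ne')).add
      ((hasDerivAt_id t).const_mul (α * c))
    refine h1.congr_deriv ?_
    have e2 : -(1 + α) = -α - 1 := by ring
    rw [hq]
    simp only [e2]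
    ring
  -- So Φ^{-α} lies below a line of slope -αc < 0, which contradicts its positivity at large times.
  have hra : AntitoneOn r (Ici t₂) := by
    refine antitoneOn_of_deriv_nonpos (convex_Ici _)
      (fun t ht => (hrd t ht).continuousAt.continuousWithinAt)
      (fun t ht => (hrd t (interior_subset ht)).differentiableAt.differentiableWithinAt)
      fun t ht => ?_
    have ht := interior_subset ht
    rw [(hrd t ht).deriv]
    have : c ≤ q t := hqm self_mem_Ici ht ht
    nlinarith
  set t := max t₂ (r t₂ / (α * c)) with ht
  have h1 := hra (a := t₂) (b := t) self_mem_Ici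
    (mem_Ici.2 (le_max_left _ _)) (le_max_left _ _)
  have h2 : r t₂ ≤ α * c * t := by
    rw [← div_le_iff₀' (by positivity)]
    exact le_max_right _ _
  have h3 := Real.rpow_pos_of_pos (hΦ t (le_max_left _ _)) (-α)
  simp only [hr] at h1 h2
  linarith

/-- The estimate of the second derivative in the convexity argument. -/
lemma virial_estimate {p e y μ δ C r z w₁ w₂ : ℝ} (hp : 0 ≤ p) (hμp : μ ≤ p)
    (hμ : μ * (y ^ 2 + 1) ≤ p * y ^ 2 - 2 * (p + 2) * e) (hx : y ^ 2 ≤ r ^ 2)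
    (hC : 0 ≤ C) (hδ : 0 ≤ δ) (hδ₁ : δ * (1 + (p + 2) + 2 * (p + 2) * (C + |e|)) ≤ μ / 2)
    (hδ₂ : δ * (p + 2) ≤ p / 2) (h₁ : |w₁| ≤ δ * r)
    (h₂ : |w₂| ≤ δ * ((p + 2) * (1 / 2 * z ^ 2 + 1 / 2 * r ^ 2 - e + C))) :
    (4 + p / 2) * z ^ 2 + μ / 2 ≤
      (p + 4) * z ^ 2 + p * r ^ 2 - 2 * (p + 2) * e + 2 * w₁ + 2 * w₂ := by
  -- Here r and z stand for ‖U‖ and ‖Z‖, y for the radius of the well, and w₁, w₂ for ⟨W, U⟩ and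
  -- ⟨JW, g(U)⟩. Both errors carry the factor δ and are to be absorbed by (μ/2)(r² + 1) and (p/2)z².
  have c1 := (abs_le.1 h₁).1
  have c2 := (abs_le.1 h₂).1
  generalize hK : 2 * (p + 2) * (C + |e|) = K at hδ₁
  have hK0 : 0 ≤ K := by rw [← hK]; positivity
  have c3 : 2 * r ≤ r ^ 2 + 1 := by linarith [sq_nonneg (r - 1)]
  have c4 : 0 ≤ (p - μ) * (r ^ 2 - y ^ 2) := mul_nonneg (by linarith) (by linarith)
  have c5 : 2 * (p + 2) * (C - e) ≤ K := by
    rw [← hK]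
    gcongr
    linarith [neg_le_abs e]
  have c6 : δ * (2 * r + (p + 2) * r ^ 2 + 2 * (p + 2) * (C - e)) ≤
      δ * (1 + (p + 2) + K) * (r ^ 2 + 1) := by
    rw [mul_assoc δ (1 + (p + 2) + K)]
    refine mul_le_mul_of_nonneg_left ?_ hδ
    have : 0 ≤ K * r ^ 2 := by positivity
    linarith
  have c7 : δ * (1 + (p + 2) + K) * (r ^ 2 + 1) ≤ μ / 2 * (r ^ 2 + 1) := by gcongr
  have c8 : δ * (p + 2) * z ^ 2 ≤ p / 2 * z ^ 2 := by gcongr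
  have c9 : 0 ≤ μ / 2 * r ^ 2 := by
    have : 0 ≤ δ * (1 + (p + 2) + K) := by positivity
    exact mul_nonneg (by linarith) (sq_nonneg _)
  linarith

/-! ### The potential well for an abstract Hamiltonian wave equation -/

section
variable {H : Type*} [NormedAddCommGroup H] [InnerProductSpace ℝ H]

/-- The structure used for the potential well method: `g` is the gradient of `G` composed with the
smoothing `J`, homogeneous of degree `p + 1`, and `G` obeys the sharp inequality with constant
determined by the radius `y₀` of the well. -/
structure IsWell (N J : H →L[ℝ] H) (g : H → H) (G : H → ℝ) (p y₀ : ℝ) : Prop where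
  p_pos : 0 < p
  y_pos : 0 < y₀
  symm_N : ∀ U V, (inner ℝ (N U) V : ℝ) = inner ℝ U (N V)
  symm_J : ∀ U V, (inner ℝ (J U) V : ℝ) = inner ℝ U (J V)
  lip : LipOnBalls g
  hasFDerivAt : ∀ U, HasFDerivAt G ((innerSL ℝ (g U)).comp J) U
  inner_self : ∀ U, (inner ℝ (g U) (J U) : ℝ) = (p + 2) * G U
  abs_inner_le : ∀ W U, |(inner ℝ (J W) (g U) : ℝ)| ≤ (p + 2) * (-G U - G W)
  le : ∀ U, -((p + 2) * G U) ≤ ‖U‖ ^ 2 * (‖U‖ / y₀) ^ p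

/-- The field of the Hamiltonian system `U' = NZ`, `Z' = -N(U + J g(U))`. -/
def wellField (N J : H →L[ℝ] H) (g : H → H) (X : H × H) : H × H :=
  (N X.2, -N (X.1 + J (g X.1)))

lemma lipOnBalls_wellField (N J : H →L[ℝ] H) {g : H → H} (hg : LipOnBalls g) :
    LipOnBalls (wellField N J g) := by
  intro R
  obtain ⟨K, hK⟩ := hg R
  have h1 : LipschitzOnWith (‖N‖₊ * 1) (fun X : H × H => N X.2) (Metric.closedBall 0 R) :=
    (N.lipschitz.comp LipschitzWith.prod_snd).lipschitzOnWith
  have hf : LipschitzOnWith (K * 1) (fun X : H × H => g X.1) (Metric.closedBall 0 R) := by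
    refine hK.comp LipschitzWith.prod_fst.lipschitzOnWith fun X hX => ?_
    rw [mem_closedBall_zero_iff] at hX ⊢
    exact (norm_fst_le X).trans hX
  have h2 : LipschitzOnWith (1 + ‖J‖₊ * (K * 1)) (fun X : H × H => X.1 + J (g X.1))
      (Metric.closedBall 0 R) :=
    LipschitzWith.prod_fst.lipschitzOnWith.add (J.lipschitz.comp_lipschitzOnWith hf)
  exact ⟨_, h1.prodMk (N.lipschitz.comp_lipschitzOnWith h2).neg⟩

/-- The energy. -/
def wellEnergy (G : H → ℝ) (U Z : H) : ℝ := 1 / 2 * ‖Z‖ ^ 2 + 1 / 2 * ‖U‖ ^ 2 + G U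

namespace IsWell
variable {N J : H →L[ℝ] H} {g : H → H} {G : H → ℝ} {p y₀ : ℝ} (h : IsWell N J g G p y₀)
include h

section
variable {U Z : ℝ → H} {t : ℝ} (hU : HasDerivAt U (N (Z t)) t)
  (hZ : HasDerivAt Z (-N (U t + J (g (U t)))) t)
include hU hZ

/-- The gradient of the energy is (U + J g(U), Z), and symmetry of N makes the Hamiltonian field
orthogonal to it. -/
lemma hasDerivAt_energy : HasDerivAt (fun t => wellEnergy G (U t) (Z t)) 0 t := by
  have h1 := ((hZ.norm_sq.const_mul (1 / 2)).add (hU.norm_sq.const_mul (1 / 2))).add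
    ((h.hasFDerivAt (U t)).comp_hasDerivAt t hU)
  refine h1.congr_deriv ?_
  simp only [ContinuousLinearMap.comp_apply, innerSL_apply_apply]
  rw [inner_neg_right, ← h.symm_N, inner_add_right, real_inner_comm (N (Z t)) (U t),
    ← h.symm_J, real_inner_comm (J (N (Z t)))]
  ring

end

/-- The sharp inequality inserted into the energy. With σ = (‖U‖/y₀)² the bracket is the depth of
the well minus the lower bound for the rescaled potential energy; it vanishes at σ = 1. -/
lemma kinetic_le {U Z : H} (hE : wellEnergy G U Z ≤ p / (2 * (p + 2)) * y₀ ^ 2) :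
    1 / 2 * ‖Z‖ ^ 2 ≤ y₀ ^ 2 * (p / (2 * (p + 2)) - (‖U‖ / y₀) ^ 2 / 2 +
      ((‖U‖ / y₀) ^ 2) ^ ((p + 2) / 2) / (p + 2)) := by
  have hp := h.p_pos
  have hy := h.y_pos
  have h1 := h.le U
  have e : ((‖U‖ / y₀) ^ 2) ^ ((p + 2) / 2) = (‖U‖ / y₀) ^ 2 * (‖U‖ / y₀) ^ p := by
    have hn : 0 ≤ ‖U‖ / y₀ := by positivity
    rw [← Real.rpow_natCast, ← Real.rpow_mul hn, ← Real.rpow_add_of_nonneg hn (by simp) hp.le]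
    congr 1
    push_cast
    ring
  have e2 : y₀ ^ 2 * (p / (2 * (p + 2)) - (‖U‖ / y₀) ^ 2 / 2 +
      ((‖U‖ / y₀) ^ 2) ^ ((p + 2) / 2) / (p + 2)) =
      p / (2 * (p + 2)) * y₀ ^ 2 - ‖U‖ ^ 2 / 2 + (‖U‖ ^ 2 * (‖U‖ / y₀) ^ p) / (p + 2) := by
    rw [e]
    field_simp
  have h2 : -G U ≤ (‖U‖ ^ 2 * (‖U‖ / y₀) ^ p) / (p + 2) := by
    rw [le_div_iff₀ (by positivity)]
    linarith
  rw [e2]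
  unfold wellEnergy at hE
  linarith

/-- The bracket in `kinetic_le` vanishes quadratically at the rim of the well, so ‖Z‖ itself
vanishes at least linearly there. This linear bound is what handles the critical energy. -/
lemma exists_norm_le (R : ℝ) : ∃ C ≥ 0, ∀ U Z : H, ‖U‖ ≤ R →
    wellEnergy G U Z ≤ p / (2 * (p + 2)) * y₀ ^ 2 → ‖Z‖ ≤ C * |‖U‖ ^ 2 - y₀ ^ 2| := by
  have hy := h.y_pos
  obtain ⟨C, hC0, hC⟩ := exists_well_le_sq h.p_pos ((R / y₀) ^ 2)
  refine ⟨Real.sqrt (2 * C) / y₀, by positivity, fun U Z hU hE => ?_⟩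
  have h1 := h.kinetic_le hE
  have h2 := hC ((‖U‖ / y₀) ^ 2) ⟨by positivity, by gcongr⟩
  have h3 : ‖Z‖ ^ 2 ≤ (Real.sqrt (2 * C) / y₀ * |‖U‖ ^ 2 - y₀ ^ 2|) ^ 2 := by
    have e : (Real.sqrt (2 * C) / y₀ * |‖U‖ ^ 2 - y₀ ^ 2|) ^ 2 =
        2 * (y₀ ^ 2 * (C * ((‖U‖ / y₀) ^ 2 - 1) ^ 2)) := by
      rw [mul_pow, div_pow, Real.sq_sqrt (by positivity), sq_abs]
      field_simp
    rw [e]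
    have := mul_le_mul_of_nonneg_left h2 (sq_nonneg y₀)
    linarith
  exact abs_le_of_sq_le_sq' h3 (by positivity) |>.2

section
variable {U Z : ℝ → H} {T : ℝ} (hU : ∀ t ∈ Ico 0 T, HasDerivAt U (N (Z t)) t)
  (hZ : ∀ t ∈ Ico 0 T, HasDerivAt Z (-N (U t + J (g (U t)))) t)
include hU hZ

lemma energy_eq {t : ℝ} (ht : t ∈ Ico 0 T) :
    wellEnergy G (U t) (Z t) = wellEnergy G (U 0) (Z 0) := by
  refine constant_of_has_deriv_right_zero (f := fun t => wellEnergy G (U t) (Z t)) (a := 0) (b := t)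
    (fun x hx => ?_) (fun x hx => ?_) t ⟨ht.1, le_rfl⟩
  · have hx' : x ∈ Ico 0 T := ⟨hx.1, hx.2.trans_lt ht.2⟩
    exact (h.hasDerivAt_energy (hU x hx') (hZ x hx')).continuousAt.continuousWithinAt
  · have hx' : x ∈ Ico 0 T := ⟨hx.1, hx.2.trans ht.2⟩
    exact (h.hasDerivAt_energy (hU x hx') (hZ x hx')).hasDerivWithinAt

variable (hE : wellEnergy G (U 0) (Z 0) ≤ p / (2 * (p + 2)) * y₀ ^ 2)
include hE

/-- The derivative of ‖U‖² - y₀² is 2⟨U, NZ⟩, and ‖Z‖ is bounded by a multiple of |‖U‖² - y₀²|. By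
Gronwall, a trajectory that touches the rim lies on it throughout; combined with the intermediate
value theorem, no trajectory crosses it. -/
lemma eq_radius {t t₁ : ℝ} (ht : t ∈ Ico 0 T) (ht₁ : t₁ ∈ Icc 0 t) (h1 : ‖U t₁‖ ^ 2 = y₀ ^ 2) :
    ∀ x ∈ Icc 0 t, ‖U x‖ ^ 2 = y₀ ^ 2 := by
  have hsub : Icc 0 t ⊆ Ico 0 T := fun x hx => ⟨hx.1, hx.2.trans_lt ht.2⟩
  obtain ⟨R, hR⟩ := isCompact_Icc.exists_bound_of_continuousOn (f := U) (s := Icc 0 t)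
    fun x hx => (hU x (hsub hx)).continuousAt.continuousWithinAt
  have hR0 : 0 ≤ R := (norm_nonneg _).trans (hR 0 ⟨le_rfl, ht.1⟩)
  obtain ⟨C, hC0, hC⟩ := h.exists_norm_le R
  have key := eq_zero_of_abs_deriv_le (D := fun t => ‖U t‖ ^ 2 - y₀ ^ 2)
    (D' := fun t => 2 * inner ℝ (U t) (N (Z t))) (T := t) (C := 2 * R * ‖N‖ * C) (t₁ := t₁)
    (fun x hx => ((hU x (hsub hx)).norm_sq).sub_const _) (fun x hx => ?_) ht₁ (by simp [h1])
  · intro x hx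
    have := key x hx
    linarith
  · have h2 := hC (U x) (Z x) (hR x hx) ((h.energy_eq hU hZ (hsub hx)).trans_le hE)
    have h3 := abs_real_inner_le_norm (U x) (N (Z x))
    have h4 := N.le_opNorm (Z x)
    rw [abs_mul, abs_two]
    have h5 : ‖U x‖ * ‖N (Z x)‖ ≤ R * (‖N‖ * (C * |‖U x‖ ^ 2 - y₀ ^ 2|)) := by
      have := hR x hx
      calc _ ≤ R * (‖N‖ * ‖Z x‖) := by gcongr
        _ ≤ _ := by gcongr
    nlinarith

omit h hZ hE in
lemma continuousOn_normSq {t : ℝ} (ht : t ∈ Ico 0 T) :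
    ContinuousOn (fun x => ‖U x‖ ^ 2) (Icc 0 t) := fun x hx =>
  ((hU x ⟨hx.1, hx.2.trans_lt ht.2⟩).continuousAt.norm.pow 2).continuousWithinAt

lemma le_radius (h0 : ‖U 0‖ ^ 2 ≤ y₀ ^ 2) {t : ℝ} (ht : t ∈ Ico 0 T) : ‖U t‖ ^ 2 ≤ y₀ ^ 2 := by
  by_contra! hlt
  obtain ⟨t₁, ht₁, h1⟩ := intermediate_value_Icc ht.1 (continuousOn_normSq hU ht)
    ⟨h0, hlt.le⟩
  have := h.eq_radius hU hZ hE ht ht₁ h1 t ⟨ht.1, le_rfl⟩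
  linarith

lemma radius_lt (h0 : y₀ ^ 2 < ‖U 0‖ ^ 2) {t : ℝ} (ht : t ∈ Ico 0 T) : y₀ ^ 2 < ‖U t‖ ^ 2 := by
  by_contra! hle
  obtain ⟨t₁, ht₁, h1⟩ := intermediate_value_Icc' ht.1 (continuousOn_normSq hU ht)
    ⟨hle, h0.le⟩
  have := h.eq_radius hU hZ hE ht ht₁ h1 0 ⟨le_rfl, ht.1⟩
  linarith

/-- A bound for `U` gives one for the whole state. -/
lemma exists_bound {R : ℝ} (hR : ∀ t ∈ Ico 0 T, ‖U t‖ ≤ R) :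
    ∃ C, ∀ t ∈ Ico 0 T, ‖Z t‖ ≤ C := by
  obtain ⟨C, hC0, hC⟩ := h.exists_norm_le R
  refine ⟨C * (R ^ 2 + y₀ ^ 2), fun t ht => ?_⟩
  refine (hC (U t) (Z t) (hR t ht) ((h.energy_eq hU hZ ht).trans_le hE)).trans ?_
  gcongr
  have := hR t ht
  have h1 : ‖U t‖ ^ 2 ≤ R ^ 2 := by gcongr
  rw [abs_le]
  constructor <;> nlinarith [sq_nonneg y₀, sq_nonneg ‖U t‖, sq_nonneg R]

end

/-! ### Nonexistence of global solutions above the well -/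

section Global
variable [CompleteSpace H]
variable {U Z : ℝ → H} (hU : ∀ t ≥ 0, HasDerivAt U (N (Z t)) t)
  (hZ : ∀ t ≥ 0, HasDerivAt Z (-N (U t + J (g (U t)))) t)
include hU hZ

-- The functional of the concavity argument is ‖Y‖² with Y' = Z. The identity NY = U - W persists
-- because U' = NZ; the constant W corrects for U(0) possibly lying outside the range of N.
omit h in
lemma exists_primitive {W Y₀ : H} (hY₀ : N Y₀ = U 0 - W) : ∃ Y : ℝ → H, Y 0 = Y₀ ∧
    (∀ t ≥ 0, HasDerivAt Y (Z (max t 0)) t) ∧ ∀ t ≥ 0, N (Y t) = U t - W := by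
  -- Freezing Z at negative times gives a continuous integrand on the whole line.
  have hc : Continuous fun t : ℝ => Z (max t 0) := by
    have : ContinuousOn Z (Ici 0) := fun t ht => (hZ t ht).continuousAt.continuousWithinAt
    exact this.comp_continuous (by fun_prop) fun t => mem_Ici.2 (le_max_right _ _)
  have hd : ∀ t, HasDerivAt (fun t => Y₀ + ∫ τ in (0 : ℝ)..t, Z (max τ 0)) (Z (max t 0)) t :=
    fun t => (intervalIntegral.integral_hasDerivAt_right (hc.intervalIntegrable _ _)
      (hc.stronglyMeasurableAtFilter _ _) hc.continuousAt).const_add _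
  refine ⟨_, by simp, fun t _ => hd t, fun t ht => ?_⟩
  have hcN : Continuous fun t : ℝ => N (Z (max t 0)) := N.continuous.comp hc
  have h1 : ∫ τ in (0 : ℝ)..t, N (Z (max τ 0)) = U t - U 0 := by
    refine intervalIntegral.integral_eq_sub_of_hasDerivAt (fun x hx => ?_)
      (hcN.intervalIntegrable _ _)
    rw [uIcc_of_le ht] at hx
    rw [max_eq_left hx.1]
    exact hU x hx.1
  rw [map_add, ← N.intervalIntegral_comp_comm (hc.intervalIntegrable _ _), h1, hY₀]
  abel

/-- The virial identity, and the contradiction it leads to. -/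
lemma false_of_convexity {W Y₀ : H} (hY₀ : N Y₀ = U 0 - W) {β : ℝ} (hβ : 0 < β)
    (hconv : ∀ t ≥ 0, (4 + β) * ‖Z t‖ ^ 2 ≤ 2 * ‖Z t‖ ^ 2
      - 2 * inner ℝ (U t - W) (U t + J (g (U t))))
    (hpos : (∀ t ≥ 0, 0 < 2 * ‖Z t‖ ^ 2 - 2 * inner ℝ (U t - W) (U t + J (g (U t)))) ∧
        (0 : ℝ) ≤ inner ℝ Y₀ (Z 0) ∨
      ∃ c > 0, ∀ t ≥ 0, c ≤ 2 * ‖Z t‖ ^ 2 - 2 * inner ℝ (U t - W) (U t + J (g (U t)))) : False := by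
  obtain ⟨Y, hY0, hYd, hNY⟩ := exists_primitive hU hZ hY₀
  have hYd : ∀ t ≥ 0, HasDerivAt Y (Z t) t := fun t ht => by
    simpa [max_eq_left (show (0 : ℝ) ≤ t from ht)] using hYd t ht
  -- The second derivative of ‖Y‖²: moving N from Z' onto Y turns ⟨Y, N(U + J g(U))⟩ into ⟨U - W, U
  -- + J g(U)⟩.
  set Φ₂ : ℝ → ℝ := fun t => 2 * ‖Z t‖ ^ 2 - 2 * inner ℝ (U t - W) (U t + J (g (U t))) with hΦ₂
  have hd : ∀ t ≥ 0, HasDerivAt (fun t => ‖Y t‖ ^ 2) (2 * inner ℝ (Y t) (Z t)) t :=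
    fun t ht => (hYd t ht).norm_sq
  have hd₁ : ∀ t ≥ 0, HasDerivAt (fun t => (2 : ℝ) * inner ℝ (Y t) (Z t)) (Φ₂ t) t := by
    intro t ht
    refine (((hYd t ht).inner ℝ (hZ t ht)).const_mul 2).congr_deriv ?_
    rw [inner_neg_right, ← h.symm_N, hNY t ht, real_inner_self_eq_norm_sq]
    ring
  have hmono : ∀ t ≥ 0, ∀ c : ℝ, (∀ x ∈ Icc 0 t, c ≤ Φ₂ x) →
      c * t + 2 * inner ℝ Y₀ (Z 0) ≤ 2 * inner ℝ (Y t) (Z t) := by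
    intro t ht c hc
    have hm : MonotoneOn (fun x => 2 * inner ℝ (Y x) (Z x) - c * x) (Icc 0 t) := by
      have hd₂ : ∀ x ∈ Icc 0 t, HasDerivAt (fun x => 2 * inner ℝ (Y x) (Z x) - c * x)
          (Φ₂ x - c) x := fun x hx => by
        exact ((hd₁ x hx.1).sub ((hasDerivAt_id x).const_mul c)).congr_deriv (by simp)
      refine monotoneOn_of_deriv_nonneg (convex_Icc _ _)
        (fun x hx => (hd₂ x hx).continuousAt.continuousWithinAt)
        (fun x hx => (hd₂ x (interior_subset hx)).differentiableAt.differentiableWithinAt)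
        fun x hx => ?_
      have hx := interior_subset hx
      rw [(hd₂ x hx).deriv]
      linarith [hc x hx]
    have := hm ⟨le_rfl, ht⟩ ⟨ht, le_rfl⟩ ht
    simp only [hY0] at this
    linarith
  -- Either the first derivative starts nonnegative and increases strictly, or a uniform lower bound
  -- c on `Φ₂` makes it positive eventually.
  have hev : ∃ t₁ ≥ 0, ∀ t ≥ t₁, (0 : ℝ) < 2 * inner ℝ (Y t) (Z t) := by
    rcases hpos with ⟨hp, h0⟩ | ⟨c, hc, hc'⟩
    · have hsm : StrictMonoOn (fun t => (2 : ℝ) * inner ℝ (Y t) (Z t)) (Ici 0) := by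
        refine strictMonoOn_of_deriv_pos (convex_Ici _)
          (fun t ht => (hd₁ t ht).continuousAt.continuousWithinAt) fun t ht => ?_
        rw [interior_Ici] at ht
        rw [(hd₁ t (le_of_lt ht)).deriv]
        exact hp t (le_of_lt ht)
      refine ⟨1, zero_le_one, fun t ht => ?_⟩
      have := hsm (a := 0) (b := t) self_mem_Ici (mem_Ici.2 (by linarith)) (by linarith)
      simp only [hY0] at this
      linarith
    · refine ⟨max 0 ((1 - 2 * inner ℝ Y₀ (Z 0)) / c), le_max_left _ _, fun t ht => ?_⟩
      have ht0 : 0 ≤ t := (le_max_left _ _).trans ht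
      have h1 := hmono t ht0 c fun x hx => hc' x hx.1
      have h2 := (le_max_right _ _).trans ht
      rw [div_le_iff₀' hc] at h2
      linarith
  obtain ⟨t₁, ht₁, hpos'⟩ := hev
  -- The choice α = β/4 gives (1 + α)(2⟨Y,Z⟩)² = (4 + β)⟨Y,Z⟩², which Cauchy–Schwarz bounds by
  -- ‖Y‖²(4 + β)‖Z‖².
  refine concavity_blowup (α := β / 4) (t₁ := t₁) (by positivity) (fun t _ => by positivity)
    (fun t ht => hd t (ht₁.trans ht)) (fun t ht => hd₁ t (ht₁.trans ht)) hpos' fun t ht => ?_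
  have h1 := hconv t (ht₁.trans ht)
  have h2 := abs_real_inner_le_norm (Y t) (Z t)
  have h3 : (inner ℝ (Y t) (Z t) : ℝ) ^ 2 ≤ ‖Y t‖ ^ 2 * ‖Z t‖ ^ 2 := by
    rw [← sq_abs, ← mul_pow]
    gcongr
  have h4 : ‖Y t‖ ^ 2 * ((4 + β) * ‖Z t‖ ^ 2) ≤ ‖Y t‖ ^ 2 * Φ₂ t := by gcongr
  nlinarith

/-- Above the well there is no global solution. -/
theorem not_global (hE : wellEnergy G (U 0) (Z 0) ≤ p / (2 * (p + 2)) * y₀ ^ 2)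
    (h0 : y₀ ^ 2 < ‖U 0‖ ^ 2)
    (hsub : wellEnergy G (U 0) (Z 0) < p / (2 * (p + 2)) * y₀ ^ 2 →
      ∀ δ > 0, ∃ W Y₀, ‖W‖ ≤ δ ∧ N Y₀ = U 0 - W)
    (hcrit : wellEnergy G (U 0) (Z 0) = p / (2 * (p + 2)) * y₀ ^ 2 →
      ∃ Y₀, N Y₀ = U 0 ∧ (0 : ℝ) ≤ inner ℝ Y₀ (Z 0)) : False := by
  have hp := h.p_pos
  have hy := h.y_pos
  set e := wellEnergy G (U 0) (Z 0) with he
  have hlt : ∀ t ≥ 0, y₀ ^ 2 < ‖U t‖ ^ 2 := fun t ht =>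
    h.radius_lt (T := t + 1) (fun x hx => hU x hx.1) (fun x hx => hZ x hx.1) hE h0 ⟨ht, by linarith⟩
  have hen : ∀ t ≥ 0, wellEnergy G (U t) (Z t) = e := fun t ht =>
    h.energy_eq (T := t + 1) (fun x hx => hU x hx.1) (fun x hx => hZ x hx.1) ⟨ht, by linarith⟩
  -- Homogeneity gives ⟨g(U), JU⟩ = (p+2)G(U), and conservation of energy then eliminates G(U).
  have hvir : ∀ t ≥ 0, ∀ W : H, 2 * ‖Z t‖ ^ 2 - 2 * inner ℝ (U t - W) (U t + J (g (U t))) =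
      (p + 4) * ‖Z t‖ ^ 2 + p * ‖U t‖ ^ 2 - 2 * (p + 2) * e +
        2 * inner ℝ W (U t) + 2 * inner ℝ (J W) (g (U t)) := by
    intro t ht W
    have e1 := hen t ht
    unfold wellEnergy at e1
    rw [inner_sub_left, inner_add_right, inner_add_right, real_inner_self_eq_norm_sq, ← h.symm_J,
      ← h.symm_J, real_inner_comm (g (U t)) (J (U t)), h.inner_self, ← e1]
    ring
  rcases hE.lt_or_eq with hlt' | heq
  -- Subcritical energy: γ > 0 is the gap, and half of μ is left as a uniform lower bound after the
  -- errors due to W are absorbed.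
  · set γ := p * y₀ ^ 2 - 2 * (p + 2) * e with hγ
    have hγ0 : 0 < γ := by
      have : 2 * (p + 2) * e < 2 * (p + 2) * (p / (2 * (p + 2)) * y₀ ^ 2) := by gcongr
      have e2 : 2 * (p + 2) * (p / (2 * (p + 2)) * y₀ ^ 2) = p * y₀ ^ 2 := by field_simp
      linarith
    set μ := min p (γ / (y₀ ^ 2 + 1)) with hμ
    have hμ0 : 0 < μ := lt_min hp (by positivity)
    have hμp : μ ≤ p := min_le_left _ _
    have hμγ : μ * (y₀ ^ 2 + 1) ≤ γ := by
      rw [← le_div_iff₀ (by positivity)]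
      exact min_le_right _ _
    -- A bound for -G on the unit ball, from the sharp inequality.
    set C₀ := (1 / y₀) ^ p / (p + 2) with hC₀
    have hG : ∀ W : H, ‖W‖ ≤ 1 → -G W ≤ C₀ := by
      intro W hW
      have h1 := h.le W
      have h2 : ‖W‖ ^ 2 * (‖W‖ / y₀) ^ p ≤ 1 ^ 2 * (1 / y₀) ^ p := by gcongr
      rw [hC₀, le_div_iff₀ (by positivity)]
      linarith
    have hC₀0 : 0 ≤ C₀ := by positivity
    set C₁ := 1 + (p + 2) + 2 * (p + 2) * (C₀ + |e|) with hC₁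
    have hC₁0 : 0 < C₁ := by positivity
    set δ := min (μ / 2 / C₁) (p / 2 / (p + 2)) with hδ
    have hδ0 : 0 < δ := lt_min (by positivity) (by positivity)
    have hδ1 : δ * C₁ ≤ μ / 2 := by
      rw [← le_div_iff₀ hC₁0]; exact min_le_left _ _
    have hδ2 : δ * (p + 2) ≤ p / 2 := by
      rw [← le_div_iff₀ (by positivity)]; exact min_le_right _ _
    obtain ⟨W, Y₀, hW, hY₀⟩ := hsub hlt' δ hδ0
    have key : ∀ t ≥ 0, (4 + p / 2) * ‖Z t‖ ^ 2 + μ / 2 ≤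
        2 * ‖Z t‖ ^ 2 - 2 * inner ℝ (U t - W) (U t + J (g (U t))) := by
      intro t ht
      rw [hvir t ht]
      have b1 : |(inner ℝ W (U t) : ℝ)| ≤ δ * ‖U t‖ :=
        (abs_real_inner_le_norm _ _).trans (by gcongr)
      have b2 : |(inner ℝ (J W) (g (U t)) : ℝ)| ≤ δ * ((p + 2) * (-G (U t) + C₀)) := by
        -- The estimate of ⟨JW, g(U)⟩ is not small for small W as it stands; applying it to the
        -- normalized vector extracts the factor δ.
        have e1 : W = δ • (δ⁻¹ • W) := by rw [smul_inv_smul₀ hδ0.ne']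
        have hn : ‖δ⁻¹ • W‖ ≤ 1 := by
          rw [norm_smul, Real.norm_of_nonneg (by positivity), inv_mul_le_iff₀ hδ0]
          linarith
        have b3 := h.abs_inner_le (δ⁻¹ • W) (U t)
        rw [e1, map_smul, real_inner_smul_left, abs_mul, abs_of_pos hδ0]
        gcongr
        refine b3.trans ?_
        have := hG _ hn
        gcongr
        linarith
      have e1 := hen t ht
      unfold wellEnergy at e1
      have e2 : -G (U t) = 1 / 2 * ‖Z t‖ ^ 2 + 1 / 2 * ‖U t‖ ^ 2 - e := by linarith
      rw [e2] at b2
      have hx := hlt t ht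
      exact virial_estimate hp.le hμp hμγ hx.le hC₀0 hδ0.le hδ1 hδ2 b1 b2
    refine h.false_of_convexity hU hZ hY₀ (β := p / 2) (by positivity)
      (fun t ht => (by linarith [key t ht])) (Or.inr ⟨μ / 2, by positivity, fun t ht => ?_⟩)
    have := key t ht
    have : 0 ≤ (4 + p / 2) * ‖Z t‖ ^ 2 := by positivity
    linarith
  -- Critical energy: with W = 0 the virial expression is (p+4)‖Z‖² + p(‖U‖² - y₀²). It exceeds
  -- (4+p)‖Z‖² strictly but not uniformly, so the sign of ⟨Y₀, Z(0)⟩ is needed.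
  · obtain ⟨Y₀, hY₀, hin⟩ := hcrit heq
    have e2 : 2 * (p + 2) * e = p * y₀ ^ 2 := by rw [heq]; field_simp
    have key : ∀ t ≥ 0, (4 + p) * ‖Z t‖ ^ 2 <
        2 * ‖Z t‖ ^ 2 - 2 * inner ℝ (U t - 0) (U t + J (g (U t))) := by
      intro t ht
      rw [hvir t ht, e2, map_zero, inner_zero_left, inner_zero_left]
      have := hlt t ht
      nlinarith
    refine h.false_of_convexity hU hZ (W := 0) (by rw [hY₀, sub_zero]) (β := p) hp
      (fun t ht => (key t ht).le) (Or.inl ⟨fun t ht => ?_, hin⟩)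
    exact lt_of_le_of_lt (by positivity) (key t ht)

end Global

end IsWell

end

end GBq
end

open MeasureTheory Set
open scoped FourierTransform ContDiff

noncomputable section

namespace GBq

/-! ### The operators of the equation -/

/-- `P(k)² = 1 + k² + κ k⁴`. -/
def dispSq (κ k : ℝ) : ℝ := 1 + k ^ 2 + κ * k ^ 4

/-- `N(k) = |k| (1 + k²)^{1/2} / P(k)`. -/
def symN (κ k : ℝ) : ℝ := |k| * besselSymbol 1 k / Real.sqrt (dispSq κ k)

/-- `N(D)`. -/
def opN (κ : ℝ) : L2 →L[ℝ] L2 := mulOp (fun k => (symN κ k : ℂ))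

section
variable {κ : ℝ} (hκ : 0 < κ)
include hκ

lemma dispSq_pos (k : ℝ) : 0 < dispSq κ k := by unfold dispSq; positivity

lemma symN_sq (k : ℝ) : symN κ k ^ 2 = k ^ 2 * besselSymbol 2 k / dispSq κ k := by
  rw [symN, div_pow, mul_pow, sq_abs, Real.sq_sqrt (dispSq_pos hκ k).le, sq (besselSymbol 1 k),
    besselSymbol_mul]
  norm_num

/-- Positivity of κ is essential here: κk⁴ in the denominator balances the k⁴ of the numerator. -/
lemma symN_sq_le (k : ℝ) : symN κ k ^ 2 ≤ 1 + 1 / κ := by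
  rw [symN_sq hκ, besselSymbol_two, div_le_iff₀ (dispSq_pos hκ k), dispSq]
  have : (1 + 1 / κ) * (1 + k ^ 2 + κ * k ^ 4) =
      k ^ 2 * (1 + k ^ 2) + (1 + κ * k ^ 4 + 1 / κ + k ^ 2 / κ) := by field_simp; ring
  rw [this]
  have : 0 ≤ 1 + κ * k ^ 4 + 1 / κ + k ^ 2 / κ := by positivity
  linarith

omit hκ in
lemma measurable_symN : Measurable (symN κ) := by
  have := measurable_besselSymbol 1
  unfold symN dispSq
  fun_prop

omit hκ in
lemma symN_nonneg (k : ℝ) : 0 ≤ symN κ k :=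
  div_nonneg (mul_nonneg (abs_nonneg _) (besselSymbol_pos _ _).le) (Real.sqrt_nonneg _)

omit hκ in
lemma symN_neg_arg (k : ℝ) : symN κ (-k) = symN κ k := by
  simp [symN, dispSq, besselSymbol_neg_arg, abs_neg, show (-k) ^ 4 = k ^ 4 by ring]

lemma isSymbol_symN : IsSymbol (fun k => (symN κ k : ℂ)) where
  toIsHerm := isHerm_ofReal (measurable_symN) (symN_neg_arg)
  bdd := ⟨Real.sqrt (1 + 1 / κ), fun k => by
    rw [Complex.norm_real, Real.norm_of_nonneg (symN_nonneg k)]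
    exact Real.le_sqrt_of_sq_le (symN_sq_le hκ k)⟩

lemma hasMul_opN (U : L2) : HasMul (fun k => (symN κ k : ℂ)) U (opN κ U) :=
  hasMul_mulOp (isSymbol_symN hκ) U

lemma hasMul_opN_sq (U : L2) : HasMul (fun k => ((symN κ k ^ 2 : ℝ) : ℂ)) U (opN κ (opN κ U)) :=
  (hasMul_opN hκ U).comp (hasMul_opN hκ _) fun k _ => by push_cast; ring

lemma inner_opN (U V : L2) : (inner ℝ (opN κ U) V : ℝ) = inner ℝ U (opN κ V) :=
  HasMul.inner_symm (fun _ => Complex.conj_ofReal _) (hasMul_opN hκ U) (hasMul_opN hκ V)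

theorem isWell {a p : ℝ} (ha : 0 < a) (hp : 0 < p) :
    IsWell (opN κ) besselJ (nl a p) (pot a p) p (wellRadius a p) where
  p_pos := hp
  y_pos := wellRadius_pos ha hp
  symm_N := inner_opN hκ
  symm_J := inner_besselJ
  lip R := by
    obtain ⟨K, hK⟩ := exists_nl_lipschitz (a := a) hp R
    refine ⟨K, LipschitzOnWith.of_dist_le_mul fun U hU V hV => ?_⟩
    rw [mem_closedBall_zero_iff] at hU hV
    rw [dist_eq_norm, dist_eq_norm]
    exact hK U V hU hV
  hasFDerivAt := hasFDerivAt_pot hp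
  inner_self := inner_nl hp
  abs_inner_le := abs_inner_nl_le ha hp
  le := neg_pot_le ha hp

end

/-- The exponents in the definition of C_* cancel, so its power in e₀ is the mass ‖φ‖_1². -/
lemma e0_eq {a p : ℝ} (ha : 0 < a) (hp : 0 < p) :
    e0 a p = p / (2 * (p + 2)) * wellRadius a p ^ 2 := by
  have hg := gsMass_pos hp
  have h1 : Cstar p ^ (-2 * (p + 2) / p) = gsMass p := by
    rw [Cstar, ← gsMass, ← Real.rpow_mul (Real.sqrt_nonneg _), Real.sqrt_eq_rpow,
      ← Real.rpow_mul hg.le]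
    convert Real.rpow_one _ using 2
    field_simp
  rw [e0, h1, wellRadius_sq ha hp]
  ring

/-! ### Continuous curves in integer Sobolev spaces -/

/-- The pointwise product, as an element of `L²` when it is one. -/
def mulL2 (u w : L2) : L2 := ofFun fun x => u x * w x

lemma mulL2_comm (u w : L2) : mulL2 u w = mulL2 w u :=
  congrArg ofFun (funext fun x => mul_comm (u x) (w x))

lemma mulL2_coeFn {u : L2} {R : ℝ} (hu : ∀ᵐ x, |u x| ≤ R) (w : L2) :
    mulL2 u w =ᵐ[volume] fun x => u x * w x := by
  have hm : MemLp (fun x => u x * w x) 2 volume := by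
    refine MemLp.of_le_mul (Lp.memLp w)
      ((Lp.aestronglyMeasurable u).mul (Lp.aestronglyMeasurable w)) (c := R) ?_
    filter_upwards [hu] with x hx
    rw [norm_mul]
    gcongr
    exact hx
  exact ofFun_coeFn hm

lemma norm_mulL2_le {u : L2} {R : ℝ} (hu : ∀ᵐ x, |u x| ≤ R) (w : L2) :
    ‖mulL2 u w‖ ≤ R * ‖w‖ := by
  refine Lp.norm_le_mul_norm_of_ae_le_mul ?_
  filter_upwards [hu, mulL2_coeFn hu w] with x hx h
  rw [h, norm_mul]
  gcongr
  exact hx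

lemma HasDer.ae_abs_le {u g : L2} (h : HasDer u g) : ∀ᵐ x, |u x| ≤ ‖u‖ + ‖g‖ := by
  obtain ⟨v, hv, hp⟩ := h.exists_isPrim
  have e : (fun x => (u : ℝ → ℝ) x ^ 2) =ᵐ[volume] fun x => v x ^ 2 := by
    filter_upwards [hv] with x hx
    rw [hx]
  filter_upwards [hv] with x hx
  have h1 := hp.sq_le ((L2.integrable_sq u).congr e) (L2.integrable_sq g) x
  rw [← integral_congr_ae e, ← L2.norm_sq_eq, ← L2.norm_sq_eq] at h1
  rw [hx]
  refine abs_le_of_sq_le_sq (h1.trans ?_) (by positivity)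
  nlinarith [norm_nonneg u, norm_nonneg g]

lemma HasDer.mulL2 {u u' v v' : L2} (hu : HasDer u u') (hv : HasDer v v') :
    HasDer (mulL2 u v) (mulL2 u' v + mulL2 u v') := by
  obtain ⟨u₁, hu₁, hpu⟩ := hu.exists_isPrim
  obtain ⟨v₁, hv₁, hpv⟩ := hv.exists_isPrim
  refine (hpu.mul hpv).hasDer ?_ ?_
  · filter_upwards [mulL2_coeFn hu.ae_abs_le v, hu₁, hv₁] with x h1 h2 h3
    rw [h1, h2, h3]
  · rw [mulL2_comm u' v]
    filter_upwards [Lp.coeFn_add (GBq.mulL2 v u') (GBq.mulL2 u v'), mulL2_coeFn hu.ae_abs_le v',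
      mulL2_coeFn hv.ae_abs_le u', hu₁, hv₁] with x h1 h2 h3 h4 h5
    rw [h1, Pi.add_apply, h2, h3, h4, h5]
    ring

/-- The chain rule for the identity allows any value of its derivative at 0. Choosing 0 there and
comparing with the true derivative shows that g vanishes almost everywhere on the zero set of u. -/
lemma IsPrim.ae_eq_zero {u g : ℝ → ℝ} (h : IsPrim u g) : ∀ᵐ x, u x = 0 → g x = 0 := by
  have h1 : IsPrim u (fun x => (if u x = 0 then 0 else 1) * g x) :=
    h.comp (G := id) (G' := fun y => if y = 0 then 0 else 1) rfl
      (fun R => ⟨1, LipschitzWith.id.lipschitzOnWith⟩) fun y hy => by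
        simpa [hy] using hasDerivAt_id y
  filter_upwards [h.ae_hasDerivAt, h1.ae_hasDerivAt] with x h2 h3 hx
  simpa [hx] using h2.unique h3

lemma HasDer.ae_eq_zero {u g : L2} (h : HasDer u g) : ∀ᵐ x, u x = 0 → g x = 0 := by
  obtain ⟨v, hv, hp⟩ := h.exists_isPrim
  filter_upwards [hv, hp.ae_eq_zero] with x h1 h2 h3
  exact h2 (by rw [← h1, h3])

/-- Curves `u` that are continuous on `I` with values in `H^m(ℝ)`. -/
def CurveH (I : Set ℝ) : ℕ → (ℝ → L2) → Prop
  | 0, u => ContinuousOn u I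
  | m + 1, u => ContinuousOn u I ∧ ∃ v : ℝ → L2, (∀ t ∈ I, HasDer (u t) (v t)) ∧ CurveH I m v

section
variable {I : Set ℝ} {m : ℕ} {u v : ℝ → L2}

lemma CurveH.continuousOn (h : CurveH I m u) : ContinuousOn u I := by
  cases m with
  | zero => exact h
  | succ m => exact h.1

lemma CurveH.of_succ (h : CurveH I (m + 1) u) : CurveH I m u := by
  induction m generalizing u with
  | zero => exact h.1
  | succ m ih =>
    obtain ⟨h1, w, hw, hw'⟩ := h
    exact ⟨h1, w, hw, ih hw'⟩

lemma CurveH.mono (h : CurveH I m u) {n : ℕ} (hn : n ≤ m) : CurveH I n u := by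
  induction m with
  | zero => rwa [Nat.le_zero.1 hn]
  | succ m ih =>
    rcases Nat.le_succ_iff.1 hn with h' | h'
    · exact ih h.of_succ h'
    · rwa [h']

lemma CurveH.add (hu : CurveH I m u) (hv : CurveH I m v) : CurveH I m (fun t => u t + v t) := by
  induction m generalizing u v with
  | zero => exact ContinuousOn.add hu hv
  | succ m ih =>
    obtain ⟨h1, w, hw, hw'⟩ := hu
    obtain ⟨h1', z, hz, hz'⟩ := hv
    exact ⟨h1.add h1', _, fun t ht => (hw t ht).add (hz t ht), ih hw' hz'⟩

lemma CurveH.const_smul (c : ℝ) (hu : CurveH I m u) : CurveH I m (fun t => c • u t) := by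
  induction m generalizing u with
  | zero => exact ContinuousOn.const_smul hu c
  | succ m ih =>
    obtain ⟨h1, w, hw, hw'⟩ := hu
    exact ⟨h1.const_smul c, _, fun t ht => (hw t ht).smul c, ih hw'⟩

lemma CurveH.congr (hu : CurveH I m u) (h : ∀ t ∈ I, v t = u t) : CurveH I m v := by
  cases m with
  | zero => exact ContinuousOn.congr hu h
  | succ m =>
    obtain ⟨h1, w, hw, hw'⟩ := hu
    exact ⟨h1.congr h, w, fun t ht => by rw [h t ht]; exact hw t ht, hw'⟩

/-- The product H¹ × L² → L² is bounded because H¹ ⊂ L^∞; the difference of products is split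
bilinearly. -/
lemma CurveH.mul_zero (hu : CurveH I 1 u) (hv : CurveH I 0 v) :
    CurveH I 0 (fun t => mulL2 (u t) (v t)) := by
  obtain ⟨h1, w, hw, hw'⟩ := hu
  have hw' : ContinuousOn w I := hw'
  have hv : ContinuousOn v I := hv
  intro t ht
  have key : ∀ s ∈ I, ‖mulL2 (u s) (v s) - mulL2 (u t) (v t)‖ ≤
      (‖u s‖ + ‖w s‖) * ‖v s - v t‖ + (‖u s - u t‖ + ‖w s - w t‖) * ‖v t‖ := by
    intro s hs
    have hd := (hw s hs).sub (hw t ht)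
    have e : mulL2 (u s) (v s) - mulL2 (u t) (v t) =
        mulL2 (u s) (v s - v t) + mulL2 (u s - u t) (v t) := by
      apply Lp.ext
      filter_upwards [Lp.coeFn_sub (mulL2 (u s) (v s)) (mulL2 (u t) (v t)),
        Lp.coeFn_add (mulL2 (u s) (v s - v t)) (mulL2 (u s - u t) (v t)),
        mulL2_coeFn (hw s hs).ae_abs_le (v s), mulL2_coeFn (hw t ht).ae_abs_le (v t),
        mulL2_coeFn (hw s hs).ae_abs_le (v s - v t), mulL2_coeFn (HasDer.ae_abs_le hd) (v t),
        Lp.coeFn_sub (v s) (v t), Lp.coeFn_sub (u s) (u t)] with x h1 h2 h3 h4 h5 h6 h7 h8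
      rw [h1, h2, Pi.sub_apply, Pi.add_apply, h3, h4, h5, h6, h7, h8, Pi.sub_apply, Pi.sub_apply]
      ring
    rw [e]
    exact (norm_add_le _ _).trans (add_le_add (norm_mulL2_le (hw s hs).ae_abs_le _)
      (norm_mulL2_le (HasDer.ae_abs_le hd) _))
  rw [ContinuousWithinAt, tendsto_iff_norm_sub_tendsto_zero]
  have hlim : Filter.Tendsto (fun s => (‖u s‖ + ‖w s‖) * ‖v s - v t‖ +
      (‖u s - u t‖ + ‖w s - w t‖) * ‖v t‖) (nhdsWithin t I) (nhds 0) := by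
    have c : ContinuousWithinAt (fun s => (‖u s‖ + ‖w s‖) * ‖v s - v t‖ +
      (‖u s - u t‖ + ‖w s - w t‖) * ‖v t‖) I t :=
      (((h1 t ht).norm.add (hw' t ht).norm).mul ((hv t ht).sub continuousWithinAt_const).norm).add
      ((((h1 t ht).sub continuousWithinAt_const).norm.add
        ((hw' t ht).sub continuousWithinAt_const).norm).mul continuousWithinAt_const)
    simpa [ContinuousWithinAt] using c
  refine squeeze_zero' (Filter.Eventually.of_forall fun _ => norm_nonneg _) ?_ hlim
  filter_upwards [self_mem_nhdsWithin] with s hs using key s hs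

/-- `H^m(ℝ)`, `m ≥ 1`, is an algebra. -/
lemma CurveH.mul (hu : CurveH I (m + 1) u) (hv : CurveH I (m + 1) v) :
    CurveH I (m + 1) (fun t => mulL2 (u t) (v t)) := by
  induction m generalizing u v with
  | zero =>
    obtain ⟨h1, w, hw, hw'⟩ := id hu
    obtain ⟨h1', z, hz, hz'⟩ := id hv
    refine ⟨hu.mul_zero hv.of_succ, _, fun t ht => (hw t ht).mulL2 (hz t ht), ?_⟩
    refine CurveH.add ?_ (hu.mul_zero hz')
    simp only [mulL2_comm]
    exact hv.mul_zero hw'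
  | succ m ih =>
    obtain ⟨h1, w, hw, hw'⟩ := id hu
    obtain ⟨h1', z, hz, hz'⟩ := id hv
    exact ⟨(ih hu.of_succ hv.of_succ).continuousOn, _,
      fun t ht => (hw t ht).mulL2 (hz t ht), (ih hw' hv.of_succ).add (ih hu.of_succ hz')⟩

end

end GBq
end

open MeasureTheory Set
open scoped FourierTransform ContDiff

noncomputable section

namespace GBq

/-! ### Powers of curves in integer Sobolev spaces -/

/-- Locally bounded functions that are continuous off the origin. -/
structure LocBdd (φ : ℝ → ℝ) : Prop where
  measurable : Measurable φ
  continuousAt : ∀ y ≠ 0, ContinuousAt φ y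
  bdd : ∀ R, ∃ C, ∀ y, |y| ≤ R → |φ y| ≤ C

lemma LocBdd.memLp {φ : ℝ → ℝ} (hφ : LocBdd φ) {u : L2} {R : ℝ} (hu : ∀ᵐ x, |u x| ≤ R) (v : L2) :
    MemLp (fun x => φ (u x) * v x) 2 volume := by
  obtain ⟨C, hC⟩ := hφ.bdd R
  refine MemLp.of_le_mul (Lp.memLp v) ((hφ.measurable.comp_aemeasurable
    (Lp.aestronglyMeasurable u).aemeasurable).aestronglyMeasurable.mul
      (Lp.aestronglyMeasurable v)) (c := C) ?_
  filter_upwards [hu] with x hx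
  rw [norm_mul]
  gcongr
  exact hC _ hx

lemma LocBdd.coeFn {φ : ℝ → ℝ} (hφ : LocBdd φ) {u : L2} {R : ℝ} (hu : ∀ᵐ x, |u x| ≤ R) (v : L2) :
    ofFun (fun x => φ (u x) * v x) =ᵐ[volume] fun x => φ (u x) * v x :=
  ofFun_coeFn (hφ.memLp hu v)

lemma HasDer.nem {u v : L2} (h : HasDer u v) {G G' : ℝ → ℝ} (hG : LocLip G) (hG' : LocBdd G')
    (hd : ∀ y ≠ 0, HasDerivAt G (G' y) y) :
    HasDer (nem G u) (ofFun fun x => G' (u x) * v x) := by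
  obtain ⟨w, hw, hp⟩ := h.exists_isPrim
  refine (hp.comp hG.zero hG.lip hd).hasDer ?_ ?_
  · filter_upwards [hG.nem_coeFn h.ae_abs_le, hw] with x h1 h2
    rw [h1, h2]
  · filter_upwards [hG'.coeFn h.ae_abs_le v, hw] with x h1 h2
    rw [h1, h2]

section
variable {I : Set ℝ} {u : ℝ → L2}

lemma CurveH.nem_zero (hu : CurveH I 1 u) {G : ℝ → ℝ} (hG : LocLip G) :
    ContinuousOn (fun t => nem G (u t)) I := by
  obtain ⟨h1, w, hw, hw'⟩ := hu
  have hw' : ContinuousOn w I := hw'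
  intro t ht
  obtain ⟨K, hK⟩ := hG.exists_nem_lipschitz (‖u t‖ + ‖w t‖ + 1)
  have hev : ∀ᶠ s in nhdsWithin t I, ‖u s‖ + ‖w s‖ < ‖u t‖ + ‖w t‖ + 1 :=
    ((h1 t ht).norm.add (hw' t ht).norm).eventually_lt_const (lt_add_one (‖u t‖ + ‖w t‖))
  rw [ContinuousWithinAt, tendsto_iff_norm_sub_tendsto_zero]
  have hlim : Filter.Tendsto (fun s => K * ‖u s - u t‖) (nhdsWithin t I) (nhds 0) := by
    have c : ContinuousWithinAt (fun s => K * ‖u s - u t‖) I t :=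
      continuousWithinAt_const.mul ((h1 t ht).sub continuousWithinAt_const).norm
    simpa [ContinuousWithinAt] using c
  refine squeeze_zero' (Filter.Eventually.of_forall fun _ => norm_nonneg _) ?_ hlim
  filter_upwards [self_mem_nhdsWithin, hev] with s hs hs'
  refine hK _ _ ?_ ?_
  · filter_upwards [(hw s hs).ae_abs_le] with x hx using hx.trans hs'.le
  · filter_upwards [(hw t ht).ae_abs_le] with x hx using hx.trans (by linarith)

/-- The function φ may jump at 0, yet φ(u)u_x depends continuously on t because u_x = 0 almost
everywhere where u = 0. This covers the last derivative of a power, where no Lipschitz bound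
remains. Continuity is checked along sequences: H¹ convergence gives pointwise convergence of u, and
dominated convergence does the rest. -/
lemma continuousOn_comp_mul_der {v : ℝ → L2} (hu : ContinuousOn u I) (hv : ContinuousOn v I)
    (hd : ∀ t ∈ I, HasDer (u t) (v t)) {φ : ℝ → ℝ} (hφ : LocBdd φ) :
    ContinuousOn (fun t => ofFun fun x => φ (u t x) * v t x) I := by
  intro t ht
  set R := ‖u t‖ + ‖v t‖ + 1 with hR
  obtain ⟨C, hC⟩ := hφ.bdd R
  have hev : ∀ᶠ s in nhdsWithin t I, ‖u s‖ + ‖v s‖ < R :=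
    ((hu t ht).norm.add (hv t ht).norm).eventually_lt_const (lt_add_one (‖u t‖ + ‖v t‖))
  have hut : ∀ᵐ x, |u t x| ≤ R := by
    filter_upwards [(hd t ht).ae_abs_le] with x hx using hx.trans (by linarith)
  refine Filter.tendsto_of_seq_tendsto fun s hs => ?_
  have hs0 : ∀ᶠ n in Filter.atTop, s n ∈ I ∧ ‖u (s n)‖ + ‖v (s n)‖ < R :=
    hs.eventually (Filter.Eventually.and self_mem_nhdsWithin hev)
  have hus : ∀ n, s n ∈ I ∧ ‖u (s n)‖ + ‖v (s n)‖ < R → ∀ᵐ x, |u (s n) x| ≤ R := fun n hn => by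
    filter_upwards [(hd _ hn.1).ae_abs_le] with x hx using hx.trans hn.2.le
  have hus' : Filter.Tendsto (fun n => u (s n)) Filter.atTop (nhds (u t)) := (hu t ht).tendsto.comp hs
  have hvs' : Filter.Tendsto (fun n => v (s n)) Filter.atTop (nhds (v t)) := (hv t ht).tendsto.comp hs
  have hpt : ∀ᵐ x, Filter.Tendsto (fun n => u (s n) x) Filter.atTop (nhds (u t x)) := by
    have h1 : ∀ n, s n ∈ I → ∀ᵐ x, |u (s n) x - u t x| ≤ ‖u (s n) - u t‖ + ‖v (s n) - v t‖ := by
      intro n hn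
      filter_upwards [HasDer.ae_abs_le ((hd _ hn).sub (hd t ht)), Lp.coeFn_sub (u (s n)) (u t)]
        with x h2 h3
      rwa [h3] at h2
    have h2 : ∀ᵐ x, ∀ n, s n ∈ I → |u (s n) x - u t x| ≤ ‖u (s n) - u t‖ + ‖v (s n) - v t‖ := by
      rw [ae_all_iff]
      intro n
      by_cases hn : s n ∈ I
      · filter_upwards [h1 n hn] with x hx _ using hx
      · exact Filter.Eventually.of_forall fun x h => absurd h hn
    filter_upwards [h2] with x hx
    rw [tendsto_iff_norm_sub_tendsto_zero]
    have hlim : Filter.Tendsto (fun n => ‖u (s n) - u t‖ + ‖v (s n) - v t‖) Filter.atTop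
        (nhds 0) := by
      have := ((hus'.sub_const (u t)).norm).add ((hvs'.sub_const (v t)).norm)
      simpa using this
    refine squeeze_zero' (Filter.Eventually.of_forall fun _ => norm_nonneg _) ?_ hlim
    filter_upwards [hs0] with n hn using hx n hn.1
  have hsq : Filter.Tendsto (fun n => ∫ x, ((φ (u (s n) x) - φ (u t x)) * v t x) ^ 2)
      Filter.atTop (nhds 0) := by
    have h0 : ∫ x : ℝ, (0 : ℝ) = 0 := integral_zero _ _
    rw [← h0]
    refine tendsto_integral_filter_of_dominated_convergence (fun x => (2 * C) ^ 2 * v t x ^ 2)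
      (Filter.Eventually.of_forall fun n => ?_) ?_ ((L2.integrable_sq _).const_mul _) ?_
    · exact (((hφ.measurable.comp_aemeasurable (Lp.aestronglyMeasurable _).aemeasurable).sub
        (hφ.measurable.comp_aemeasurable (Lp.aestronglyMeasurable _).aemeasurable)).mul
        (Lp.aestronglyMeasurable _).aemeasurable).pow_const 2 |>.aestronglyMeasurable
    · filter_upwards [hs0] with n hn
      filter_upwards [hus n hn, hut] with x h1 h2
      rw [Real.norm_of_nonneg (sq_nonneg _), mul_pow, ← sq_abs (_ - _)]
      gcongr
      have := abs_sub (φ (u (s n) x)) (φ (u t x))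
      linarith [hC _ h1, hC _ h2]
    · filter_upwards [hpt, (hd t ht).ae_eq_zero] with x h1 h2
      rcases eq_or_ne (u t x) 0 with h | h
      · simp [h2 h]
      · have h3 := (hφ.continuousAt _ h).tendsto.comp h1
        have h4 := ((h3.sub_const (φ (u t x))).mul_const (v t x)).pow 2
        simpa using h4
  rw [tendsto_iff_norm_sub_tendsto_zero]
  have hlim : Filter.Tendsto (fun n => C * ‖v (s n) - v t‖ +
      Real.sqrt (∫ x, ((φ (u (s n) x) - φ (u t x)) * v t x) ^ 2)) Filter.atTop (nhds 0) := by
    have := (((hvs'.sub_const (v t)).norm).const_mul C).add hsq.sqrt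
    simpa using this
  refine squeeze_zero' (Filter.Eventually.of_forall fun _ => norm_nonneg _) ?_ hlim
  filter_upwards [hs0] with n hn
  have c1 := hφ.coeFn (hus n hn) (v (s n))
  have c2 := hφ.coeFn hut (v t)
  have c3 := hφ.coeFn (hus n hn) (v (s n) - v t)
  have c4 := hφ.coeFn (hus n hn) (v t)
  set A := ofFun fun x => φ (u (s n) x) * v (s n) x
  set B := ofFun fun x => φ (u t x) * v t x
  set D := ofFun fun x => φ (u (s n) x) * (v (s n) - v t : L2) x
  set E := ofFun fun x => φ (u (s n) x) * v t x
  -- Splitting: φ(uₙ)(vₙ - v) is small since φ(uₙ) is bounded, and (φ(uₙ) - φ(u))v tends to 0 by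
  -- dominated convergence.
  have e : A - B = D + (E - B) := by
    apply Lp.ext
    filter_upwards [c1, c2, c3, c4, Lp.coeFn_sub A B, Lp.coeFn_add D (E - B), Lp.coeFn_sub E B,
      Lp.coeFn_sub (v (s n)) (v t)] with x h1 h2 h3 h4 h5 h6 h7 h8
    rw [h5, h6, Pi.sub_apply, Pi.add_apply, h7, Pi.sub_apply, h1, h2, h3, h4, h8, Pi.sub_apply]
    ring
  have hD : ‖D‖ ≤ C * ‖v (s n) - v t‖ := by
    refine Lp.norm_le_mul_norm_of_ae_le_mul ?_
    filter_upwards [c3, hus n hn] with x h1 h2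
    rw [h1, norm_mul]
    gcongr
    exact hC _ h2
  have hEB : ‖E - B‖ = Real.sqrt (∫ x, ((φ (u (s n) x) - φ (u t x)) * v t x) ^ 2) := by
    rw [eq_comm, Real.sqrt_eq_iff_mul_self_eq (integral_nonneg fun x => sq_nonneg _)
      (norm_nonneg _), ← sq, L2.norm_sq_eq]
    apply integral_congr_ae
    filter_upwards [c2, c4, Lp.coeFn_sub E B] with x h1 h2 h3
    rw [h3, Pi.sub_apply, h1, h2]
    ring
  simp only [Function.comp_apply]
  calc ‖A - B‖ ≤ ‖D‖ + ‖E - B‖ := by rw [e]; exact norm_add_le _ _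
    _ ≤ _ := add_le_add hD hEB.le

/-- The odd power `|y|^{q-1} y`. -/
def oddPow (q y : ℝ) : ℝ := |y| ^ (q - 1) * y

lemma hasDerivAt_abs_rpow_of_ne (q : ℝ) {y : ℝ} (hy : y ≠ 0) :
    HasDerivAt (fun y : ℝ => |y| ^ q) (q * oddPow (q - 1) y) y := by
  refine ((hasDerivAt_abs hy).rpow_const (p := q) (Or.inl (abs_ne_zero.2 hy))).congr_deriv ?_
  have e2 : |y| ^ (q - 1) = |y| ^ (q - 1 - 1) * |y| := by
    rw [← Real.rpow_add_one (abs_ne_zero.2 hy)]; simp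
  have e : (SignType.sign y : ℝ) * |y| = y := sign_mul_abs y
  rw [oddPow, e2]
  linear_combination (q * |y| ^ (q - 1 - 1)) * e

lemma hasDerivAt_oddPow_of_ne (q : ℝ) {y : ℝ} (hy : y ≠ 0) :
    HasDerivAt (oddPow q) (q * |y| ^ (q - 1)) y := by
  refine ((hasDerivAt_abs_rpow_of_ne (q - 1) hy).mul (hasDerivAt_id y)).congr_deriv ?_
  have e2 : |y| ^ (q - 1) = |y| ^ (q - 1 - 1 - 1) * (y * y) := by
    rw [← abs_mul_abs_self, ← mul_assoc, ← Real.rpow_add_one (abs_ne_zero.2 hy),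
      ← Real.rpow_add_one (abs_ne_zero.2 hy)]
    simp
  rw [oddPow, id_eq, e2]
  ring

lemma locBdd_abs_rpow {q : ℝ} (hq : 0 ≤ q) : LocBdd fun y : ℝ => |y| ^ q where
  measurable := by fun_prop
  continuousAt _ _ := (continuous_abs_rpow hq).continuousAt
  bdd R := ⟨R ^ q, fun y hy => by
    rw [abs_of_nonneg (by positivity)]
    gcongr⟩

lemma locBdd_oddPow {q : ℝ} (hq : 0 ≤ q) : LocBdd (oddPow q) where
  measurable := by unfold oddPow; fun_prop
  continuousAt _ hy := (hasDerivAt_oddPow_of_ne q hy).continuousAt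
  bdd R := ⟨R ^ q, fun y hy => by
    rcases eq_or_ne y 0 with rfl | h
    · rw [abs_zero] at hy
      simp only [oddPow, mul_zero, abs_zero]
      positivity
    · rw [oddPow, abs_mul, abs_of_nonneg (by positivity), ← Real.rpow_add_one (abs_ne_zero.2 h),
        sub_add_cancel]
      gcongr⟩

lemma LocBdd.const_mul {φ : ℝ → ℝ} (h : LocBdd φ) (c : ℝ) : LocBdd fun y => c * φ y where
  measurable := h.measurable.const_mul c
  continuousAt y hy := continuousAt_const.mul (h.continuousAt y hy)
  bdd R := by
    obtain ⟨C, hC⟩ := h.bdd R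
    refine ⟨|c| * C, fun y hy => ?_⟩
    rw [abs_mul]
    gcongr
    exact hC y hy

lemma locLip_oddPow {q : ℝ} (hq : 1 ≤ q) : LocLip (oddPow q) := by
  rcases hq.eq_or_lt with rfl | hq
  · refine ⟨by simp [oddPow], fun R => ⟨1, ?_⟩⟩
    have : oddPow 1 = id := by ext y; simp [oddPow]
    rw [this]
    exact LipschitzWith.id.lipschitzOnWith
  · exact locLip_of_hasDerivAt (by simp [oddPow])
      (fun y => hasDerivAt_abs_rpow_mul (p := q - 1) (by linarith) y)
      ((continuous_abs_rpow (by linarith)).const_mul _)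

lemma locLip_abs_rpow {q : ℝ} (hq : 1 ≤ q) : LocLip fun y : ℝ => |y| ^ q := by
  rcases hq.eq_or_lt with rfl | hq
  · refine ⟨by simp, fun R => ⟨1, ?_⟩⟩
    simp only [Real.rpow_one]
    exact (lipschitzWith_one_norm (E := ℝ)).lipschitzOnWith
  · refine locLip_of_hasDerivAt (h' := fun y => q * oddPow (q - 1) y)
      (by simp [Real.zero_rpow (by linarith : q ≠ 0)]) (fun y => ?_) ?_
    · rcases eq_or_ne y 0 with rfl | hy
      · have := hasDerivAt_abs_rpow (0 : ℝ) hq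
        simpa [oddPow] using this
      · exact hasDerivAt_abs_rpow_of_ne q hy
    · refine continuous_const.mul (continuous_iff_continuousAt.2 fun y => ?_)
      rcases eq_or_ne y 0 with rfl | hy
      · rw [Metric.continuousAt_iff]
        intro ε hε
        have h1 : Filter.Tendsto (fun y : ℝ => |y| ^ (q - 1)) (nhds 0) (nhds 0) := by
          have := (continuous_abs_rpow (p := q - 1) (by linarith)).tendsto 0
          simpa [Real.zero_rpow (by linarith : q - 1 ≠ 0)] using this
        obtain ⟨δ, hδ, h⟩ := Metric.tendsto_nhds_nhds.1 h1 ε hε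
        refine ⟨δ, hδ, fun {x} hx => ?_⟩
        rcases eq_or_ne x 0 with rfl | hx0
        · simpa using hε
        · have := h hx
          rw [dist_zero_right, Real.norm_eq_abs] at this
          have e : oddPow (q - 1) 0 = 0 := by simp [oddPow]
          rw [e, dist_zero_right, Real.norm_eq_abs, oddPow, abs_mul]
          rw [abs_of_nonneg (by positivity)] at this ⊢
          rwa [← Real.rpow_add_one (abs_ne_zero.2 hx0), sub_add_cancel]
      · exact (hasDerivAt_oddPow_of_ne _ hy).continuousAt

lemma ofFun_const_mul_comp {G : ℝ → ℝ} (hG : LocLip G) {u v : L2} (hd : HasDer u v) (c : ℝ) :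
    ofFun (fun x => c * G (u x) * v x) = c • mulL2 (nem G u) v := by
  have h1 := hG.nem_coeFn hd.ae_abs_le
  have hG' : LocBdd G := ⟨hG.continuous.measurable, fun _ _ => hG.continuous.continuousAt, fun R => by
    obtain ⟨C, hC⟩ := (isCompact_Icc (a := -R) (b := R)).exists_bound_of_continuousOn
      hG.continuous.continuousOn
    exact ⟨C, fun y hy => hC y (abs_le.1 hy)⟩⟩
  obtain ⟨C, hC⟩ := hG'.bdd (‖u‖ + ‖v‖)
  have h2 : ∀ᵐ x, |nem G u x| ≤ C := by
    filter_upwards [h1, hd.ae_abs_le] with x h1 h2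
    rw [h1]
    exact hC _ h2
  apply Lp.ext
  filter_upwards [(hG'.const_mul c).coeFn hd.ae_abs_le v, Lp.coeFn_smul c (mulL2 (nem G u) v),
    mulL2_coeFn h2 v, h1] with x e1 e2 e3 e4
  rw [e1, e2, Pi.smul_apply, e3, e4, smul_eq_mul]
  ring

/-- Powers of exponent at least `m ≥ 1` act continuously on `H^m(ℝ)`. -/
lemma CurveH.power (m : ℕ) : ∀ {q : ℝ} {u : ℝ → L2}, (m + 1 : ℝ) ≤ q → CurveH I (m + 1) u →
    CurveH I (m + 1) (fun t => nem (fun y => |y| ^ q) (u t)) ∧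
      CurveH I (m + 1) (fun t => nem (oddPow q) (u t)) := by
  induction m with
  | zero =>
    intro q u hq hu
    have hq : 1 ≤ q := by simpa using hq
    obtain ⟨h1, w, hw, hw'⟩ := id hu
    have b1 := (locBdd_oddPow (q := q - 1) (by linarith)).const_mul q
    have b2 := (locBdd_abs_rpow (q := q - 1) (by linarith)).const_mul q
    -- The derivative may have exponent q - 1 = 0, where the odd power is the sign function; only
    -- the continuity result for φ discontinuous at 0 applies.
    exact ⟨⟨hu.nem_zero (locLip_abs_rpow hq), _, fun t ht => (hw t ht).nem (locLip_abs_rpow hq) b1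
        fun y hy => hasDerivAt_abs_rpow_of_ne q hy, continuousOn_comp_mul_der h1 hw' hw b1⟩,
      ⟨hu.nem_zero (locLip_oddPow hq), _, fun t ht => (hw t ht).nem (locLip_oddPow hq) b2
        fun y hy => hasDerivAt_oddPow_of_ne q hy, continuousOn_comp_mul_der h1 hw' hw b2⟩⟩
  | succ m ih =>
    intro q u hq hu
    push_cast at hq
    have hm : (0 : ℝ) ≤ m := m.cast_nonneg
    have hq1 : 1 ≤ q := by linarith
    obtain ⟨h1, w, hw, hw'⟩ := id hu
    have b1 := (locBdd_oddPow (q := q - 1) (by linarith)).const_mul q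
    have b2 := (locBdd_abs_rpow (q := q - 1) (by linarith)).const_mul q
    obtain ⟨i1, i2⟩ := ih (q := q - 1) (by linarith) hu.of_succ
    have hu1 : CurveH I 1 u := hu.mono (by omega)
    refine ⟨⟨hu1.nem_zero (locLip_abs_rpow hq1), _, fun t ht => (hw t ht).nem (locLip_abs_rpow hq1)
        b1 fun y hy => hasDerivAt_abs_rpow_of_ne q hy, ?_⟩,
      ⟨hu1.nem_zero (locLip_oddPow hq1), _, fun t ht => (hw t ht).nem (locLip_oddPow hq1) b2
        fun y hy => hasDerivAt_oddPow_of_ne q hy, ?_⟩⟩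
    -- Differentiation exchanges even and odd powers and lowers q by one, so both families go
    -- through the induction together.
    · exact ((i2.mul hw').const_smul q).congr fun t ht =>
        ofFun_const_mul_comp (locLip_oddPow (q := q - 1) (by linarith)) (hw t ht) q
    · exact ((i1.mul hw').const_smul q).congr fun t ht =>
        ofFun_const_mul_comp (locLip_abs_rpow (q := q - 1) (by linarith)) (hw t ht) q

/-- The nonlinearity is -a times the odd power of exponent p + 1, and p + 1 ≥ m + 1. -/
lemma CurveH.nonlin {a p : ℝ} (hp : 0 < p) {m : ℕ} (hm : (m : ℝ) ≤ p) (hu : CurveH I (m + 1) u) :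
    CurveH I (m + 1) (fun t => nem (nonlin a p) (u t)) := by
  have hu1 : CurveH I 1 u := hu.mono (by omega)
  obtain ⟨h1, w, hw, hw'⟩ := hu1
  refine ((CurveH.power m (q := p + 1) (by linarith) hu).2.const_smul (-a)).congr fun t ht => ?_
  have hb := (hw t ht).ae_abs_le
  apply Lp.ext
  filter_upwards [(locLip_nonlin a hp).nem_coeFn hb, Lp.coeFn_smul (-a) (nem (oddPow (p + 1)) (u t)),
    (locLip_oddPow (q := p + 1) (by linarith)).nem_coeFn hb] with x e1 e2 e3
  rw [e1, e2, Pi.smul_apply, e3, smul_eq_mul, GBq.nonlin, oddPow, add_sub_cancel_right, mul_assoc]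

end

end GBq
end

open MeasureTheory Set
open scoped FourierTransform ContDiff

noncomputable section

namespace GBq

/-! ### Bessel potentials and integer Sobolev spaces -/

lemma HasMul.of_comp {m m' m'' : ℝ → ℂ} {W u v : L2} (h : HasMul m W u) (h' : HasMul m'' W v)
    (hm : ∀ k ≠ 0, m'' k = m' k * m k) : HasMul m' u v := by
  filter_upwards [h, h', Measure.ae_ne volume (0 : ℝ)] with ξ h1 h2 h3
  rw [h1, h2, hm _ (by simp [h3, Real.pi_ne_zero]), mul_assoc]

lemma hasMul_bessel_zero (u : L2) : HasMul (fun k => (besselSymbol 0 k : ℂ)) u u :=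
  (hasMul_one u).congr fun k _ => by simp [besselSymbol_zero]

lemma HasMul.bessel_comp {r s t : ℝ} {u v w : L2} (h : HasMul (fun k => (besselSymbol r k : ℂ)) u v)
    (h' : HasMul (fun k => (besselSymbol s k : ℂ)) v w) (ht : s + r = t) :
    HasMul (fun k => (besselSymbol t k : ℂ)) u w :=
  h.comp h' fun k _ => by rw [← ht, ← besselSymbol_mul]; push_cast; ring

lemma HasMul.bessel_symm {r : ℝ} {u v : L2} (h : HasMul (fun k => (besselSymbol r k : ℂ)) u v) :
    HasMul (fun k => (besselSymbol (-r) k : ℂ)) v u :=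
  h.of_comp (hasMul_bessel_zero u) fun k _ => by
    rw [← Complex.ofReal_mul, besselSymbol_mul, neg_add_cancel]

lemma HasMul.bessel_mono {r s : ℝ} (hrs : r ≤ s) {u v : L2}
    (h : HasMul (fun k => (besselSymbol s k : ℂ)) u v) :
    HasMul (fun k => (besselSymbol r k : ℂ)) u
      (mulOp (fun k => (besselSymbol (r - s) k : ℂ)) v) :=
  h.bessel_comp (hasMul_mulOp (isSymbol_bessel (by linarith)) v) (by ring)

section
variable {I : Set ℝ} {u : ℝ → L2}

/-- Induction on m: the derivative of the Bessel potential of order r of W is the Bessel potential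
of order r - 1 of ∂ₓJW, and ∂ₓJ is bounded on L². -/
lemma CurveH.of_bessel (m : ℕ) : ∀ {r : ℝ} {W u : ℝ → L2}, m ≤ r → ContinuousOn W I →
    (∀ t ∈ I, HasMul (fun k => (besselSymbol (-r) k : ℂ)) (W t) (u t)) → CurveH I m u := by
  have hcont : ∀ {r : ℝ} {W u : ℝ → L2}, 0 ≤ r → ContinuousOn W I →
      (∀ t ∈ I, HasMul (fun k => (besselSymbol (-r) k : ℂ)) (W t) (u t)) → ContinuousOn u I := by
    intro r W u hr hW h
    exact ((mulOp (fun k => (besselSymbol (-r) k : ℂ))).continuous.comp_continuousOn hW).congr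
      fun t ht => (h t ht).unique (hasMul_mulOp (isSymbol_bessel (by linarith)) (W t))
  induction m with
  | zero => exact fun hr hW h => hcont (by simpa using hr) hW h
  | succ m ih =>
    intro r W u hr hW h
    push_cast at hr
    have hm : (0 : ℝ) ≤ m := m.cast_nonneg
    set D := mulOp (fun k => k * Complex.I * besselSymbol (-1) k) with hD
    have hv := fun t => hasMul_mulOp (isSymbol_bessel (s := -(r - 1)) (by linarith)) (D (W t))
    refine ⟨hcont (by linarith) hW h, _, fun t ht => ?_,
      ih (r := r - 1) (by linarith) (D.continuous.comp_continuousOn hW) fun t _ => hv t⟩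
    have h1 := (hasMul_mulOp isSymbol_der_bessel (W t)).comp (hv t) fun k _ => rfl
    refine (h t ht).of_comp h1 fun k _ => ?_
    have e : besselSymbol (-r) k = besselSymbol (-(r - 1)) k * besselSymbol (-1) k := by
      rw [besselSymbol_mul]; ring_nf
    rw [e]
    push_cast
    ring

/-- With Λ = (1-∂ₓ²)^{1/2}, writing 1 + k² = 1 - (ik)² gives Λ^{m+1}u = JΛ^m u - ∂ₓJ Λ^m u_x, in
which J and ∂ₓJ are bounded. -/
lemma CurveH.exists_bessel (m : ℕ) : ∀ {u : ℝ → L2}, CurveH I m u → ∃ β : ℝ → L2,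
    ContinuousOn β I ∧ ∀ t ∈ I, HasMul (fun k => (besselSymbol m k : ℂ)) (u t) (β t) := by
  induction m with
  | zero => exact fun {u} hu => ⟨u, hu, fun t _ => by simpa using hasMul_bessel_zero (u t)⟩
  | succ m ih =>
    intro u hu
    obtain ⟨β₁, hβ₁, hm₁⟩ := ih hu.of_succ
    obtain ⟨h1, v, hv, hv'⟩ := hu
    obtain ⟨β₂, hβ₂, hm₂⟩ := ih hv'
    set D := mulOp (fun k => k * Complex.I * besselSymbol (-1) k) with hD
    refine ⟨fun t => besselJ (β₁ t) + (-1 : ℝ) • D (β₂ t),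
      (besselJ.continuous.comp_continuousOn hβ₁).add
        (((-1 : ℝ) • D).continuous.comp_continuousOn hβ₂), fun t ht => ?_⟩
    have e1 := (hm₁ t ht).comp (hasMul_besselJ (β₁ t)) fun k _ => rfl
    have e2 := (((hv t ht).comp (hm₂ t ht) fun k _ => rfl).comp
      (hasMul_mulOp isSymbol_der_bessel (β₂ t)) fun k _ => rfl)
    have e3 : HasMul (fun k => -((k * Complex.I * besselSymbol (-1) k) *
        (besselSymbol m k * (k * Complex.I)))) (u t) ((-1 : ℝ) • D (β₂ t)) := by
      filter_upwards [e2.smul (-1), e2, Lp.coeFn_smul (-1 : ℝ) (hat (D (β₂ t)))] with ξ _ h2 h3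
      rw [map_smul, h3, Pi.smul_apply, h2]
      simp
    refine (e1.add_symbol e3).congr fun k _ => ?_
    have b1 : besselSymbol ((m + 1 : ℕ) : ℝ) k =
        besselSymbol 2 k * (besselSymbol (-1) k * besselSymbol m k) := by
      rw [besselSymbol_mul, besselSymbol_mul]; push_cast; ring_nf
    rw [b1, besselSymbol_two]
    push_cast
    linear_combination (-(k : ℂ) ^ 2 * besselSymbol (-1) k * besselSymbol m k) * Complex.I_sq

end

/-! ### Linear inhomogeneous equations -/

section
variable {E : Type*} [NormedAddCommGroup E] [NormedSpace ℝ E]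

/-- Variation of constants with the exponential of the bounded operator A. -/
lemma exists_linear_solution [CompleteSpace E] (A : E →L[ℝ] E) {β : ℝ → E} {S : Set ℝ} (hS : IsOpen S) (hc : S.OrdConnected) (h0 : 0 ∈ S)
    (hβ : ContinuousOn β S) (x₀ : E) : ∃ X : ℝ → E, X 0 = x₀ ∧
      ∀ t ∈ S, HasDerivAt X (A (X t) + β t) t := by
  set Θ : ℝ → E →L[ℝ] E := fun t => NormedSpace.exp (t • A) with hΘ
  have hΘd : ∀ t, HasDerivAt Θ (A * Θ t) t := fun t => hasDerivAt_exp_smul_const' A t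
  have hΘc : Continuous Θ := continuous_iff_continuousAt.2 fun t => (hΘd t).continuousAt
  have hΘΘ : ∀ t, Θ t * Θ (-t) = 1 := fun t => by
    let _ : NormedAlgebra ℚ (E →L[ℝ] E) := NormedAlgebra.restrictScalars ℚ ℝ _
    rw [hΘ]
    simp only
    rw [← NormedSpace.exp_add_of_commute]
    · rw [← add_smul, add_neg_cancel, zero_smul, NormedSpace.exp_zero]
    · exact ((Commute.refl A).smul_left t).smul_right (-t)
  have hγ : ContinuousOn (fun τ => Θ (-τ) (β τ)) S :=
    ((hΘc.comp continuous_neg).continuousOn).clm_apply hβ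
  refine ⟨fun t => Θ t (x₀ + ∫ τ in (0 : ℝ)..t, Θ (-τ) (β τ)), ?_, fun t ht => ?_⟩
  · simp [hΘ, NormedSpace.exp_zero]
  · have hi := (intervalIntegral.integral_hasDerivAt_right (a := 0) (b := t)
      ((hγ.mono (hc.uIcc_subset h0 ht)).intervalIntegrable)
      (hγ.stronglyMeasurableAtFilter hS t ht)
      (hγ.continuousAt (hS.mem_nhds ht))).const_add x₀
    refine ((hΘd t).clm_apply hi).congr_deriv ?_
    have h1 : Θ t (Θ (-t) (β t)) = β t := by
      have := congrArg (fun T : E →L[ℝ] E => T (β t)) (hΘΘ t)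
      simpa using this
    rw [h1]
    rfl

lemma linear_solution_unique (A : E →L[ℝ] E) {β : ℝ → E} {S : Set ℝ} (hS : IsOpen S)
    (hc : S.OrdConnected) (h0 : 0 ∈ S) {X Y : ℝ → E}
    (hX : ∀ t ∈ S, HasDerivAt X (A (X t) + β t) t)
    (hY : ∀ t ∈ S, HasDerivAt Y (A (Y t) + β t) t) (h : X 0 = Y 0) : EqOn X Y S := by
  intro t ht
  have hmin : min 0 t ∈ S := by rcases min_choice 0 t with e | e <;> rwa [e]
  have hmax : max 0 t ∈ S := by rcases max_choice 0 t with e | e <;> rwa [e]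
  obtain ⟨a, ha, ha'⟩ := exists_Ioc_subset_of_mem_nhds (hS.mem_nhds hmin) (exists_lt _)
  obtain ⟨b, hb, hb'⟩ := exists_Ico_subset_of_mem_nhds (hS.mem_nhds hmax) (exists_gt _)
  obtain ⟨ha0, hat⟩ := lt_min_iff.1 ha
  obtain ⟨hb0, hbt⟩ := max_lt_iff.1 hb
  have hsub : Ioo a b ⊆ S := by
    intro x hx
    rcases le_total x (min 0 t) with h1 | h1
    · exact ha' ⟨hx.1, h1⟩
    rcases le_total (max 0 t) x with h2 | h2
    · exact hb' ⟨h2, hx.2⟩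
    exact hc.out hmin hmax ⟨h1, h2⟩
  exact ODE_solution_unique_of_mem_Ioo (v := fun t x => A x + β t) (s := fun _ => univ)
    (K := ‖A‖₊ + 0)
    (fun _ _ => (A.lipschitz.add (LipschitzWith.const _)).lipschitzOnWith) ⟨ha0, hb0⟩
    (fun t ht => ⟨hX t (hsub ht), mem_univ _⟩) (fun t ht => ⟨hY t (hsub ht), mem_univ _⟩) h
    ⟨hat, hbt⟩

end

/-! ### Propagation of regularity -/

/-- `D(k) = k² (1 + k²)^{r/2} / P(k)²`. -/
def symD (κ r k : ℝ) : ℝ := k ^ 2 * besselSymbol r k / dispSq κ k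

/-- The corresponding operator. -/
def opD (κ r : ℝ) : L2 →L[ℝ] L2 := mulOp (fun k => (symD κ r k : ℂ))

section
variable {κ : ℝ} (hκ : 0 < κ)
include hκ

/-- P² has degree four and k² degree two, so the forcing gains two derivatives. -/
lemma isSymbol_symD {r : ℝ} (hr : r ≤ 2) : IsSymbol (fun k => (symD κ r k : ℂ)) where
  toIsHerm := isHerm_ofReal (by
    have := measurable_besselSymbol r
    unfold symD dispSq
    fun_prop) fun k => by
      simp [symD, dispSq, besselSymbol_neg_arg, show (-k) ^ 4 = k ^ 4 by ring]
  bdd := ⟨1 + 1 / κ, fun k => by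
    have hP := dispSq_pos hκ k
    have hb := besselSymbol_pos r k
    rw [Complex.norm_real, Real.norm_of_nonneg (by unfold symD; positivity)]
    refine le_trans ?_ (symN_sq_le hκ k)
    rw [symN_sq hκ, symD]
    have := besselSymbol_mono hr k
    gcongr⟩

lemma hasMul_opD {r : ℝ} (hr : r ≤ 2) (u : L2) : HasMul (fun k => (symD κ r k : ℂ)) u (opD κ r u) :=
  hasMul_mulOp (isSymbol_symD hκ hr) u

lemma opN_besselJ (u : L2) : opN κ (besselJ u) = besselJ (opN κ u) :=
  ((hasMul_besselJ u).comp (hasMul_opN hκ _) fun _ _ => rfl).unique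
    ((hasMul_opN hκ u).comp (hasMul_besselJ _) fun _ _ => by ring)

/-- The multiplier N²J² has symbol k²/P², the coefficient of f in the equation solved for u_tt. -/
lemma besselJ_opN_sq_besselJ (u : L2) : besselJ (opN κ (opN κ (besselJ u))) = opD κ 0 u := by
  refine (((hasMul_besselJ u).comp (hasMul_opN_sq hκ _) fun _ _ => rfl).comp (hasMul_besselJ _)
    fun _ _ => rfl).unique ((hasMul_opD hκ (by norm_num) u).congr fun k _ => ?_)
  have e : besselSymbol (-1) k * (besselSymbol 2 k * besselSymbol (-1) k) = besselSymbol 0 k := by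
    rw [besselSymbol_mul, besselSymbol_mul]; norm_num
  have e2 : symD κ 0 k = besselSymbol (-1) k * (symN κ k ^ 2 * besselSymbol (-1) k) := by
    rw [symN_sq hκ, symD, ← e]
    ring
  rw [e2]
  push_cast
  ring

/-- The linear equation commutes with multipliers. It is solved in L² for the unknown Λ^r u, whose
forcing is bounded when r ≤ ρ + 2; applying Λ^{-r} and using uniqueness in L² identifies the result
with u. -/
lemma exists_regular_of_forcing {S : Set ℝ} (hS : IsOpen S) (hc : S.OrdConnected) (h0 : 0 ∈ S) {u y f β : ℝ → L2} {r ρ : ℝ}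
    (hr : 0 ≤ r) (hρ : r ≤ ρ + 2)
    (hu : ∀ t ∈ S, HasDerivAt u (y t) t)
    (hy : ∀ t ∈ S, HasDerivAt y (-opN κ (opN κ (u t)) - opD κ 0 (f t)) t)
    (hβ : ContinuousOn β S)
    (hf : ∀ t ∈ S, HasMul (fun k => (besselSymbol ρ k : ℂ)) (f t) (β t)) {w₀ w₁ : L2}
    (h₀ : HasMul (fun k => (besselSymbol r k : ℂ)) (u 0) w₀)
    (h₁ : HasMul (fun k => (besselSymbol r k : ℂ)) (y 0) w₁) :
    ∃ W V B : ℝ → L2, W 0 = w₀ ∧ V 0 = w₁ ∧ ContinuousOn B S ∧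
      (∀ t ∈ S, HasDerivAt W (V t) t) ∧ (∀ t ∈ S, HasDerivAt V (B t) t) ∧
      ∀ t ∈ S, HasMul (fun k => (besselSymbol (-r) k : ℂ)) (W t) (u t) := by
  set A : L2 × L2 →L[ℝ] L2 × L2 :=
    (ContinuousLinearMap.snd ℝ L2 L2).prod
      (-((opN κ).comp ((opN κ).comp (ContinuousLinearMap.fst ℝ L2 L2)))) with hA
  set F : ℝ → L2 := fun t => -opD κ (r - ρ) (β t) with hF
  have hFc : ContinuousOn F S := ((opD κ (r - ρ)).continuous.comp_continuousOn hβ).neg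
  obtain ⟨X, hX0, hX⟩ := exists_linear_solution A hS hc h0
    (β := fun t => ((0 : L2), F t)) (continuousOn_const.prodMk hFc) (w₀, w₁)
  set R := mulOp (fun k => (besselSymbol (-r) k : ℂ)) with hR
  have hRm := hasMul_mulOp (isSymbol_bessel (s := -r) (by linarith))
  have hW : ∀ t ∈ S, HasDerivAt (fun t => (X t).1) (X t).2 t := fun t ht => by
    have := ((hX t ht).hasFDerivAt.fst).hasDerivAt
    simpa [hA] using this
  have hV : ∀ t ∈ S, HasDerivAt (fun t => (X t).2)
      (-opN κ (opN κ (X t).1) + F t) t := fun t ht => by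
    have := ((hX t ht).hasFDerivAt.snd).hasDerivAt
    simpa [hA] using this
  have hRN : ∀ w, R (opN κ (opN κ w)) = opN κ (opN κ (R w)) := fun w =>
    ((hasMul_opN_sq hκ w).comp (hRm _) fun _ _ => rfl).unique
      ((hRm w).comp (hasMul_opN_sq hκ _) fun _ _ => by ring)
  have hRF : ∀ t ∈ S, R (F t) = -opD κ 0 (f t) := fun t ht => by
    rw [hF]
    simp only [map_neg]
    congr 1
    refine (((hf t ht).comp (hasMul_opD hκ (r := r - ρ) (by linarith) _) fun _ _ => rfl).comp
      (hRm _) fun _ _ => rfl).unique ((hasMul_opD hκ (by norm_num) _).congr fun k _ => ?_)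
    have e : besselSymbol (-r) k * (besselSymbol (r - ρ) k * besselSymbol ρ k) =
        besselSymbol 0 k := by
      rw [besselSymbol_mul, besselSymbol_mul]; ring_nf
    rw [symD, symD, ← e]
    push_cast
    ring
  have key : EqOn (fun t => (R (X t).1, R (X t).2)) (fun t => (u t, y t)) S := by
    refine linear_solution_unique A (β := fun t => ((0 : L2), -opD κ 0 (f t))) hS hc h0
      (fun t ht => ?_) (fun t ht => ?_) ?_
    · refine ((R.hasFDerivAt.comp_hasDerivAt t (hW t ht)).prodMk
        (R.hasFDerivAt.comp_hasDerivAt t (hV t ht))).congr_deriv ?_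
      simp [hA, hRN, hRF t ht]
    · refine ((hu t ht).prodMk (hy t ht)).congr_deriv ?_
      simp [hA, sub_eq_add_neg]
    · simp only [hX0]
      rw [(hRm w₀).unique h₀.bessel_symm, (hRm w₁).unique h₁.bessel_symm]
  refine ⟨fun t => (X t).1, fun t => (X t).2, fun t => -opN κ (opN κ (X t).1) + F t, by simp [hX0],
    by simp [hX0], ?_, hW, hV, fun t ht => ?_⟩
  · refine ContinuousOn.add (ContinuousOn.neg ((opN κ).continuous.comp_continuousOn
      ((opN κ).continuous.comp_continuousOn fun t ht => ?_))) hFc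
    exact (hW t ht).continuousAt.continuousWithinAt
  · have := congrArg Prod.fst (key ht)
    simp only at this
    rw [← this]
    exact hRm _

/-- Bootstrap: if u is a continuous curve in H^{m+1} with m ≤ p, so is f(u), and the linear equation
then puts u in H^r for every r ≤ s with r ≤ m + 3. No time is lost, since the equation with f(u)
regarded as a known forcing is linear. -/
theorem exists_regular {α p s : ℝ} {S : Set ℝ} (hp : 0 < p) (hs : 1 ≤ s) (hsp : s ≤ (⌊p⌋ : ℝ) + 3)
    (hS : IsOpen S) (hc : S.OrdConnected) (h0 : 0 ∈ S) {U Z : ℝ → L2} (hU : ∀ t ∈ S, HasDerivAt U (opN κ (Z t)) t)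
    (hZ : ∀ t ∈ S, HasDerivAt Z (-opN κ (U t + besselJ (nl α p (U t)))) t) {w₀ w₁ : L2}
    (h₀ : HasMul (fun k => (besselSymbol s k : ℂ)) (besselJ (U 0)) w₀)
    (h₁ : HasMul (fun k => (besselSymbol s k : ℂ)) (besselJ (opN κ (Z 0))) w₁) :
    ∃ W V B : ℝ → L2, W 0 = w₀ ∧ V 0 = w₁ ∧ ContinuousOn B S ∧
      (∀ t ∈ S, HasDerivAt W (V t) t) ∧ (∀ t ∈ S, HasDerivAt V (B t) t) ∧
      ∀ t ∈ S, HasMul (fun k => (besselSymbol (-s) k : ℂ)) (W t) (besselJ (U t)) := by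
  set u : ℝ → L2 := fun t => besselJ (U t) with hu
  set y : ℝ → L2 := fun t => besselJ (opN κ (Z t)) with hy
  have hud : ∀ t ∈ S, HasDerivAt u (y t) t := fun t ht =>
    besselJ.hasFDerivAt.comp_hasDerivAt t (hU t ht)
  have hyd : ∀ t ∈ S,
      HasDerivAt y (-opN κ (opN κ (u t)) - opD κ 0 (nem (nonlin α p) (u t))) t := by
    intro t ht
    refine ((besselJ.comp (opN κ)).hasFDerivAt.comp_hasDerivAt t (hZ t ht)).congr_deriv ?_
    rw [ContinuousLinearMap.comp_apply, ← besselJ_opN_sq_besselJ hκ, hu]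
    simp only [map_neg, map_add, opN_besselJ hκ, nl]
    abel
  have step : ∀ m : ℕ, (m : ℝ) ≤ p → CurveH S (m + 1) u → ∀ r : ℝ, 0 ≤ r → r ≤ s →
      r ≤ m + 3 → ∃ W V B : ℝ → L2, W 0 = mulOp (fun k => (besselSymbol (r - s) k : ℂ)) w₀ ∧
      V 0 = mulOp (fun k => (besselSymbol (r - s) k : ℂ)) w₁ ∧ ContinuousOn B S ∧
      (∀ t ∈ S, HasDerivAt W (V t) t) ∧ (∀ t ∈ S, HasDerivAt V (B t) t) ∧
      ∀ t ∈ S, HasMul (fun k => (besselSymbol (-r) k : ℂ)) (W t) (u t) := by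
    intro m hm hcu r hr hrs hrm
    obtain ⟨β, hβ, hβ'⟩ := (hcu.nonlin (a := α) hp hm).exists_bessel
    exact exists_regular_of_forcing hκ hS hc h0 hr (by push_cast; linarith) hud hyd hβ hβ'
      (h₀.bessel_mono hrs) (h₁.bessel_mono hrs)
  have claim : ∀ m : ℕ, (m : ℝ) + 1 ≤ s → (m : ℝ) ≤ p → CurveH S (m + 1) u := by
    intro m
    induction m with
    | zero =>
      intro _ _
      exact CurveH.of_bessel 1 (r := 1) (W := U) (by simp)
        (fun t ht => (hU t ht).continuousAt.continuousWithinAt) fun t _ => hasMul_besselJ (U t)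
    | succ m ih =>
      intro h1 h2
      push_cast at h1 h2
      have hm : (0 : ℝ) ≤ m := m.cast_nonneg
      obtain ⟨W, V, B, -, -, -, hW, -, hWu⟩ := step m (by linarith) (ih (by linarith) (by linarith))
        (min s (m + 3)) (le_min (by linarith) (by linarith)) (min_le_left _ _) (min_le_right _ _)
      exact CurveH.of_bessel _ (le_min (by push_cast; linarith) (by push_cast; linarith))
        (fun t ht => (hW t ht).continuousAt.continuousWithinAt) hWu
  obtain ⟨m, hm1, hm2, hm3⟩ : ∃ m : ℕ, (m : ℝ) + 1 ≤ s ∧ (m : ℝ) ≤ p ∧ s ≤ m + 3 := by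
    -- The largest m allowed by both constraints: if s - 1 is limiting then s < m + 2, and if p is
    -- limiting then m = [p] and s ≤ [p] + 3.
    refine ⟨min ⌊s - 1⌋₊ ⌊p⌋₊, ?_, ?_, ?_⟩
    · have h1 : ((min ⌊s - 1⌋₊ ⌊p⌋₊ : ℕ) : ℝ) ≤ ⌊s - 1⌋₊ := by exact_mod_cast min_le_left _ _
      have := Nat.floor_le (show 0 ≤ s - 1 by linarith)
      linarith
    · have h1 : ((min ⌊s - 1⌋₊ ⌊p⌋₊ : ℕ) : ℝ) ≤ ⌊p⌋₊ := by exact_mod_cast min_le_right _ _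
      exact h1.trans (Nat.floor_le hp.le)
    · rcases min_choice ⌊s - 1⌋₊ ⌊p⌋₊ with h | h <;> rw [h]
      · have := Nat.lt_floor_add_one (s - 1)
        linarith
      · rwa [natCast_floor_eq_intCast_floor hp.le]
  obtain ⟨W, V, B, hW0, hV0, hrest⟩ := step m hm2 (claim m hm1 hm2) s (by linarith) le_rfl hm3
  refine ⟨W, V, B, ?_, ?_, hrest⟩
  · rw [hW0, sub_self]
    exact (hasMul_mulOp (isSymbol_bessel le_rfl) w₀).unique (hasMul_bessel_zero w₀)
  · rw [hV0, sub_self]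
    exact (hasMul_mulOp (isSymbol_bessel le_rfl) w₁).unique (hasMul_bessel_zero w₁)

end

end GBq
end

open MeasureTheory Set
open scoped FourierTransform ContDiff

noncomputable section

namespace GBq

/-! ### The Bessel potential as an isometry of `H^s(ℝ)` onto `L²(ℝ)` -/

lemma Hs.toL2_injective {s : ℝ} : Function.Injective (Hs.toL2 (s := s)) :=
  Subtype.val_injective

lemma exists_hasMul_of_symbolMul {m : ℝ → ℝ} (hm : Measurable m) (hm' : ∀ k, m (-k) = m k) {u : L2}
    (h : MemLp (symbolMul m u) 2 volume) : ∃ v, HasMul (fun k => (m k : ℂ)) u v :=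
  exists_hasMul (isHerm_ofReal hm hm') u h

lemma Hs.exists_bessel {s : ℝ} (u : Hs s) :
    ∃ w, HasMul (fun k => (besselSymbol s k : ℂ)) u.toL2 w :=
  exists_hasMul_of_symbolMul (measurable_besselSymbol s) (besselSymbol_neg_arg s) u.memLp

lemma HasMul.norm_eq {m : ℝ → ℝ} {u v : L2} (h : HasMul (fun k => (m k : ℂ)) u v) :
    (eLpNorm (symbolMul m u) 2 volume).toReal = ‖v‖ := by
  rw [← norm_hat, Lp.norm_def]
  congr 1
  refine eLpNorm_congr_ae ?_
  filter_upwards [h] with ξ hξ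
  rw [hξ]
  rfl

/-- `(1 - ∂ₓ²)^{s/2} : H^s(ℝ) → L²(ℝ)`. -/
def Hs.bessel (s : ℝ) : Hs s →L[ℝ] L2 :=
  LinearMap.mkContinuous
    { toFun := fun u => u.exists_bessel.choose
      map_add' := fun u v => (u + v).exists_bessel.choose_spec.unique
        (u.exists_bessel.choose_spec.add v.exists_bessel.choose_spec)
      map_smul' := fun c u => (c • u).exists_bessel.choose_spec.unique
        (u.exists_bessel.choose_spec.smul c) } 1 fun u => by
    rw [one_mul, Hs.norm_eq, sobolevNorm, u.exists_bessel.choose_spec.norm_eq]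
    exact le_rfl

lemma Hs.hasMul_bessel {s : ℝ} (u : Hs s) :
    HasMul (fun k => (besselSymbol s k : ℂ)) u.toL2 (Hs.bessel s u) :=
  u.exists_bessel.choose_spec

lemma Hs.norm_bessel {s : ℝ} (u : Hs s) : ‖Hs.bessel s u‖ = ‖u‖ := by
  rw [Hs.norm_eq, sobolevNorm, u.hasMul_bessel.norm_eq]

lemma mem_sobolevSubmodule {s : ℝ} {u w : L2} (h : HasMul (fun k => (besselSymbol s k : ℂ)) u w) :
    u ∈ sobolevSubmodule s :=
  (memLp_congr_ae h).1 (Lp.memLp (hat w))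

section
variable {s : ℝ} (hs : 0 ≤ s)

include hs in
lemma hasMul_mulOp_bessel_neg (w : L2) : HasMul (fun k => (besselSymbol s k : ℂ))
    (mulOp (fun k => (besselSymbol (-s) k : ℂ)) w) w := by
  have := (hasMul_mulOp (isSymbol_bessel (s := -s) (by linarith)) w).bessel_symm
  rwa [neg_neg] at this

/-- `(1 - ∂ₓ²)^{-s/2} : L²(ℝ) → H^s(ℝ)`. -/
def Hs.ofBessel : L2 →L[ℝ] Hs s :=
  LinearMap.mkContinuous
    { toFun := fun w => (⟨mulOp (fun k => (besselSymbol (-s) k : ℂ)) w,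
        mem_sobolevSubmodule (hasMul_mulOp_bessel_neg hs w)⟩ : sobolevSubmodule s)
      map_add' := fun u v => Subtype.ext (map_add _ u v)
      map_smul' := fun c u => Subtype.ext (map_smul _ c u) } 1 fun w => by
    rw [one_mul, Hs.norm_eq, sobolevNorm]
    exact (hasMul_mulOp_bessel_neg hs w).norm_eq.le

lemma Hs.toL2_ofBessel (w : L2) :
    (Hs.ofBessel hs w).toL2 = mulOp (fun k => (besselSymbol (-s) k : ℂ)) w := rfl

lemma Hs.ofBessel_bessel (u : Hs s) : Hs.ofBessel hs (Hs.bessel s u) = u := by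
  apply Hs.toL2_injective
  rw [Hs.toL2_ofBessel]
  exact (hasMul_mulOp (isSymbol_bessel (s := -s) (by linarith)) _).unique u.hasMul_bessel.bessel_symm

end

/-- `(1 - ∂ₓ²)^{1/2} : H^s(ℝ) → L²(ℝ)`, for `s ≥ 1`. -/
def Hs.besselOne (s : ℝ) : Hs s →L[ℝ] L2 :=
  (mulOp (fun k => (besselSymbol (1 - s) k : ℂ))).comp (Hs.bessel s)

lemma Hs.hasMul_besselOne {s : ℝ} (hs : 1 ≤ s) (u : Hs s) :
    HasMul (fun k => (besselSymbol 1 k : ℂ)) u.toL2 (Hs.besselOne s u) :=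
  u.hasMul_bessel.bessel_mono hs

lemma besselJ_eq_of_hasMul {u U : L2} (h : HasMul (fun k => (besselSymbol 1 k : ℂ)) u U) :
    besselJ U = u :=
  (hasMul_besselJ U).unique h.bessel_symm

lemma Hs.besselJ_besselOne {s : ℝ} (hs : 1 ≤ s) (u : Hs s) :
    besselJ (Hs.besselOne s u) = u.toL2 :=
  besselJ_eq_of_hasMul (u.hasMul_besselOne hs)

lemma Hs.norm_besselOne_le {s : ℝ} (hs : 1 ≤ s) (u : Hs s) : ‖Hs.besselOne s u‖ ≤ ‖u‖ := by
  rw [← u.norm_bessel]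
  have := (u.hasMul_besselOne hs).norm_le u.hasMul_bessel (C := 1) fun k _ => by
    rw [Complex.norm_real, Complex.norm_real, Real.norm_of_nonneg (besselSymbol_pos _ _).le,
      Real.norm_of_nonneg (besselSymbol_pos _ _).le, one_mul]
    exact besselSymbol_mono hs k
  rwa [one_mul] at this

lemma besselJ_injective : Function.Injective besselJ := fun U V h =>
  HasMul.eq_of_ne_zero (fun k _ => by
    exact_mod_cast (besselSymbol_pos (-1) k).ne') (hasMul_besselJ U) (h ▸ hasMul_besselJ V)

/-! ### The equation -/

section
variable {κ : ℝ} (hκ : 0 < κ)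
include hκ

/-- The weak form of the equation, solved for `u_tt`. -/
lemma weak_equation_iff {u w f : L2} :
    (∀ φ : ℝ → ℝ, ContDiff ℝ ∞ φ → HasCompactSupport φ →
      ∫ x, w x * φ x = ∫ x, (u x * (iteratedDeriv 2 φ x - iteratedDeriv 4 φ x)
        + w x * (iteratedDeriv 2 φ x - κ * iteratedDeriv 4 φ x) + f x * iteratedDeriv 2 φ x)) ↔
      w = -opN κ (opN κ u) - opD κ 0 f := by
  -- The equation sorted by order of differentiation: w - ∂ₓ²(u + w + f) + ∂ₓ⁴(u + κw) = 0.
  set z : ℕ → L2 := fun j => if j = 0 then w else if j = 2 then -(u + w + f) else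
    if j = 4 then u + κ • w else 0 with hz
  have z0 : z 0 = w := by simp [hz]
  have z1 : z 1 = 0 := by simp [hz]
  have z2 : z 2 = -(u + w + f) := by simp [hz]
  have z3 : z 3 = 0 := by simp [hz]
  have z4 : z 4 = u + κ • w := by simp [hz]
  have key2 : ∀ φ : ℝ → ℝ, ContDiff ℝ ∞ φ → HasCompactSupport φ →
      (∑ j ∈ Finset.range 5, ∫ x, z j x * iteratedDeriv j φ x = 0 ↔
      ∫ x, w x * φ x = ∫ x, (u x * (iteratedDeriv 2 φ x - iteratedDeriv 4 φ x)
        + w x * (iteratedDeriv 2 φ x - κ * iteratedDeriv 4 φ x) + f x * iteratedDeriv 2 φ x)) := by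
    intro φ hφ hc
    have hint : ∀ (v : L2) (j : ℕ), Integrable fun x => v x * iteratedDeriv j φ x := by
      intro v j
      have h1 : Continuous (iteratedDeriv j φ) := hφ.continuous_iteratedDeriv j (by exact_mod_cast le_top)
      have h2 : HasCompactSupport (iteratedDeriv j φ) := by
        induction j with
        | zero => simpa using hc
        | succ j ih =>
          rw [iteratedDeriv_succ]
          exact (ih (hφ.continuous_iteratedDeriv j (by exact_mod_cast le_top))).deriv
      simpa [mul_comm] using
        (L2.locallyIntegrable v).integrable_smul_right_of_hasCompactSupport h1 h2
    have e2 : ∫ x, z 2 x * iteratedDeriv 2 φ x = -((∫ x, u x * iteratedDeriv 2 φ x) +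
        (∫ x, w x * iteratedDeriv 2 φ x) + ∫ x, f x * iteratedDeriv 2 φ x) := by
      have i1 : Integrable fun x => u x * iteratedDeriv 2 φ x + w x * iteratedDeriv 2 φ x :=
        (hint u 2).add (hint w 2)
      rw [← integral_add (hint u 2) (hint w 2), ← integral_add i1 (hint f 2), ← integral_neg, z2]
      apply integral_congr_ae
      filter_upwards [Lp.coeFn_neg (u + w + f), Lp.coeFn_add (u + w) f, Lp.coeFn_add u w]
        with x h1 h2 h3
      rw [h1, Pi.neg_apply, h2, Pi.add_apply, h3, Pi.add_apply]
      ring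
    have e4 : ∫ x, z 4 x * iteratedDeriv 4 φ x = (∫ x, u x * iteratedDeriv 4 φ x) +
        κ * ∫ x, w x * iteratedDeriv 4 φ x := by
      rw [← integral_const_mul, ← integral_add (hint u 4) ((hint w 4).const_mul κ), z4]
      apply integral_congr_ae
      filter_upwards [Lp.coeFn_add u (κ • w), Lp.coeFn_smul κ w] with x h1 h2
      rw [h1, Pi.add_apply, h2, Pi.smul_apply, smul_eq_mul]
      ring
    have ez : ∀ j, ∫ x, (0 : L2) x * iteratedDeriv j φ x = 0 := fun j => by simp
    have er : ∫ x, (u x * (iteratedDeriv 2 φ x - iteratedDeriv 4 φ x)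
        + w x * (iteratedDeriv 2 φ x - κ * iteratedDeriv 4 φ x) + f x * iteratedDeriv 2 φ x) =
        (∫ x, u x * iteratedDeriv 2 φ x) - (∫ x, u x * iteratedDeriv 4 φ x) +
        ((∫ x, w x * iteratedDeriv 2 φ x) - κ * ∫ x, w x * iteratedDeriv 4 φ x) +
        ∫ x, f x * iteratedDeriv 2 φ x := by
      have i1 : Integrable fun x => u x * iteratedDeriv 2 φ x - u x * iteratedDeriv 4 φ x :=
        (hint u 2).sub (hint u 4)
      have i2 : Integrable fun x => w x * iteratedDeriv 2 φ x - κ * (w x * iteratedDeriv 4 φ x) :=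
        (hint w 2).sub ((hint w 4).const_mul κ)
      have i3 : Integrable fun x => (u x * iteratedDeriv 2 φ x - u x * iteratedDeriv 4 φ x) +
          (w x * iteratedDeriv 2 φ x - κ * (w x * iteratedDeriv 4 φ x)) := i1.add i2
      rw [← integral_const_mul, ← integral_sub (hint u 2) (hint u 4),
        ← integral_sub (hint w 2) ((hint w 4).const_mul κ), ← integral_add i1 i2,
        ← integral_add i3 (hint f 2)]
      refine integral_congr_ae (Filter.Eventually.of_forall fun x => ?_)
      ring
    have e0 : ∫ x, z 0 x * iteratedDeriv 0 φ x = ∫ x, w x * φ x := by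
      rw [z0, iteratedDeriv_zero]
    simp only [Finset.sum_range_succ, Finset.sum_range_zero]
    rw [e0, e2, e4, z1, z3, ez, ez, er]
    constructor <;> intro h <;> linarith
  have key : (∀ᵐ ξ : ℝ, ∑ j ∈ Finset.range 5,
      (-(2 * Real.pi * ξ * Complex.I)) ^ j * hat (z j) ξ = 0) ↔
      w = -opN κ (opN κ u) - opD κ 0 f := by
    -- The symbol relation factors through P(k)² > 0, so it can be solved for w.
    have hF : ∀ᵐ ξ : ℝ, (∑ j ∈ Finset.range 5,
        (-(2 * Real.pi * ξ * Complex.I)) ^ j * hat (z j) ξ) =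
        (dispSq κ (2 * Real.pi * ξ) : ℂ) * (hat w ξ - hat (-opN κ (opN κ u) - opD κ 0 f) ξ) := by
      simp only [Finset.sum_range_succ, Finset.sum_range_zero]
      rw [z0, z1, z2, z3, z4]
      simp only [map_neg, map_add, map_smul, map_zero, map_sub]
      filter_upwards [Lp.coeFn_neg (hat u + hat w + hat f), Lp.coeFn_add (hat u + hat w) (hat f),
        Lp.coeFn_add (hat u) (hat w), Lp.coeFn_add (hat u) (κ • hat w), Lp.coeFn_smul κ (hat w),
        Lp.coeFn_zero ℂ 2 (volume : Measure ℝ),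
        Lp.coeFn_sub (-hat (opN κ (opN κ u))) (hat (opD κ 0 f)),
        Lp.coeFn_neg (hat (opN κ (opN κ u))), hasMul_opN_sq hκ u,
        hasMul_opD hκ (r := 0) (by norm_num) f] with ξ h1 h2 h3 h4 h5 h6 h7 h8 h9 h10
      rw [h1, Pi.neg_apply, h2, Pi.add_apply, h3, Pi.add_apply, h4, Pi.add_apply, h5, Pi.smul_apply,
        h6, h7, Pi.sub_apply, h8, Pi.neg_apply, h9, h10]
      set k := 2 * Real.pi * ξ with hk
      have hP : (dispSq κ k : ℂ) ≠ 0 := by exact_mod_cast (dispSq_pos hκ k).ne'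
      have hk' : (2 * Real.pi * ξ : ℂ) = (k : ℂ) := by rw [hk]; push_cast; ring
      have hP' : (dispSq κ k : ℂ) = 1 + k ^ 2 + κ * k ^ 4 := by rw [dispSq]; push_cast; ring
      rw [hk', symN_sq hκ, symD, besselSymbol_two, besselSymbol_zero, Complex.real_smul]
      push_cast
      have e1 : (dispSq κ k : ℂ) * (hat w ξ - (-((k : ℂ) ^ 2 * (1 + k ^ 2) / dispSq κ k * hat u ξ) -
          (k : ℂ) ^ 2 * 1 / dispSq κ k * hat f ξ)) =
          dispSq κ k * hat w ξ + (k : ℂ) ^ 2 * (1 + k ^ 2) * hat u ξ + (k : ℂ) ^ 2 * hat f ξ := by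
        field_simp
        ring
      rw [e1, hP']
      simp only [Pi.zero_apply]
      have i4 : Complex.I ^ 4 = 1 := Complex.I_pow_four
      linear_combination (-(k : ℂ) ^ 2 * (hat u ξ + hat w ξ + hat f ξ)) * Complex.I_sq +
        ((k : ℂ) ^ 4 * (hat u ξ + κ * hat w ξ)) * i4
    constructor
    · intro h
      apply hat_injective
      apply Lp.ext
      filter_upwards [h, hF] with ξ h1 h2
      rw [h1, eq_comm, mul_eq_zero] at h2
      rcases h2 with h2 | h2
      · exact absurd h2 (by exact_mod_cast (dispSq_pos hκ _).ne')
      · exact sub_eq_zero.1 h2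
    · intro h
      filter_upwards [hF] with ξ h2
      rw [h2, ← h, sub_self, mul_zero]
  rw [← key]
  constructor
  · intro h
    exact hat_of_integral_test fun φ hφ hc => (key2 φ hφ hc).2 (h φ hφ hc)
  · intro h φ hφ hc
    exact (key2 φ hφ hc).1 (integral_test_of_hat h hφ hc)

end

end GBq
end

open MeasureTheory Set
open scoped FourierTransform ContDiff

noncomputable section

namespace GBq

/-! ### Solutions of the equation and of the Hamiltonian system -/

section
variable {κ a p s : ℝ} (hκ : 0 < κ) (hp : 0 < p)
include hκ hp

/-- The weak form of the equation for `u = JU`. -/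
lemma weak_equation_nl_iff {U u w : L2} (hu : besselJ U = u) :
    (∀ φ : ℝ → ℝ, ContDiff ℝ ∞ φ → HasCompactSupport φ →
      ∫ x, w x * φ x = ∫ x, (u x * (iteratedDeriv 2 φ x - iteratedDeriv 4 φ x)
        + w x * (iteratedDeriv 2 φ x - κ * iteratedDeriv 4 φ x)
        + nonlin a p (u x) * iteratedDeriv 2 φ x)) ↔
      w = besselJ (-opN κ (opN κ (U + besselJ (nl a p U)))) := by
  subst hu
  have e : besselJ (-opN κ (opN κ (U + besselJ (nl a p U)))) =
      -opN κ (opN κ (besselJ U)) - opD κ 0 (nl a p U) := by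
    rw [← besselJ_opN_sq_besselJ hκ]
    simp only [map_neg, map_add, opN_besselJ hκ]
    abel
  rw [e, ← weak_equation_iff hκ]
  refine forall_congr' fun φ => forall_congr' fun _ => forall_congr' fun _ => ?_
  have e1 : ∫ x, (besselJ U x * (iteratedDeriv 2 φ x - iteratedDeriv 4 φ x)
      + w x * (iteratedDeriv 2 φ x - κ * iteratedDeriv 4 φ x)
      + nonlin a p (besselJ U x) * iteratedDeriv 2 φ x) =
      ∫ x, (besselJ U x * (iteratedDeriv 2 φ x - iteratedDeriv 4 φ x)
      + w x * (iteratedDeriv 2 φ x - κ * iteratedDeriv 4 φ x)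
      + nl a p U x * iteratedDeriv 2 φ x) := by
    apply integral_congr_ae
    filter_upwards [nl_coeFn (a := a) hp U] with x hx
    rw [hx]
  rw [e1]

/-- Any solution of the equation comes from the Hamiltonian system. -/
lemma IsSolution.besselJ_eq (hs : 1 ≤ s) {u₀ u₁ : Hs s} {v : ℝ → Hs s} {T T' : ℝ} (hTT : T ≤ T')
    (hv : IsSolution κ a p u₀ u₁ (Ico 0 T') v) {U Z : ℝ → L2}
    (hU : ∀ t ∈ Ico 0 T, HasDerivAt U (opN κ (Z t)) t)
    (hZ : ∀ t ∈ Ico 0 T, HasDerivAt Z (-opN κ (U t + besselJ (nl a p (U t)))) t)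
    (hU0 : besselJ (U 0) = u₀.toL2) (hZ0 : besselJ (opN κ (Z 0)) = u₁.toL2)
    (hlip : LipOnBalls (nl a p)) :
    ∀ t ∈ Ico 0 T, (v t).toL2 = besselJ (U t) := by
  rcases le_or_gt T 0 with hT | hT
  · exact fun t ht => absurd (ht.1.trans_lt ht.2) (not_lt.2 hT)
  set I := Ico 0 T' with hI
  have hT' : 0 < T' := hT.trans_le hTT
  have hu : UniqueDiffOn ℝ I := uniqueDiffOn_Ico 0 T'
  have hsub : Ico 0 T ⊆ I := Ico_subset_Ico_right hTT
  set E := Hs.besselOne s with hE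
  have hJE := fun u : Hs s => Hs.besselJ_besselOne hs u
  set v' := derivWithin v I with hv'
  set v'' := derivWithin v' I with hv''
  have hd1 : ∀ t ∈ I, HasDerivWithinAt v (v' t) I t := fun t ht =>
    ((hv.contDiffOn.differentiableOn (by norm_num)) t ht).hasDerivWithinAt
  have hd2 : ∀ t ∈ I, HasDerivWithinAt v' (v'' t) I t := fun t ht =>
    (((hv.contDiffOn.derivWithin hu (m := 1) (by norm_num)).differentiableOn (by norm_num))
      t ht).hasDerivWithinAt
  have heq : ∀ t ∈ I, E (v'' t) = -opN κ (opN κ (E (v t) + besselJ (nl a p (E (v t))))) :=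
    fun t ht => besselJ_injective
      ((hJE _).trans ((weak_equation_nl_iff hκ hp (hJE (v t))).1 (hv.equation t ht)))
  -- The comparison uses the pair (U, U') instead of (U, Z): for an arbitrary solution |k|⁻¹u_t is
  -- not known to be in L² at positive times, so Z need not be defined for it in advance.
  set F : L2 × L2 → L2 × L2 :=
    fun X => (X.2, -opN κ (opN κ (X.1 + besselJ (nl a p X.1)))) with hF
  have hFl : LipOnBalls F := by
    intro R
    obtain ⟨K, hK⟩ := hlip R
    have hf : LipschitzOnWith (K * 1) (fun X : L2 × L2 => nl a p X.1) (Metric.closedBall 0 R) := by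
      refine hK.comp LipschitzWith.prod_fst.lipschitzOnWith fun X hX => ?_
      rw [mem_closedBall_zero_iff] at hX ⊢
      exact (norm_fst_le X).trans hX
    have h2 := LipschitzWith.prod_fst.lipschitzOnWith (s := Metric.closedBall 0 R) |>.add
      (besselJ.lipschitz.comp_lipschitzOnWith hf)
    exact ⟨_, LipschitzWith.prod_snd.lipschitzOnWith.prodMk ((opN κ).lipschitz.comp_lipschitzOnWith
      ((opN κ).lipschitz.comp_lipschitzOnWith h2)).neg⟩
  have hEv : ∀ t ∈ I, HasDerivWithinAt (fun t => (E (v t), E (v' t)))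
      (F (E (v t), E (v' t))) I t := fun t ht => by
    refine ((E.hasFDerivAt.comp_hasDerivWithinAt t (hd1 t ht)).prodMk
      (E.hasFDerivAt.comp_hasDerivWithinAt t (hd2 t ht))).congr_deriv ?_
    simp only [hF, heq t ht]
  have hUZ : ∀ t ∈ Ico 0 T, HasDerivAt (fun t => (U t, opN κ (Z t))) (F (U t, opN κ (Z t))) t :=
    fun t ht => by
      refine ((hU t ht).prodMk ((opN κ).hasFDerivAt.comp_hasDerivAt t (hZ t ht))).congr_deriv ?_
      simp only [hF, map_neg]
  have hcmp := hFl.eqOn_Ico (T := T) (f := fun t => (E (v t), E (v' t)))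
    (g := fun t => (U t, opN κ (Z t)))
    (fun t ht => ((hEv t (hsub ht)).continuousWithinAt).mono hsub)
    (fun t ht => (hUZ t ht).continuousAt.continuousWithinAt)
    -- Derivatives within [0, T') restrict to right derivatives, which is all that uniqueness
    -- requires.
    (fun t ht => (hEv t (hsub ht)).mono_of_mem_nhdsWithin (by
      have : Ico t T' ⊆ I := Ico_subset_Ico_left ht.1
      exact Filter.mem_of_superset (Ico_mem_nhdsGE (hsub ht).2) this))
    (fun t ht => (hUZ t ht).hasDerivWithinAt) (by
      simp only [Prod.mk.injEq]
      constructor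
      · apply besselJ_injective
        rw [hU0, hJE, hv.initial]
      · apply besselJ_injective
        rw [hZ0, hJE, hv', hv.initial_deriv])
  intro t ht
  rw [← hJE (v t)]
  exact congrArg besselJ (congrArg Prod.fst (hcmp ht))

/-- A solution of the Hamiltonian system with regular data gives a solution of the equation. -/
lemma exists_isSolution (hs : 1 ≤ s) (hsp : s ≤ (⌊p⌋ : ℝ) + 3) {u₀ u₁ : Hs s} {S I : Set ℝ}
    (hS : IsOpen S) (hc : S.OrdConnected) (hIS : I ⊆ S) (hu : UniqueDiffOn ℝ I) (h0 : 0 ∈ I)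
    {U Z : ℝ → L2} (hU : ∀ t ∈ S, HasDerivAt U (opN κ (Z t)) t)
    (hZ : ∀ t ∈ S, HasDerivAt Z (-opN κ (U t + besselJ (nl a p (U t)))) t)
    (hU0 : besselJ (U 0) = u₀.toL2) (hZ0 : besselJ (opN κ (Z 0)) = u₁.toL2) :
    ∃ u : ℝ → Hs s, IsSolution κ a p u₀ u₁ I u ∧ ∀ t ∈ I, (u t).toL2 = besselJ (U t) := by
  have hs0 : 0 ≤ s := by linarith
  obtain ⟨W, V, B, hW0, hV0, hB, hW, hV, hWU⟩ := exists_regular (α := a) hκ hp hs hsp hS hc (hIS h0)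
    hU hZ (w₀ := Hs.bessel s u₀) (w₁ := Hs.bessel s u₁) (by rw [hU0]; exact u₀.hasMul_bessel)
    (by rw [hZ0]; exact u₁.hasMul_bessel)
  -- W and its derivatives are continuous in L²; the isometry Λ^{-s} : L² → H^s carries them to a C²
  -- curve in H^s.
  set O := Hs.ofBessel hs0 with hO
  set R := mulOp (fun k => (besselSymbol (-s) k : ℂ)) with hR
  have hRW : EqOn (fun t => R (W t)) (fun t => besselJ (U t)) S := fun t ht =>
    (hasMul_mulOp (isSymbol_bessel (s := -s) (by linarith)) (W t)).unique (hWU t ht)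
  have hRV : EqOn (fun t => R (V t)) (fun t => besselJ (opN κ (Z t))) S := fun t ht => by
    have h1 := R.hasFDerivAt.comp_hasDerivAt t (hW t ht)
    have h2 := besselJ.hasFDerivAt.comp_hasDerivAt t (hU t ht)
    exact h1.unique (h2.congr_of_eventuallyEq (hRW.eventuallyEq_of_mem (hS.mem_nhds ht)))
  -- The second derivative is identified in L² by uniqueness of derivatives, S being open.
  have hRB : ∀ t ∈ S, R (B t) = besselJ (-opN κ (opN κ (U t + besselJ (nl a p (U t))))) :=
    fun t ht => by
      have h1 := R.hasFDerivAt.comp_hasDerivAt t (hV t ht)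
      have h2 := (besselJ.comp (opN κ)).hasFDerivAt.comp_hasDerivAt t (hZ t ht)
      have h3 := h1.unique (h2.congr_of_eventuallyEq (hRV.eventuallyEq_of_mem (hS.mem_nhds ht)))
      rw [h3, ContinuousLinearMap.comp_apply, map_neg]
  have hOW : ∀ t ∈ S, HasDerivAt (fun t => O (W t)) (O (V t)) t := fun t ht =>
    O.hasFDerivAt.comp_hasDerivAt t (hW t ht)
  have hOV : ∀ t ∈ S, HasDerivAt (fun t => O (V t)) (O (B t)) t := fun t ht =>
    O.hasFDerivAt.comp_hasDerivAt t (hV t ht)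
  have e1 : EqOn (derivWithin (fun t => O (W t)) I) (fun t => O (V t)) I := fun t ht =>
    (hOW t (hIS ht)).hasDerivWithinAt.derivWithin (hu t ht)
  have e2 : EqOn (derivWithin (derivWithin (fun t => O (W t)) I) I) (fun t => O (B t)) I :=
    fun t ht => by
      rw [derivWithin_congr e1 (e1 ht)]
      exact (hOV t (hIS ht)).hasDerivWithinAt.derivWithin (hu t ht)
  refine ⟨fun t => O (W t), ⟨?_, ?_, ?_, ?_⟩, fun t ht => hRW (hIS ht)⟩
  · rw [show (2 : WithTop ℕ∞) = 1 + 1 by norm_num, contDiffOn_succ_iff_derivWithin hu]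
    refine ⟨fun t ht => (hOW t (hIS ht)).differentiableAt.differentiableWithinAt, by simp, ?_⟩
    refine ContDiffOn.congr ?_ e1
    rw [contDiffOn_one_iff_derivWithin hu]
    refine ⟨fun t ht => (hOV t (hIS ht)).differentiableAt.differentiableWithinAt, ?_⟩
    refine ContinuousOn.congr ?_ fun t ht =>
      (hOV t (hIS ht)).hasDerivWithinAt.derivWithin (hu t ht)
    exact O.continuous.comp_continuousOn (hB.mono hIS)
  · simp only [hW0, hO, Hs.ofBessel_bessel]
  · rw [e1 h0]
    simp only [hV0, hO, Hs.ofBessel_bessel]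
  · intro t ht
    have h1 : (O (B t)).toL2 = besselJ (-opN κ (opN κ (U t + besselJ (nl a p (U t))))) :=
      hRB t (hIS ht)
    have h2 : besselJ (U t) = (O (W t)).toL2 := (hRW (hIS ht)).symm
    rw [e2 ht]
    exact (weak_equation_nl_iff hκ hp h2).2 h1

end

/-! ### Initial data and energy -/

/-- Additivity of quadratic forms of multipliers. -/
lemma inner_add_of_symbols {m m₁ m₂ : ℝ → ℝ} {κ : ℝ} {u v Zu Zv u₁ v₁ u₂ v₂ : L2}
    (hu : HasMul (fun k => (m k : ℂ)) u Zu) (hv : HasMul (fun k => (m k : ℂ)) v Zv)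
    (hu₁ : HasMul (fun k => (m₁ k : ℂ)) u u₁) (hv₁ : HasMul (fun k => (m₁ k : ℂ)) v v₁)
    (hu₂ : HasMul (fun k => (m₂ k : ℂ)) u u₂) (hv₂ : HasMul (fun k => (m₂ k : ℂ)) v v₂)
    (hm : ∀ k ≠ 0, m₁ k ^ 2 + κ * m₂ k ^ 2 + 1 = m k ^ 2) :
    (inner ℝ u₁ v₁ : ℝ) + κ * inner ℝ u₂ v₂ + inner ℝ u v = inner ℝ Zu Zv := by
  have hint : ∀ w z : L2, Integrable fun ξ => (hat w ξ * (starRingEnd ℂ) (hat z ξ)).re :=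
    fun w z => (L2.integrable_inner (𝕜 := ℂ) (hat z) (hat w)).re
  have i1 : Integrable fun ξ => (hat u₁ ξ * (starRingEnd ℂ) (hat v₁ ξ)).re +
      κ * (hat u₂ ξ * (starRingEnd ℂ) (hat v₂ ξ)).re := (hint u₁ v₁).add ((hint u₂ v₂).const_mul κ)
  rw [inner_eq_integral_hat, inner_eq_integral_hat, inner_eq_integral_hat, inner_eq_integral_hat,
    ← integral_const_mul, ← integral_add (hint u₁ v₁) ((hint u₂ v₂).const_mul κ),
    ← integral_add i1 (hint u v)]
  apply integral_congr_ae
  filter_upwards [hu, hv, hu₁, hv₁, hu₂, hv₂, Measure.ae_ne volume (0 : ℝ)]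
    with ξ h1 h2 h3 h4 h5 h6 h7
  have hmul : ∀ (c : ℝ) (x y : ℂ), ((c : ℂ) * x * (starRingEnd ℂ) ((c : ℂ) * y)).re =
      c ^ 2 * (x * (starRingEnd ℂ) y).re := by
    intro c x y
    have : (c : ℂ) * x * (starRingEnd ℂ) ((c : ℂ) * y) =
        ((c ^ 2 : ℝ) : ℂ) * (x * (starRingEnd ℂ) y) := by
      rw [map_mul, Complex.conj_ofReal]; push_cast; ring
    rw [this, Complex.re_ofReal_mul]
  simp only [h1, h2, h3, h4, h5, h6, hmul]
  rw [← hm (2 * Real.pi * ξ) (by simp [h7, Real.pi_ne_zero])]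
  ring

/-- The symbol `P(k) / |k|`. -/
def symQ (κ k : ℝ) : ℝ := Real.sqrt (dispSq κ k) * |k|⁻¹

section
variable {κ : ℝ} (hκ : 0 < κ)
include hκ

lemma symQ_sq {k : ℝ} (hk : k ≠ 0) : (|k|⁻¹) ^ 2 + κ * |k| ^ 2 + 1 = symQ κ k ^ 2 := by
  rw [symQ, mul_pow, Real.sq_sqrt (dispSq_pos hκ k).le, inv_pow, sq_abs, dispSq]
  field_simp
  ring

/-- P/|k| is dominated by |k|⁻¹ + (1 + k²)^{1/2}, because its square is k⁻² + κk² + 1. -/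
lemma exists_hasMul_symQ {u A U : L2} (hA : HasMul (fun k => ((|k|⁻¹ : ℝ) : ℂ)) u A)
    (hU : HasMul (fun k => (besselSymbol 1 k : ℂ)) u U) :
    ∃ Z, HasMul (fun k => (symQ κ k : ℂ)) u Z := by
  refine exists_hasMul_of_le (isHerm_ofReal ?_ fun k => ?_) (hA.add_symbol hU)
    (C := 1 + Real.sqrt κ) fun k hk => ?_
  · unfold symQ dispSq; fun_prop
  · simp [symQ, dispSq, show (-k) ^ 4 = k ^ 4 by ring]
  · have hb := besselSymbol_pos 1 k
    have hk' : 0 < |k| := abs_pos.2 hk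
    have hκ' := Real.sqrt_pos.2 hκ
    rw [← Complex.ofReal_add, Complex.norm_real, Complex.norm_real, Real.norm_of_nonneg (by
      unfold symQ; positivity), Real.norm_of_nonneg (by positivity)]
    refine abs_le_of_sq_le_sq ?_ (by positivity) |> (le_abs_self _).trans
    rw [← symQ_sq hκ hk]
    have e1 : besselSymbol 1 k ^ 2 = 1 + |k| ^ 2 := by
      rw [sq, besselSymbol_mul, sq_abs]; norm_num [besselSymbol_two]
    have e2 : Real.sqrt κ ^ 2 = κ := Real.sq_sqrt hκ.le
    have e3 : ((1 + Real.sqrt κ) * (|k|⁻¹ + besselSymbol 1 k)) ^ 2 =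
        (1 + 2 * Real.sqrt κ + κ) * ((|k|⁻¹) ^ 2 + 2 * (|k|⁻¹ * besselSymbol 1 k) + (1 + |k| ^ 2)) := by
      rw [← e1]; linear_combination (|k|⁻¹ + besselSymbol 1 k) ^ 2 * e2
    rw [e3]
    have p1 : 0 ≤ |k|⁻¹ * besselSymbol 1 k := by positivity
    have p2 : 0 ≤ (|k|⁻¹) ^ 2 := by positivity
    have p3 : 0 ≤ |k| ^ 2 := by positivity
    nlinarith [mul_nonneg hκ.le p1, mul_nonneg hκ.le p2, mul_nonneg hκ'.le p1,
      mul_nonneg hκ'.le p2, mul_nonneg hκ'.le p3]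

lemma hasMul_opN_symQ {u U Z : L2} (hU : HasMul (fun k => (besselSymbol 1 k : ℂ)) u U)
    (hZ : HasMul (fun k => (symQ κ k : ℂ)) u Z) : opN κ Z = U := by
  refine (hZ.comp (hasMul_opN hκ Z) fun _ _ => rfl).unique (hU.congr fun k hk => ?_)
  have hk' : |k| ≠ 0 := abs_ne_zero.2 hk
  have hP : Real.sqrt (dispSq κ k) ≠ 0 := (Real.sqrt_pos.2 (dispSq_pos hκ k)).ne'
  rw [← Complex.ofReal_mul, symN, symQ]
  congr 1
  field_simp

omit hκ in
lemma exists_hasMul_abs {u U : L2} (hU : HasMul (fun k => (besselSymbol 1 k : ℂ)) u U) :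
    ∃ D, HasMul (fun k => ((|k| : ℝ) : ℂ)) u D := by
  refine exists_hasMul_of_le (isHerm_ofReal (by fun_prop) fun k => by simp) hU (C := 1) fun k _ => ?_
  rw [Complex.norm_real, Complex.norm_real, one_mul, Real.norm_of_nonneg (abs_nonneg _),
    Real.norm_of_nonneg (besselSymbol_pos _ _).le, besselSymbol, ← Real.sqrt_eq_rpow]
  exact Real.abs_le_sqrt (by linarith)

/-- P²/k² = k⁻² + κk² + 1 collects the three terms of the pairing, so that ‖Z‖² is twice the kinetic
energy. -/
lemma kineticPairing_eq {u v Zu Zv Au Av Uu Uv : L2}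
    (hu : HasMul (fun k => (symQ κ k : ℂ)) u Zu) (hv : HasMul (fun k => (symQ κ k : ℂ)) v Zv)
    (hAu : HasMul (fun k => ((|k|⁻¹ : ℝ) : ℂ)) u Au) (hAv : HasMul (fun k => ((|k|⁻¹ : ℝ) : ℂ)) v Av)
    (hUu : HasMul (fun k => (besselSymbol 1 k : ℂ)) u Uu)
    (hUv : HasMul (fun k => (besselSymbol 1 k : ℂ)) v Uv) :
    kineticPairing κ u v = inner ℝ Zu Zv := by
  obtain ⟨Du, hDu⟩ := exists_hasMul_abs hUu
  obtain ⟨Dv, hDv⟩ := exists_hasMul_abs hUv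
  have h1 : HasMul (fun _ => ((1 : ℝ) : ℂ)) u u := by simpa using hasMul_one u
  have h1' : HasMul (fun _ => ((1 : ℝ) : ℂ)) v v := by simpa using hasMul_one v
  rw [kineticPairing, pairing_eq_inner hAu hAv, pairing_eq_inner hDu hDv, pairing_eq_inner h1 h1']
  exact inner_add_of_symbols hu hv hAu hAv hDu hDv fun k hk => symQ_sq hκ hk

lemma energy_eq_wellEnergy {a p : ℝ} {u v U Z A V : L2}
    (hU : HasMul (fun k => (besselSymbol 1 k : ℂ)) u U)
    (hZ : HasMul (fun k => (symQ κ k : ℂ)) v Z) (hA : HasMul (fun k => ((|k|⁻¹ : ℝ) : ℂ)) v A)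
    (hV : HasMul (fun k => (besselSymbol 1 k : ℂ)) v V) :
    energy κ a p u v = wellEnergy (pot a p) U Z := by
  obtain ⟨D, hD⟩ := exists_hasMul_abs hU
  have h1 : HasMul (fun _ => ((1 : ℝ) : ℂ)) u u := by simpa using hasMul_one u
  have e : ‖u‖ ^ 2 + ‖D‖ ^ 2 = ‖U‖ ^ 2 := hU.norm_sq_add (hasMul_one u) hD fun k _ => by
    rw [Complex.norm_real, Complex.norm_real, norm_one, Real.norm_eq_abs, Real.norm_eq_abs, sq_abs,
      sq_abs, sq_abs, sq (besselSymbol 1 k), besselSymbol_mul]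
    norm_num [besselSymbol_two]
  rw [energy, kineticPairing_eq hκ hZ hZ hA hA hV hV, pairing_eq_inner h1 h1,
    pairing_eq_inner hD hD, real_inner_self_eq_norm_sq, real_inner_self_eq_norm_sq,
    real_inner_self_eq_norm_sq, wellEnergy, pot, besselJ_eq_of_hasMul hU, ← e]
  ring

/-- The range of `N(D)` is dense. -/
lemma exists_opN_sub_small (U : L2) {δ : ℝ} (hδ : 0 < δ) : ∃ W Y, ‖W‖ ≤ δ ∧ opN κ Y = U - W := by
  have hinj : ∀ x, opN κ x = 0 → x = 0 := fun x hx => by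
    refine HasMul.eq_of_ne_zero (fun k hk => ?_) (hasMul_opN hκ x) ?_
    · have hP := Real.sqrt_pos.2 (dispSq_pos hκ k)
      have hb := besselSymbol_pos 1 k
      have hk' : 0 < |k| := abs_pos.2 hk
      have : 0 < symN κ k := by unfold symN; positivity
      exact_mod_cast this.ne'
    · rw [hx]
      have := hasMul_opN hκ 0
      rwa [map_zero] at this
  -- N is symmetric, so a vector orthogonal to its range is annihilated by N, hence zero.
  have hdense : (LinearMap.range (opN κ : L2 →ₗ[ℝ] L2)).topologicalClosure = ⊤ := by
    rw [Submodule.topologicalClosure_eq_top_iff, Submodule.eq_bot_iff]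
    intro x hx
    apply hinj
    have h := (Submodule.mem_orthogonal _ _).1 hx (opN κ (opN κ x)) ⟨opN κ x, rfl⟩
    rw [inner_opN hκ, real_inner_self_eq_norm_sq] at h
    simpa using h
  have hmem : U ∈ closure (LinearMap.range (opN κ : L2 →ₗ[ℝ] L2) : Set L2) := by
    rw [← Submodule.topologicalClosure_coe, hdense]
    trivial
  obtain ⟨_, ⟨Y, rfl⟩, hY⟩ := Metric.mem_closure_iff.1 hmem δ hδ
  refine ⟨U - opN κ Y, Y, ?_, by abel⟩
  rw [← dist_eq_norm]
  exact hY.le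

end

end GBq
end

open MeasureTheory Set
open scoped FourierTransform ContDiff

noncomputable section

namespace GBq

/-! ### From the Hamiltonian flow to global and blow-up solutions in H^s -/

section
variable {κ a p s : ℝ} (ha : 0 < a) (hp : 0 < p) (hκ : 0 < κ) (hs : 1 ≤ s)
  (hsp : s ≤ (⌊p⌋ : ℝ) + 3) {u₀ u₁ : Hs s} {U Z : ℝ → L2}
  (hU0 : besselJ (U 0) = u₀.toL2) (hZ0 : besselJ (opN κ (Z 0)) = u₁.toL2)
include ha hp hκ hs hsp hU0 hZ0

/-- The flow in L² lifts to H^s without loss of lifespan, and every other solution follows the same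
flow. -/
lemma exists_global_solution {ε : ℝ} (hε : 0 < ε)
    (hU : ∀ t, -ε < t → HasDerivAt U (opN κ (Z t)) t)
    (hZ : ∀ t, -ε < t → HasDerivAt Z (-opN κ (U t + besselJ (nl a p (U t)))) t) :
    ∃ u : ℝ → Hs s, IsSolution κ a p u₀ u₁ (Ici 0) u ∧
      ∀ T : ℝ, 0 < T → ∀ v : ℝ → Hs s,
        IsSolution κ a p u₀ u₁ (Ico 0 T) v → EqOn v u (Ico 0 T) := by
  have hI : Ici (0 : ℝ) ⊆ Ioi (-ε) := fun t ht => lt_of_lt_of_le (neg_lt_zero.2 hε) ht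
  obtain ⟨u, hu, hueq⟩ := exists_isSolution hκ hp hs hsp isOpen_Ioi ordConnected_Ioi hI
    (uniqueDiffOn_Ici 0) self_mem_Ici hU hZ hU0 hZ0
  refine ⟨u, hu, fun T _ v hv t ht => Hs.toL2_injective ?_⟩
  rw [hueq t ht.1]
  exact hv.besselJ_eq hκ hp hs le_rfl (fun t ht => hU t (hI ht.1)) (fun t ht => hZ t (hI ht.1))
    hU0 hZ0 (isWell hκ ha hp).lip t ht

/-- Since ‖U‖ = ‖u‖_1 ≤ ‖u‖_s, unboundedness in the energy space forces unboundedness in H^s, and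
conversely no solution in H^s can outlive the L² flow. -/
lemma exists_blowup_solution {ε T : ℝ} (hε : 0 < ε) (hT : 0 < T)
    (hU : ∀ t ∈ Ioo (-ε) T, HasDerivAt U (opN κ (Z t)) t)
    (hZ : ∀ t ∈ Ioo (-ε) T, HasDerivAt Z (-opN κ (U t + besselJ (nl a p (U t)))) t)
    (hunb : ∀ M, ¬ ∀ t ∈ Ico 0 T, ‖U t‖ ≤ M) :
    ∃ u : ℝ → Hs s, IsSolution κ a p u₀ u₁ (Ico 0 T) u ∧
      ¬ BddAbove ((fun t => ‖u t‖ + ‖derivWithin u (Ico 0 T) t‖) '' Ico 0 T) ∧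
      ∀ T' : ℝ, 0 < T' → ∀ v : ℝ → Hs s,
        IsSolution κ a p u₀ u₁ (Ico 0 T') v → T' ≤ T ∧ EqOn v u (Ico 0 T') := by
  have hI : Ico 0 T ⊆ Ioo (-ε) T := fun t ht => ⟨lt_of_lt_of_le (neg_lt_zero.2 hε) ht.1, ht.2⟩
  obtain ⟨u, hu, hueq⟩ := exists_isSolution hκ hp hs hsp isOpen_Ioo ordConnected_Ioo hI
    (uniqueDiffOn_Ico 0 T) ⟨le_rfl, hT⟩ hU hZ hU0 hZ0
  have hle : ∀ (w : Hs s) (t : ℝ), w.toL2 = besselJ (U t) → ‖U t‖ ≤ ‖w‖ := fun w t h => by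
    rw [← Hs.besselJ_besselOne hs] at h
    rw [← besselJ_injective h]
    exact w.norm_besselOne_le hs
  have hcmp : ∀ τ ≤ T, ∀ T' v, τ ≤ T' → IsSolution κ a p u₀ u₁ (Ico 0 T') v →
      ∀ t ∈ Ico 0 τ, (v t).toL2 = besselJ (U t) := fun τ hτ T' v hτ' hv =>
    hv.besselJ_eq hκ hp hs hτ' (fun t ht => hU t (hI ⟨ht.1, ht.2.trans_le hτ⟩))
      (fun t ht => hZ t (hI ⟨ht.1, ht.2.trans_le hτ⟩)) hU0 hZ0 (isWell hκ ha hp).lip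
  refine ⟨u, hu, ?_, fun T' _ v hv => ?_⟩
  · rintro ⟨M, hM⟩
    refine hunb M fun t ht => (hle _ t (hueq t ht)).trans ?_
    have := hM ⟨t, ht, rfl⟩
    simp only at this
    linarith [norm_nonneg (derivWithin u (Ico 0 T) t)]
  -- A solution reaching beyond T would be bounded in H^s on the compact interval [0, T], hence so
  -- would ‖U‖ on [0, T).
  · have hTT : T' ≤ T := by
      by_contra! hlt
      obtain ⟨M, hM⟩ := isCompact_Icc.exists_bound_of_continuousOn
        (hv.contDiffOn.continuousOn.mono (Icc_subset_Ico_right hlt))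
      exact hunb M fun t ht => (hle _ t (hcmp T le_rfl T' v hlt.le hv t ht)).trans
        (hM t (Ico_subset_Icc_self ht))
    refine ⟨hTT, fun t ht => Hs.toL2_injective ?_⟩
    rw [hueq t ⟨ht.1, ht.2.trans_le hTT⟩]
    exact hcmp T' hTT T' v le_rfl hv t ht

end

end GBq
end

theorem theorem2p9 (a p κ s : ℝ) (ha : 0 < a) (hp : 0 < p) (hκ : 0 < κ)
    (hs : 1 ≤ s) (hsp : s ≤ (⌊p⌋ : ℝ) + 3)
    (u₀ u₁ : GBq.Hs s) (hu₁ : GBq.InvSqrtLaplacianMem (s + 1) u₁.toL2)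
    (hE : GBq.energy κ a p u₀.toL2 u₁.toL2 ≤ GBq.e0 a p) :
    (GBq.sobolevNorm 1 u₀.toL2 ^ 2 ≤ 2 * (p + 2) * GBq.e0 a p / p →
      ∃ u : ℝ → GBq.Hs s, GBq.IsSolution κ a p u₀ u₁ (Set.Ici 0) u ∧
        ∀ T : ℝ, 0 < T → ∀ v : ℝ → GBq.Hs s,
          GBq.IsSolution κ a p u₀ u₁ (Set.Ico 0 T) v → Set.EqOn v u (Set.Ico 0 T)) ∧
    (2 * (p + 2) * GBq.e0 a p / p < GBq.sobolevNorm 1 u₀.toL2 ^ 2 →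
      (GBq.energy κ a p u₀.toL2 u₁.toL2 = GBq.e0 a p →
        GBq.InvSqrtLaplacianMem 0 u₀.toL2 ∧ 0 ≤ GBq.kineticPairing κ u₀.toL2 u₁.toL2) →
      ∃ T : ℝ, 0 < T ∧ ∃ u : ℝ → GBq.Hs s, GBq.IsSolution κ a p u₀ u₁ (Set.Ico 0 T) u ∧
        ¬ BddAbove ((fun t => ‖u t‖ + ‖derivWithin u (Set.Ico 0 T) t‖) '' Set.Ico 0 T) ∧
        ∀ T' : ℝ, 0 < T' → ∀ v : ℝ → GBq.Hs s,
          GBq.IsSolution κ a p u₀ u₁ (Set.Ico 0 T') v →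
            T' ≤ T ∧ Set.EqOn v u (Set.Ico 0 T')) := by
  open GBq in
  have hU₀ := u₀.hasMul_besselOne hs
  have hV₁ := u₁.hasMul_besselOne hs
  set U₀ := Hs.besselOne s u₀ with hU₀d
  obtain ⟨q, hq⟩ := exists_hasMul_of_symbolMul ((measurable_besselSymbol (s + 1)).mul (by fun_prop))
    (fun k => by simp [besselSymbol_neg_arg]) hu₁
  obtain ⟨A, hA⟩ : ∃ A, HasMul (fun k => ((|k|⁻¹ : ℝ) : ℂ)) u₁.toL2 A := by
    refine exists_hasMul_of_le (isHerm_ofReal (by fun_prop) fun k => by simp) hq (C := 1) fun k _ => ?_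
    rw [Complex.norm_real, Complex.norm_real, one_mul, Pi.mul_apply, norm_mul,
      Real.norm_of_nonneg (besselSymbol_pos _ k).le]
    refine le_mul_of_one_le_left (norm_nonneg _) ?_
    exact (besselSymbol_zero k).symm.trans_le (besselSymbol_mono (by linarith) k)
  -- The initial momentum is P|k|⁻¹ applied to u₁, so that N Z₀ = Λu₁ is the initial velocity of U.
  obtain ⟨Z₀, hZ₀⟩ := exists_hasMul_symQ hκ hA hV₁
  have hw := isWell hκ ha hp
  have hNZ : besselJ (opN κ Z₀) = u₁.toL2 := by
    rw [hasMul_opN_symQ hκ hV₁ hZ₀]; exact besselJ_eq_of_hasMul hV₁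
  have hJU : besselJ U₀ = u₀.toL2 := besselJ_eq_of_hasMul hU₀
  have hnorm : sobolevNorm 1 u₀.toL2 = ‖U₀‖ := hU₀.norm_eq
  have hthr : 2 * (p + 2) * e0 a p / p = wellRadius a p ^ 2 := by
    rw [e0_eq ha hp]; field_simp
  rw [hnorm, hthr]
  rw [energy_eq_wellEnergy hκ hU₀ hZ₀ hA hV₁, e0_eq ha hp] at *
  obtain ⟨ε, hε, hmax⟩ := (lipOnBalls_wellField (opN κ) besselJ hw.lip).exists_maximal (U₀, Z₀)
  have hfst : ∀ {f : ℝ → L2 × L2} {t : ℝ},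
      HasDerivAt f (wellField (opN κ) besselJ (nl a p) (f t)) t →
      HasDerivAt (fun t => (f t).1) (opN κ (f t).2) t := fun h => by
    simpa [wellField] using h.hasFDerivAt.fst.hasDerivAt
  have hsnd : ∀ {f : ℝ → L2 × L2} {t : ℝ},
      HasDerivAt f (wellField (opN κ) besselJ (nl a p) (f t)) t →
      HasDerivAt (fun t => (f t).2) (-opN κ ((f t).1 + besselJ (nl a p (f t).1))) t := fun h => by
    simpa [wellField] using h.hasFDerivAt.snd.hasDerivAt
  -- At energy at most e₀ a bound on U bounds Z, so at a finite end time it is U that becomes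
  -- unbounded.
  have hbdd : ∀ {f : ℝ → L2 × L2} {T : ℝ}, f 0 = (U₀, Z₀) →
      (∀ t ∈ Set.Ioo (-ε) T, HasDerivAt f (wellField (opN κ) besselJ (nl a p) (f t)) t) →
      ¬ BddAbove ((fun t => ‖f t‖) '' Set.Ico 0 T) → ∀ M, ¬ ∀ t ∈ Set.Ico 0 T, ‖(f t).1‖ ≤ M := by
    intro f T hf0 hf hnb M hM
    have hI : ∀ t ∈ Set.Ico 0 T, t ∈ Set.Ioo (-ε) T := fun t ht =>
      ⟨lt_of_lt_of_le (neg_lt_zero.2 hε) ht.1, ht.2⟩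
    obtain ⟨C, hC⟩ := hw.exists_bound (U := fun t => (f t).1) (Z := fun t => (f t).2)
      (fun t ht => hfst (hf t (hI t ht))) (fun t ht => hsnd (hf t (hI t ht)))
      (by simpa only [hf0] using hE) hM
    refine hnb ⟨max M C, ?_⟩
    rintro _ ⟨t, ht, rfl⟩
    exact max_le_max (hM t ht) (hC t ht)
  constructor
  · intro h0
    rcases hmax with ⟨f, hf0, hf⟩ | ⟨T, hT, f, hf0, hf, hnb⟩
    · exact exists_global_solution (U := fun t => (f t).1) (Z := fun t => (f t).2) ha hp hκ hs hsp
        (by simpa only [hf0] using hJU) (by simpa only [hf0] using hNZ) hε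
        (fun t ht => hfst (hf t ht)) fun t ht => hsnd (hf t ht)
    · refine absurd (fun t ht => ?_) (hbdd hf0 hf hnb (wellRadius a p))
      have hI : ∀ t ∈ Set.Ico 0 T, t ∈ Set.Ioo (-ε) T := fun t ht =>
        ⟨lt_of_lt_of_le (neg_lt_zero.2 hε) ht.1, ht.2⟩
      have := hw.le_radius (U := fun t => (f t).1) (Z := fun t => (f t).2)
        (fun t ht => hfst (hf t (hI t ht))) (fun t ht => hsnd (hf t (hI t ht)))
        (by simpa only [hf0] using hE) (by simpa only [hf0] using h0) ht
      exact (sq_le_sq₀ (norm_nonneg _) (wellRadius_pos ha hp).le).1 this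
  · intro h0 hcrit
    rcases hmax with ⟨f, hf0, hf⟩ | ⟨T, hT, f, hf0, hf, hnb⟩
    · exfalso
      have hpos : ∀ t ≥ (0 : ℝ), -ε < t := fun t ht => lt_of_lt_of_le (neg_lt_zero.2 hε) ht
      refine hw.not_global (U := fun t => (f t).1) (Z := fun t => (f t).2)
        (fun t ht => hfst (hf t (hpos t ht))) (fun t ht => hsnd (hf t (hpos t ht)))
        (by simpa only [hf0] using hE) (by simpa only [hf0] using h0)
        (fun _ δ hδ => exists_opN_sub_small hκ _ hδ) fun heq => ?_
      -- At critical energy |k|⁻¹u₀ ∈ L² provides an exact preimage Y of U₀ under N, and ⟨Y, Z₀⟩ is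
      -- the pairing assumed nonnegative.
      simp only [hf0] at heq ⊢
      obtain ⟨hinv, hpair⟩ := hcrit heq
      obtain ⟨A', hA'⟩ := exists_hasMul_of_symbolMul ((measurable_besselSymbol 0).mul (by fun_prop))
        (fun k => by simp [besselSymbol_neg_arg]) hinv
      have hA'' : HasMul (fun k => ((|k|⁻¹ : ℝ) : ℂ)) u₀.toL2 A' :=
        hA'.congr fun k _ => by rw [Pi.mul_apply, besselSymbol_zero, one_mul]
      obtain ⟨Y, hY⟩ := exists_hasMul_symQ hκ hA'' hU₀
      refine ⟨Y, hasMul_opN_symQ hκ hU₀ hY, ?_⟩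
      rwa [kineticPairing_eq hκ hY hZ₀ hA'' hA hU₀ hV₁] at hpair
    · exact ⟨T, hT, exists_blowup_solution (U := fun t => (f t).1) (Z := fun t => (f t).2) ha hp hκ hs
        hsp (by simpa only [hf0] using hJU) (by simpa only [hf0] using hNZ) hε hT
        (fun t ht => hfst (hf t ht)) (fun t ht => hsnd (hf t ht)) (hbdd hf0 hf hnb)⟩
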